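/- **Setting.** Let $m,r\ge 0$ be integers. Let $B$ be a unital $C^*$-algebra (trivially graded), faithfully and unitally represented by even operators on a $\mathbf Z_2$-graded Hilbert space $H_0$ that also carries odd skew-adjoint operators $\gamma_1,\dots,\gamma_r$ (the multigrading) which commute with $B$ and satisfy $\gamma_i\gamma_j+\gamma_j\gamma_i=-2\delta_{ij}$. Let $(\mathcal B,H_0,D_0)$ be an $r$-multigraded spectral triple: $\mathcal B\subset B$ is a dense unital $*$-subalgebra, and $D_0$ is an odd self-adjoint operator, anticommuting with the $\gamma_j$, such that every $b\in\mathcal B$ preserves $\operatorname{Dom}D_0$, $[D_0,b]$ is bounded and $b(D_0+i)^{-1}$ is compact. All commutators are supercommutators. Let $\beta:\mathbf Z^m\to\operatorname{Aut}(B)$ be an action that preserves $\mathcal B$ and is metrically equicontinuous: $\sup_{k}\|[D_0,\beta_k(b)]\|<\infty$ for all $b\in\mathcal B$. *The crossed product.* Let $V$ be an irreducible $\mathbf Z_2$-graded $*$-representation of $\mathbf{Cl}_m\mathbin{\widehat\otimes}\mathbf{Cl}((\mathbf R^m)^*)$ (generators are skew-adjoint and square to $-1$), with $c_0$ the action of $\mathbf{Cl}((\mathbf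 R^m)^*)$. Let $H=\ell^2(\mathbf Z^m,V\mathbin{\widehat\otimes}H_0)$, with $(U_t\xi)(p)=e^{2\pi i\langle p,t\rangle}\xi(p)$ for $t\in\mathbf T^m$. Let $\mathcal A$ be the algebraic crossed product of $\mathcal B$ by $\mathbf Z^m$, i.e. the span of the operators $b\lambda_k$, $b\in\mathcal B$, $k\in\mathbf Z^m$, where $(b\xi)(p)=(\mathrm{id}\mathbin{\widehat\otimes}\beta_p(b))\xi(p)$ and $(\lambda_k\xi)(p)=\xi(p-k)$; let $A$ be its norm closure, and $A^{\mathbf T^m}$, $\mathcal A^{\mathbf T^m}=\mathcal A\cap A^{\mathbf T^m}$ the elements commuting with all $U_t$. For a family $\mathfrak t=(\mathfrak t(p))_{p\in\mathbf Z^m}$ of bounded operators on $V\mathbin{\widehat\otimes}H_0$, let $\operatorname{Op}(\mathfrak t)$ be the closed operator $(\operatorname{Op}(\mathfrak t)\xi)(p)=\mathfrak t(p)\xi(p)$ on its maximal domain. Put $s(k)=-2\pi i\,c_0(k)$, $D_v=\operatorname{Op}(s\mathbin{\widehat\otimes}\mathrm{id})$, $D_h=\mathrm{id}\mathbin{\widehat\otimes}D_0$,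 $D=\overline{D_v+D_h}$. The multigrading of $H$ is by $\mathbf{Cl}_{m+r}$ ($\mathbf{Cl}_m$ acting on $V$, $\mathbf{Cl}_r$ on $H_0$), and the vertical Clifford action is $c=\mathrm{id}\mathbin{\widehat\otimes}c_0\mathbin{\widehat\otimes}\mathrm{id}$. Give $\operatorname{Dom}D_v$ the graph norm and $\mathbf L(\operatorname{Dom}D_v,H)$ the operator norm; let $\mathcal H=\operatorname{Dom}D\cap\mathcal A\cdot\operatorname{Dom}D_v$. *Gauge theory.* A relative gauge potential is an odd symmetric $\mathbf T^m$-invariant operator $\omega$ on $\mathcal H$ that supercommutes with the multigrading, with the vertical Clifford action and with $\mathcal A^{\mathbf T^m}$, such that for each $a\in\mathcal A$ the operator $[\omega,a]$ extends to an element of the norm closure of $A\cdot[D,\mathcal A^{\mathbf T^m}]$ (linear span) and $\omega a$ extends to an element of $\mathbf L(\operatorname{Dom}D_v,H)$. Let $\mathfrak{at}\subset\mathbf L(\operatorname{Dom}D_v,H)$ be the set of relative gauge potentials (identified with their continuous extensions), with the operator norm. Let $\mathfrak R$ be the real space of bounded odd self-adjoint $\mathbf T^m$-invariant operators on $H$ that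 supercommute with the multigrading, the vertical Clifford action and $\mathcal A^{\mathbf T^m}$. Let $\mathfrak G$ be the group of even $\mathbf T^m$-invariant unitaries $S$ on $H$ that supercommute with the multigrading, the vertical Clifford action and $A^{\mathbf T^m}$, with $S\mathcal AS^*=\mathcal A$ and $S\mathcal H=\mathcal H$, such that $[D,S]a$ extends to an element of $\mathbf L(\operatorname{Dom}D_v,H)$ for every $a\in\mathcal A$, and $[D,S]$ on $\mathcal H$ supercommutes with the vertical Clifford action and with $\mathcal A^{\mathbf T^m}$. The *gauge topology* of $\mathfrak G$ is the weakest one making $S\mapsto S\in\mathbf L(H)$ and $S\mapsto SDS^*-D\in\mathbf L(\operatorname{Dom}D_v,H)$ continuous for the norm topologies. *Cocycles.* Let $\Omega^1$ be the norm closure of the span of $B\cdot[D_0,\mathcal B]$, and $\Omega^1_{\mathrm{sa}}\cap\mathcal B'$ the real space of its self-adjoint elements commuting with $\mathcal B$. Assume: 1. there is a constant $C$ such that $\bigl\|\sum_i\beta_k(b_i)[D_0,\beta_k(b_i')]\bigr\|\le C\bigl\|\sum_i b_i[D_0,b_i']\bigr\|$ for all $k\in\mathbf Z^m$ and all finite families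 $b_i\in B$, $b_i'\in\mathcal B$; so $\beta$ descends to an action, also written $\beta$, of $\mathbf Z^m$ on $\Omega^1$ by uniformly bounded operators with $\beta_k(b[D_0,b'])=\beta_k(b)[D_0,\beta_k(b')]$; 2. $\Omega^1_{\mathrm{sa}}\cap\mathcal B'$ is invariant under this action. Let $Z_{D_0}(\mathcal B)=\{b\in Z(\mathcal B):[D_0,b]\in\mathcal B'\}$, with unitary group $U(Z_{D_0}(\mathcal B))$. Let $Z^1(\mathbf Z^m,\Omega^1_{\mathrm{sa}}\cap\mathcal B')$ be the space of maps with $\omega(k+l)=\omega(k)+\beta_k(\omega(l))$, with the norm $\|\omega\|=\sup_k(4\pi^2\|k\|^2+1)^{-1/2}\|\omega(k)\|$; let $B^1$ be its subspace of coboundaries $k\mapsto\beta_k(x)-x$, and $H^1=Z^1/B^1$. Let $Z^1(\mathbf Z^m,U(Z_{D_0}(\mathcal B)))$ be the group of maps with $\upsilon(k+l)=\upsilon(k)\beta_k(\upsilon(l))$. Let $\mathfrak r$ be the real normed space of odd self-adjoint bounded operators on $H_0$ supercommuting with $B$ and with the multigrading. Let $\mathfrak W$ be the group of even unitaries $w$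 on $H_0$ that supercommute with $\mathcal B$ and the multigrading, preserve $\operatorname{Dom}D_0$, and have $[D_0,w]$ bounded and supercommuting with $\mathcal B$. **Theorem.** 1. $\mathfrak{at}$ is a real vector space, the norm on $Z^1(\mathbf Z^m,\Omega^1_{\mathrm{sa}}\cap\mathcal B')$ is finite, and $\mathfrak F(\omega,M)=\operatorname{Op}(\mathrm{id}_V\mathbin{\widehat\otimes}(\omega+M))$ defines an isomorphism of normed real vector spaces (a linear bijection, bounded with bounded inverse) $$\mathfrak F:Z^1(\mathbf Z^m,\Omega^1_{\mathrm{sa}}\cap\mathcal B')\times\mathfrak r\to\mathfrak{at}.$$ The class of $\mathfrak F(\omega,M)$ modulo $\mathfrak{at}\cap\mathfrak R$ depends only on the class of $\omega$ in $H^1$, and $\mathfrak F$ induces a linear surjection $H^1(\mathbf Z^m,\Omega^1_{\mathrm{sa}}\cap\mathcal B')\to\mathfrak{at}/(\mathfrak{at}\cap\mathfrak R)$. 2. $\mathfrak U(\upsilon,w)=\operatorname{Op}(\mathrm{id}_V\mathbin{\widehat\otimes}w\upsilon)$ defines an isomorphism of groups $$\mathfrak U:Z^1(\mathbf Z^m,U(Z_{D_0}(\mathcal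 B)))\times\mathfrak W\to\mathfrak G.$$ It is an isomorphism of topological groups (a) for the gauge topologies: on $\mathfrak G$ as above, on $Z^1(\mathbf Z^m,U(Z_{D_0}(\mathcal B)))$ the weakest topology making $\upsilon\mapsto\upsilon\in\ell^\infty(\mathbf Z^m,\mathbf L(H_0))$ and $\upsilon\mapsto\upsilon[D_0,\upsilon^*]\in Z^1(\mathbf Z^m,\Omega^1_{\mathrm{sa}}\cap\mathcal B')$ continuous, and on $\mathfrak W$ the weakest topology making $w\mapsto w$ and $w\mapsto w[D_0,w^*]$ norm continuous; and (b) for the topology of $\ell^\infty(\mathbf Z^m,\mathbf L(H_0))$ on $Z^1(\mathbf Z^m,U(Z_{D_0}(\mathcal B)))$ and the operator norm topologies on $\mathfrak W$ and $\mathfrak G$. 3. For all $(\omega,M)\in Z^1(\mathbf Z^m,\Omega^1_{\mathrm{sa}}\cap\mathcal B')\times\mathfrak r$ and $(\upsilon,w)\in Z^1(\mathbf Z^m,U(Z_{D_0}(\mathcal B)))\times\mathfrak W$, with $S=\mathfrak U(\upsilon,w)$, $$S[D,S^*]+S\,\mathfrak F(\omega,M)\,S^*=\mathfrak F\bigl(\omega+\upsilon[D_0,\upsilon^*],\;w[D_0,w^*]+wMw^*\bigr)\quad\text{on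 }\operatorname{Dom}D,$$ where $\omega+\upsilon[D_0,\upsilon^*]$ lies in $Z^1(\mathbf Z^m,\Omega^1_{\mathrm{sa}}\cap\mathcal B')$ and $w[D_0,w^*]+wMw^*$ lies in $\mathfrak r$. -/

import Mathlib

open scoped ENNReal

noncomputable section

namespace CrossGauge

/-! ### Unbounded operators -/

section Unbounded

variable {E : Type*} [NormedAddCommGroup E] [InnerProductSpace ℂ E]

/-- The (ungraded) commutator `T S - S T` of an unbounded operator `T` with a bounded operator `S`,
on the domain of all `ξ ∈ Dom T` with `S ξ ∈ Dom T`. It is the supercommutator when `S` is even. -/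
def commPMap (T : E →ₗ.[ℂ] E) (S : E →L[ℂ] E) : E →ₗ.[ℂ] E where
  domain := T.domain ⊓ T.domain.comap (S : E →ₗ[ℂ] E)
  toFun :=
    { toFun := fun ξ => T ⟨S ξ, ξ.2.2⟩ - S (T ⟨ξ, ξ.2.1⟩)
      map_add' := by
        intro x y
        have h1 : (⟨S ((x + y : _) : E), (x + y).2.2⟩ : T.domain) =
            ⟨S (x : E), x.2.2⟩ + ⟨S (y : E), y.2.2⟩ := by
          apply Subtype.ext; simp
        have h2 : (⟨((x + y : _) : E), (x + y).2.1⟩ : T.domain) =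
            ⟨(x : E), x.2.1⟩ + ⟨(y : E), y.2.1⟩ := by
          apply Subtype.ext; simp
        rw [h1, h2, LinearPMap.map_add, LinearPMap.map_add, map_add]
        abel
      map_smul' := by
        intro c x
        have h1 : (⟨S ((c • x : _) : E), (c • x).2.2⟩ : T.domain) =
            c • ⟨S (x : E), x.2.2⟩ := by
          apply Subtype.ext; simp
        have h2 : (⟨((c • x : _) : E), (c • x).2.1⟩ : T.domain) =
            c • ⟨(x : E), x.2.1⟩ := by
          apply Subtype.ext; simp
        rw [h1, h2, LinearPMap.map_smul, LinearPMap.map_smul, map_smul, RingHom.id_apply, smul_sub] }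

/-- `S` preserves `Dom T`, and `T S - S T` on `Dom T` extends to the bounded operator `X`. -/
def IsCommutator (T : E →ₗ.[ℂ] E) (S X : E →L[ℂ] E) : Prop :=
  ∀ ξ : T.domain, ∃ h : S ξ ∈ T.domain, T ⟨S ξ, h⟩ - S (T ξ) = X ξ

/-- `S` preserves `Dom T` and `T S = S T` on `Dom T`. -/
def CommutesWith (T : E →ₗ.[ℂ] E) (S : E →L[ℂ] E) : Prop :=
  IsCommutator T S 0

/-- `S` preserves `Dom T` and `T S = - S T` on `Dom T`. -/
def AnticommutesWith (T : E →ₗ.[ℂ] E) (S : E →L[ℂ] E) : Prop :=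
  ∀ ξ : T.domain, ∃ h : S ξ ∈ T.domain, T ⟨S ξ, h⟩ = - S (T ξ)

open Classical in
/-- The bounded operator `[T, S]`, for `S` even preserving `Dom T` and with bounded commutator;
by density of `Dom T` it is unique. (It is `0` when there is no such operator.) -/
def commutator (T : E →ₗ.[ℂ] E) (S : E →L[ℂ] E) : E →L[ℂ] E :=
  if h : ∃ X : E →L[ℂ] E, IsCommutator T S X then h.choose else 0

theorem IsCommutator.unique {T : E →ₗ.[ℂ] E} {S X Y : E →L[ℂ] E}
    (hT : Dense (T.domain : Set E)) (hX : IsCommutator T S X) (hY : IsCommutator T S Y) :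
    X = Y := by
  apply DFunLike.ext'
  refine Continuous.ext_on hT X.continuous Y.continuous ?_
  intro ξ hξ
  obtain ⟨h, h1⟩ := hX ⟨ξ, hξ⟩
  obtain ⟨h', h2⟩ := hY ⟨ξ, hξ⟩
  exact h1.symm.trans h2

theorem IsCommutator.commutator_eq {T : E →ₗ.[ℂ] E} {S X : E →L[ℂ] E}
    (hT : Dense (T.domain : Set E)) (hX : IsCommutator T S X) : commutator T S = X := by
  have h : ∃ X : E →L[ℂ] E, IsCommutator T S X := ⟨X, hX⟩
  unfold commutator
  rw [dif_pos h]
  exact h.choose_spec.unique hT hX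

theorem isCommutator_commutator {T : E →ₗ.[ℂ] E} {S : E →L[ℂ] E}
    (h : ∃ X : E →L[ℂ] E, IsCommutator T S X) : IsCommutator T S (commutator T S) := by
  unfold commutator
  rw [dif_pos h]
  exact h.choose_spec

theorem isCommutator_one (T : E →ₗ.[ℂ] E) : IsCommutator T 1 0 := by
  intro ξ
  exact ⟨ξ.2, by simp⟩

theorem IsCommutator.mul {T : E →ₗ.[ℂ] E} {S S' X X' : E →L[ℂ] E}
    (h : IsCommutator T S X) (h' : IsCommutator T S' X') :
    IsCommutator T (S * S') (X * S' + S * X') := by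
  intro ξ
  obtain ⟨h1, e1⟩ := h' ξ
  obtain ⟨h2, e2⟩ := h ⟨S' ξ, h1⟩
  refine ⟨h2, ?_⟩
  have e1' : T ⟨S' ξ, h1⟩ = X' ξ + S' (T ξ) := by rw [← e1]; abel
  have e2' : T ⟨S (S' ξ), h2⟩ = X (S' ξ) + S (T ⟨S' ξ, h1⟩) := by rw [← e2]; abel
  change T ⟨S (S' ξ), h2⟩ - S (S' (T ξ)) = X (S' ξ) + S (X' ξ)
  rw [e2', e1', map_add]
  abel

theorem IsCommutator.adj [CompleteSpace E] {T : E →ₗ.[ℂ] E} {S X : E →L[ℂ] E}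
    (hT : IsSelfAdjoint T) (h : IsCommutator T S X) :
    IsCommutator T (star S) (-star X) := by
  have hd : Dense (T.domain : Set E) := hT.dense_domain
  have hs : T.adjoint = T := hT
  have hform : T.IsFormalAdjoint T := by
    have := LinearPMap.adjoint_isFormalAdjoint hd
    rwa [hs] at this
  have key : ∀ (ξ η : T.domain),
      inner ℂ ((star S) (T ξ) - (star X) (ξ : E)) (η : E) = inner ℂ ((star S) (ξ : E)) (T η) := by
    intro ξ η
    obtain ⟨h1, e1⟩ := h η
    have e1' : S (T η) = T ⟨S η, h1⟩ - X η := by rw [← e1]; abel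
    rw [inner_sub_left, ContinuousLinearMap.star_eq_adjoint, ContinuousLinearMap.star_eq_adjoint,
      ContinuousLinearMap.adjoint_inner_left, ContinuousLinearMap.adjoint_inner_left,
      ContinuousLinearMap.adjoint_inner_left, e1', inner_sub_right]
    congr 1
    exact hform ξ ⟨S η, h1⟩
  intro ξ
  have hmem : (star S) (ξ : E) ∈ T.adjoint.domain :=
    LinearPMap.mem_adjoint_domain_of_exists _ ⟨_, key ξ⟩
  have hval : T.adjoint ⟨_, hmem⟩ = (star S) (T ξ) - (star X) (ξ : E) :=
    LinearPMap.adjoint_apply_eq hd ⟨_, hmem⟩ (key ξ)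
  have gen : ∀ (R : E →ₗ.[ℂ] E), R = T → ∀ (x : E) (hx : x ∈ R.domain) (y : E), R ⟨x, hx⟩ = y →
      ∃ h : x ∈ T.domain, T ⟨x, h⟩ = y := by
    rintro R rfl x hx y hy
    exact ⟨hx, hy⟩
  obtain ⟨hm, hv⟩ := gen _ hs _ hmem _ hval
  refine ⟨hm, ?_⟩
  rw [hv]
  simp

/-- The graph of `T`, as a subspace of the Hilbert space `E ⊕ E`. -/
def hilbertGraph (T : E →ₗ.[ℂ] E) : Submodule ℂ (WithLp 2 (E × E)) :=
  T.graph.comap (WithLp.linearEquiv 2 ℂ (E × E)).toLinearMap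

/-- The domain of `T` as a normed space with the graph norm `(‖ξ‖² + ‖T ξ‖²)^{1/2}`. -/
def GraphDom (T : E →ₗ.[ℂ] E) : Type _ := hilbertGraph T

instance (T : E →ₗ.[ℂ] E) : NormedAddCommGroup (GraphDom T) :=
  inferInstanceAs (NormedAddCommGroup (hilbertGraph T))

instance (T : E →ₗ.[ℂ] E) : NormedSpace ℂ (GraphDom T) :=
  inferInstanceAs (NormedSpace ℂ (hilbertGraph T))

/-- A vector of `Dom T` as an element of the normed space `GraphDom T`, as a linear map. -/
def toGraphDom (T : E →ₗ.[ℂ] E) : T.domain →ₗ[ℂ] GraphDom T where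
  toFun ξ := (⟨WithLp.toLp 2 ((ξ : E), T ξ), T.mem_graph ξ⟩ : hilbertGraph T)
  map_add' := by
    intro x y
    apply Subtype.ext (p := (· ∈ hilbertGraph T))
    apply (WithLp.linearEquiv 2 ℂ (E × E)).injective
    change ((_ : E), _) = ((_ : E) + _, _ + _)
    simp [LinearPMap.map_add]
  map_smul' := by
    intro c x
    apply Subtype.ext (p := (· ∈ hilbertGraph T))
    apply (WithLp.linearEquiv 2 ℂ (E × E)).injective
    change ((_ : E), _) = (c • (_ : E), c • _)
    simp [LinearPMap.map_smul]

/-- The inclusion of `Dom T` into `E`. -/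
def GraphDom.incl (T : E →ₗ.[ℂ] E) : GraphDom T →L[ℂ] E :=
  ContinuousLinearMap.fst ℂ E E ∘L
    ((WithLp.prodContinuousLinearEquiv 2 ℂ E E : WithLp 2 (E × E) →L[ℂ] E × E) ∘L
      (hilbertGraph T).subtypeL)

/-- An element of `𝐋(Dom T, E)` as an unbounded operator on `E` with domain `Dom T`. -/
def asPMap (T : E →ₗ.[ℂ] E) (ω : GraphDom T →L[ℂ] E) : E →ₗ.[ℂ] E where
  domain := T.domain
  toFun := (ω : GraphDom T →ₗ[ℂ] E) ∘ₗ toGraphDom T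

/-- A bounded operator, restricted to an element of `𝐋(Dom T, E)`. -/
def restrictToDom (T : E →ₗ.[ℂ] E) : (E →L[ℂ] E) →ₗ[ℝ] (GraphDom T →L[ℂ] E) where
  toFun Z := Z ∘L GraphDom.incl T
  map_add' := by intro x y; ext; simp
  map_smul' := by intro c x; ext; simp

/-- The operator `K · a` extends to an element of `𝐋(Dom T, E)`. -/
def ExtendsToDom (T K : E →ₗ.[ℂ] E) (a : E →L[ℂ] E) : Prop :=
  ∃ Y : GraphDom T →L[ℂ] E, ∀ (ξ : K.domain) (hT : (ξ : E) ∈ T.domain),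
    ∃ h : a ξ ∈ K.domain, K ⟨a ξ, h⟩ = Y (toGraphDom T ⟨ξ, hT⟩)

end Unbounded

/-! ### Relative gauge potentials, remainders, gauge transformations

The definitions below are for an equivariant spectral triple of a unital algebra with a vertical
geometry whose vertical metric is the constant `1`. -/

/-- The operators that the notions of gauge theory refer to: the `ℤ/2`-grading, the generators
`cliff j` of the multigrading, the vertical Clifford action `vert i = c(εⁱ)`, the unitaries `act g`,
the differentiable algebra `𝒜` acting on `H`, the Dirac operator `D` and the vertical Dirac
operator `Dv`. -/
structure GaugeData (J I G : Type*) (H : Type*) [NormedAddCommGroup H]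
    [InnerProductSpace ℂ H] where
  grading : H →L[ℂ] H
  cliff : J → H →L[ℂ] H
  vert : I → H →L[ℂ] H
  act : G → H →L[ℂ] H
  alg : Submodule ℂ (H →L[ℂ] H)
  D : H →ₗ.[ℂ] H
  Dv : H →ₗ.[ℂ] H

namespace GaugeData

variable {J I G H : Type*} [NormedAddCommGroup H] [InnerProductSpace ℂ H]

/-- The `C*`-algebra `A`, the norm closure of `𝒜`. -/
def algA (d : GaugeData J I G H) : Set (H →L[ℂ] H) :=
  closure (d.alg : Set (H →L[ℂ] H))

/-- `A^G`. -/
def fixedA (d : GaugeData J I G H) : Set (H →L[ℂ] H) :=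
  {a | a ∈ d.algA ∧ ∀ g, d.act g * a = a * d.act g}

/-- `𝒜^G = 𝒜 ∩ A^G`. -/
def fixedAlg (d : GaugeData J I G H) : Set (H →L[ℂ] H) :=
  {a | a ∈ d.alg ∧ a ∈ d.fixedA}

/-- The closure of `A · [D, 𝒜^G]` in `𝐋(H)`. -/
def horizontalForms (d : GaugeData J I G H) : Submodule ℂ (H →L[ℂ] H) :=
  (Submodule.span ℂ
    {X | ∃ a ∈ d.algA, ∃ b ∈ d.fixedAlg, X = a * commutator d.D b}).topologicalClosure

/-- `Dom D ∩ 𝒜 · Dom Dv`. -/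
def coreDom (d : GaugeData J I G H) : Submodule ℂ H :=
  d.D.domain ⊓ Submodule.span ℂ {η | ∃ a ∈ d.alg, ∃ ξ ∈ d.Dv.domain, η = a ξ}

/-- The restriction of `ω ∈ 𝐋(Dom Dv, H)` to `Dom D ∩ 𝒜 · Dom Dv`. -/
def potentialOp (d : GaugeData J I G H) (ω : GraphDom d.Dv →L[ℂ] H) : H →ₗ.[ℂ] H :=
  (asPMap d.Dv ω).domRestrict d.coreDom

/-- `ω` is a relative gauge potential: on `Dom D ∩ 𝒜 · Dom Dv` it is odd, supercommutes with the
multigrading, is symmetric and `G`-invariant, supercommutes with the vertical Clifford action and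
with `𝒜^G`; each `[ω, a]`, `a ∈ 𝒜`, extends to an element of the closure of `A · [D, 𝒜^G]`, and each
`ω · a` extends to an element of `𝐋(Dom Dv, H)`. -/
structure IsRelativeGaugePotential (d : GaugeData J I G H) (ω : GraphDom d.Dv →L[ℂ] H) :
    Prop where
  odd : AnticommutesWith (d.potentialOp ω) d.grading
  cliff : ∀ j, AnticommutesWith (d.potentialOp ω) (d.cliff j)
  symm : (d.potentialOp ω).IsFormalAdjoint (d.potentialOp ω)
  invariant : ∀ g, CommutesWith (d.potentialOp ω) (d.act g)
  vert : ∀ i, AnticommutesWith (d.potentialOp ω) (d.vert i)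
  fixedAlg : ∀ a ∈ d.fixedAlg, CommutesWith (d.potentialOp ω) a
  comm : ∀ a ∈ d.alg, ∃ X ∈ d.horizontalForms, IsCommutator (d.potentialOp ω) a X
  bdd : ∀ a ∈ d.alg, ExtendsToDom d.Dv (d.potentialOp ω) a

/-- The normed real vector space `𝔞𝔱` of relative gauge potentials, as a subspace of
`𝐋(Dom Dv, H)` with its operator norm: the real span of the set of relative gauge potentials. (For an
equivariant spectral triple with vertical geometry, that set is a real subspace itself.) -/
def potentials (d : GaugeData J I G H) : Submodule ℝ (GraphDom d.Dv →L[ℂ] H) :=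
  Submodule.span ℝ {ω | d.IsRelativeGaugePotential ω}

/-- The real vector space `ℜ` of remainders supercommuting with the vertical Clifford action and
with `𝒜^G`: bounded operators that are odd, supercommute with the multigrading, are symmetric and
`G`-invariant, and supercommute with the vertical Clifford action and with `𝒜^G`. -/
def remainders [CompleteSpace H] (d : GaugeData J I G H) : Submodule ℝ (H →L[ℂ] H) where
  carrier := {Z | Z * d.grading = -(d.grading * Z) ∧ (∀ j, Z * d.cliff j = -(d.cliff j * Z)) ∧
    star Z = Z ∧ (∀ g, Z * d.act g = d.act g * Z) ∧ (∀ i, Z * d.vert i = -(d.vert i * Z)) ∧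
    ∀ a ∈ d.fixedAlg, Z * a = a * Z}
  zero_mem' := by simp
  add_mem' := by
    rintro a b ⟨h1, h2, h3, h4, h5, h6⟩ ⟨k1, k2, k3, k4, k5, k6⟩
    refine ⟨?_, fun j => ?_, ?_, fun g => ?_, fun i => ?_, fun x hx => ?_⟩
    · rw [add_mul, mul_add, h1, k1, neg_add]
    · rw [add_mul, mul_add, h2, k2, neg_add]
    · rw [star_add, h3, k3]
    · rw [add_mul, mul_add, h4, k4]
    · rw [add_mul, mul_add, h5, k5, neg_add]
    · rw [add_mul, mul_add, h6 x hx, k6 x hx]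
  smul_mem' := by
    rintro c a ⟨h1, h2, h3, h4, h5, h6⟩
    refine ⟨?_, fun j => ?_, ?_, fun g => ?_, fun i => ?_, fun x hx => ?_⟩
    · rw [smul_mul_assoc, mul_smul_comm, h1, smul_neg]
    · rw [smul_mul_assoc, mul_smul_comm, h2, smul_neg]
    · rw [star_smul, h3, star_trivial]
    · rw [smul_mul_assoc, mul_smul_comm, h4]
    · rw [smul_mul_assoc, mul_smul_comm, h5, smul_neg]
    · rw [smul_mul_assoc, mul_smul_comm, h6 x hx]

/-- The relative gauge potentials that are (restrictions of) remainders. -/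
def boundedPotentials [CompleteSpace H] (d : GaugeData J I G H) : Submodule ℝ d.potentials :=
  (d.remainders.map (restrictToDom d.Dv)).comap d.potentials.subtype

/-- The operator `[D, S]` on `Dom D ∩ 𝒜 · Dom Dv`. -/
def gaugeComm (d : GaugeData J I G H) (S : H →L[ℂ] H) : H →ₗ.[ℂ] H :=
  (commPMap d.D S).domRestrict d.coreDom

/-- `S` is a gauge transformation: it is an even `G`-invariant unitary that supercommutes with the
multigrading, the vertical Clifford action and `A^G`, with `S 𝒜 S* = 𝒜`, which preserves
`Dom D ∩ 𝒜 · Dom Dv`, such that each `[D, S] · a`, `a ∈ 𝒜`, extends to an element of `𝐋(Dom Dv, H)`,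
and `[D, S]` supercommutes with the vertical Clifford action and with `𝒜^G`. -/
structure IsGaugeTransformation [CompleteSpace H] (d : GaugeData J I G H)
    (S : unitary (H →L[ℂ] H)) : Prop where
  even : (S : H →L[ℂ] H) * d.grading = d.grading * S
  cliff : ∀ j, (S : H →L[ℂ] H) * d.cliff j = d.cliff j * S
  vert : ∀ i, (S : H →L[ℂ] H) * d.vert i = d.vert i * S
  invariant : ∀ g, (S : H →L[ℂ] H) * d.act g = d.act g * S
  fixedA : ∀ a ∈ d.fixedA, (S : H →L[ℂ] H) * a = a * S
  alg : (fun a => (S : H →L[ℂ] H) * a * star (S : H →L[ℂ] H)) '' (d.alg : Set (H →L[ℂ] H)) = d.alg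
  coreDom : d.coreDom.map ((S : H →L[ℂ] H) : H →ₗ[ℂ] H) = d.coreDom
  bdd : ∀ a ∈ d.alg, ExtendsToDom d.Dv (d.gaugeComm S) a
  comm_vert : ∀ i, AnticommutesWith (d.gaugeComm S) (d.vert i)
  comm_fixedAlg : ∀ a ∈ d.fixedAlg, CommutesWith (d.gaugeComm S) a

/-- The gauge group `𝔊`. -/
def gaugeGroup [CompleteSpace H] (d : GaugeData J I G H) : Set (unitary (H →L[ℂ] H)) :=
  {S | d.IsGaugeTransformation S}

/-- `Y ∈ 𝐋(Dom Dv, H)` extends the operator `S D S* - D = S [D, S*]` on `Dom D ∩ 𝒜 · Dom Dv`. -/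
def IsGaugeShift [CompleteSpace H] (d : GaugeData J I G H) (S : H →L[ℂ] H)
    (Y : GraphDom d.Dv →L[ℂ] H) : Prop :=
  ∀ (ξ : H) (_ : ξ ∈ d.coreDom) (hD : ξ ∈ d.D.domain) (hv : ξ ∈ d.Dv.domain),
    ∃ h : (star S) ξ ∈ d.D.domain, S (d.D ⟨(star S) ξ, h⟩) - d.D ⟨ξ, hD⟩ = Y (toGraphDom d.Dv ⟨ξ, hv⟩)

open Classical in
/-- The element of `𝐋(Dom Dv, H)` that extends `S D S* - D`, for `S` a gauge transformation
(and `0` when there is no such element). -/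
def gaugeShift [CompleteSpace H] (d : GaugeData J I G H) (S : H →L[ℂ] H) :
    GraphDom d.Dv →L[ℂ] H :=
  if h : ∃ Y, d.IsGaugeShift S Y then h.choose else 0

/-- The topology of the gauge group: the weakest one for which the inclusion into the unitary group
with its norm topology and the map `S ↦ S D S* - D` into `𝐋(Dom Dv, H)` are continuous. -/
abbrev gaugeTopology [CompleteSpace H] (d : GaugeData J I G H) :
    TopologicalSpace (unitary (H →L[ℂ] H)) :=
  TopologicalSpace.induced
    (fun S => ((S : H →L[ℂ] H), d.gaugeShift (S : H →L[ℂ] H))) inferInstance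

end GaugeData

/-! ### The base spectral triple -/

/-- An `r`-multigraded spectral triple `(𝓑, H₀, D₀)` for the trivially graded unital `C*`-algebra
`B`, with unital `𝓑`. (The representation `rep` of `B` and the odd generators `cliff j` with
`cliff j ^ 2 = -1` make up the graded representation of `Cl_r ⊗̂ B`; as `B` is trivially graded and
`Cl_r` is simple as a graded algebra, that representation is faithful as soon as `rep` is.) -/
structure SpectralTriple (r : ℕ) (B H₀ : Type*) [CStarAlgebra B] [NormedAddCommGroup H₀]
    [InnerProductSpace ℂ H₀] [CompleteSpace H₀] where
  rep : B →⋆ₐ[ℂ] (H₀ →L[ℂ] H₀)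
  rep_injective : Function.Injective rep
  grading : H₀ →L[ℂ] H₀
  grading_star : star grading = grading
  grading_sq : grading * grading = 1
  rep_even : ∀ b, rep b * grading = grading * rep b
  cliff : Fin r → H₀ →L[ℂ] H₀
  cliff_star : ∀ i, star (cliff i) = -cliff i
  cliff_rel : ∀ i j, cliff i * cliff j + cliff j * cliff i = if i = j then -2 else 0
  cliff_odd : ∀ i, cliff i * grading = -(grading * cliff i)
  rep_cliff : ∀ b i, rep b * cliff i = cliff i * rep b
  smooth : StarSubalgebra ℂ B
  smooth_dense : Dense (smooth : Set B)
  D : H₀ →ₗ.[ℂ] H₀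
  D_selfAdjoint : IsSelfAdjoint D
  D_odd : AnticommutesWith D grading
  D_cliff : ∀ i, AnticommutesWith D (cliff i)
  D_lip : ∀ b ∈ smooth, ∃ X : H₀ →L[ℂ] H₀, IsCommutator D (rep b) X
  D_resolvent : ∀ b ∈ smooth, ∃ K : H₀ →L[ℂ] H₀, IsCompactOperator K ∧
    ∀ ξ : D.domain, K (D ξ + Complex.I • (ξ : H₀)) = rep b ξ

/-- A metrically equicontinuous action of `ℤᵐ` on `B`: an action by `*`-automorphisms that preserves
`𝓑`, with `sup_k ‖[D₀, β_k(b)]‖ < ∞` for `b ∈ 𝓑`. -/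
structure EquicontinuousAction (m : ℕ) {r : ℕ} {B H₀ : Type*} [CStarAlgebra B]
    [NormedAddCommGroup H₀] [InnerProductSpace ℂ H₀] [CompleteSpace H₀]
    (T : SpectralTriple r B H₀) where
  act : (Fin m → ℤ) → B ≃⋆ₐ[ℂ] B
  act_add : ∀ k l b, act (k + l) b = act k (act l b)
  act_smooth : ∀ k, ∀ b ∈ T.smooth, act k b ∈ T.smooth
  act_bdd : ∀ b ∈ T.smooth, ∃ C : ℝ, ∀ k, ‖commutator T.D (T.rep (act k b))‖ ≤ C

namespace SpectralTriple

variable {m r : ℕ} {B H₀ : Type*} [CStarAlgebra B] [NormedAddCommGroup H₀]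
  [InnerProductSpace ℂ H₀] [CompleteSpace H₀]

/-- The bounded operator `[D₀, b]`. -/
def d (T : SpectralTriple r B H₀) (b : B) : H₀ →L[ℂ] H₀ :=
  commutator T.D (T.rep b)

theorem isCommutator_d (T : SpectralTriple r B H₀) {b : B} (hb : b ∈ T.smooth) :
    IsCommutator T.D (T.rep b) (T.d b) :=
  isCommutator_commutator (T.D_lip b hb)

theorem d_one (T : SpectralTriple r B H₀) : T.d 1 = 0 := by
  unfold d
  rw [map_one]
  exact (isCommutator_one T.D).commutator_eq T.D_selfAdjoint.dense_domain

theorem d_mul (T : SpectralTriple r B H₀) {a b : B} (ha : a ∈ T.smooth) (hb : b ∈ T.smooth) :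
    T.d (a * b) = T.d a * T.rep b + T.rep a * T.d b := by
  have h := (T.isCommutator_d ha).mul (T.isCommutator_d hb)
  rw [← map_mul] at h
  exact h.commutator_eq T.D_selfAdjoint.dense_domain

theorem d_star (T : SpectralTriple r B H₀) {b : B} (hb : b ∈ T.smooth) :
    T.d (star b) = -star (T.d b) := by
  have h := (T.isCommutator_d hb).adj T.D_selfAdjoint
  rw [← map_star] at h
  exact h.commutator_eq T.D_selfAdjoint.dense_domain

/-- `Ω¹`, the norm closure of `B · [D₀, 𝓑]`. -/
def oneForms (T : SpectralTriple r B H₀) : Submodule ℂ (H₀ →L[ℂ] H₀) :=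
  (Submodule.span ℂ {X | ∃ b₁ : B, ∃ b₂ ∈ T.smooth, X = T.rep b₁ * T.d b₂}).topologicalClosure

/-- The real vector space `Ω¹_sa ∩ 𝓑'` of self-adjoint elements of `Ω¹` that commute with `𝓑`. -/
def centralForms (T : SpectralTriple r B H₀) : Submodule ℝ (H₀ →L[ℂ] H₀) where
  carrier := {x | x ∈ T.oneForms ∧ star x = x ∧ ∀ b ∈ T.smooth, x * T.rep b = T.rep b * x}
  zero_mem' := by simp
  add_mem' := by
    rintro x y ⟨h1, h2, h3⟩ ⟨k1, k2, k3⟩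
    refine ⟨add_mem h1 k1, by rw [star_add, h2, k2], fun b hb => ?_⟩
    rw [add_mul, mul_add, h3 b hb, k3 b hb]
  smul_mem' := by
    rintro c x ⟨h1, h2, h3⟩
    refine ⟨(T.oneForms.restrictScalars ℝ).smul_mem c h1,
      by rw [star_smul, h2, star_trivial], fun b hb => ?_⟩
    rw [smul_mul_assoc, mul_smul_comm, h3 b hb]

/-- The real vector space `𝔯` of odd self-adjoint bounded operators on `H₀` that supercommute with
`B` and with the multigrading. -/
def oddCommutant (T : SpectralTriple r B H₀) : Submodule ℝ (H₀ →L[ℂ] H₀) where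
  carrier := {M | star M = M ∧ M * T.grading = -(T.grading * M) ∧
    (∀ b, M * T.rep b = T.rep b * M) ∧ ∀ i, M * T.cliff i = -(T.cliff i * M)}
  zero_mem' := by simp
  add_mem' := by
    rintro x y ⟨h1, h2, h3, h4⟩ ⟨k1, k2, k3, k4⟩
    refine ⟨by rw [star_add, h1, k1], ?_, fun b => ?_, fun i => ?_⟩
    · rw [add_mul, mul_add, h2, k2, neg_add]
    · rw [add_mul, mul_add, h3, k3]
    · rw [add_mul, mul_add, h4, k4, neg_add]
  smul_mem' := by
    rintro c x ⟨h1, h2, h3, h4⟩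
    refine ⟨by rw [star_smul, h1, star_trivial], ?_, fun b => ?_, fun i => ?_⟩
    · rw [smul_mul_assoc, mul_smul_comm, h2, smul_neg]
    · rw [smul_mul_assoc, mul_smul_comm, h3]
    · rw [smul_mul_assoc, mul_smul_comm, h4, smul_neg]

/-- The group `U(Z_{D₀}(𝓑))` of unitaries in
`Z_{D₀}(𝓑) = {b ∈ Z(𝓑) | [D₀, b] commutes with 𝓑}`. -/
def centralUnitaries (T : SpectralTriple r B H₀) : Subgroup (unitary B) where
  carrier := {u | (u : B) ∈ T.smooth ∧ (∀ b ∈ T.smooth, (u : B) * b = b * u) ∧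
    ∀ b ∈ T.smooth, T.d u * T.rep b = T.rep b * T.d u}
  one_mem' := by
    refine ⟨by simp, by simp, ?_⟩
    simp [T.d_one]
  mul_mem' := by
    rintro u v ⟨h1, h2, h3⟩ ⟨k1, k2, k3⟩
    refine ⟨by simpa using mul_mem h1 k1, fun b hb => ?_, fun b hb => ?_⟩
    · rw [Submonoid.coe_mul, mul_assoc, k2 b hb, ← mul_assoc, h2 b hb, mul_assoc]
    · have hu : T.rep u * T.rep b = T.rep b * T.rep u := by
        rw [← map_mul, ← map_mul, h2 b hb]
      have hv : T.rep v * T.rep b = T.rep b * T.rep v := by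
        rw [← map_mul, ← map_mul, k2 b hb]
      rw [Submonoid.coe_mul, T.d_mul h1 k1, add_mul, mul_add]
      congr 1
      · rw [mul_assoc, hv, ← mul_assoc, h3 b hb, mul_assoc]
      · rw [mul_assoc, k3 b hb, ← mul_assoc, hu, mul_assoc]
  inv_mem' := by
    rintro u ⟨h1, h2, h3⟩
    have e : ((u⁻¹ : unitary B) : B) = star (u : B) := rfl
    refine ⟨by rw [e]; exact star_mem h1, fun b hb => ?_, fun b hb => ?_⟩
    · have := congrArg star (h2 (star b) (star_mem hb))
      rw [star_mul, star_mul, star_star] at this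
      rw [e, this]
    · have := congrArg star (h3 (star b) (star_mem hb))
      rw [star_mul, star_mul, map_star, star_star] at this
      rw [e, T.d_star h1, neg_mul, mul_neg, this]

/-- The group `𝔚` of even unitaries `w` on `H₀` that supercommute with `𝓑` and the multigrading,
such that `w` preserves `Dom D₀`, `[D₀, w]` is bounded, and `[D₀, w]` supercommutes with `𝓑`. -/
def constantGauge (T : SpectralTriple r B H₀) : Subgroup (unitary (H₀ →L[ℂ] H₀)) where
  carrier := {w | (w : H₀ →L[ℂ] H₀) * T.grading = T.grading * w ∧
    (∀ b ∈ T.smooth, (w : H₀ →L[ℂ] H₀) * T.rep b = T.rep b * w) ∧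
    (∀ i, (w : H₀ →L[ℂ] H₀) * T.cliff i = T.cliff i * w) ∧
    ∃ X : H₀ →L[ℂ] H₀, IsCommutator T.D w X ∧ ∀ b ∈ T.smooth, X * T.rep b = T.rep b * X}
  one_mem' := ⟨by simp, by simp, by simp, 0, isCommutator_one T.D, by simp⟩
  mul_mem' := by
    rintro u v ⟨h1, h2, h3, X, h4, h5⟩ ⟨k1, k2, k3, Y, k4, k5⟩
    refine ⟨?_, fun b hb => ?_, fun i => ?_, _, h4.mul k4, fun b hb => ?_⟩
    · rw [Submonoid.coe_mul, mul_assoc, k1, ← mul_assoc, h1, mul_assoc]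
    · rw [Submonoid.coe_mul, mul_assoc, k2 b hb, ← mul_assoc, h2 b hb, mul_assoc]
    · rw [Submonoid.coe_mul, mul_assoc, k3, ← mul_assoc, h3, mul_assoc]
    · rw [add_mul, mul_add]
      congr 1
      · rw [mul_assoc, k2 b hb, ← mul_assoc, h5 b hb, mul_assoc]
      · rw [mul_assoc, k5 b hb, ← mul_assoc, h2 b hb, mul_assoc]
  inv_mem' := by
    rintro u ⟨h1, h2, h3, X, h4, h5⟩
    have e : ((u⁻¹ : unitary (H₀ →L[ℂ] H₀)) : H₀ →L[ℂ] H₀) = star (u : H₀ →L[ℂ] H₀) := rfl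
    refine ⟨?_, fun b hb => ?_, fun i => ?_, -star X, ?_, fun b hb => ?_⟩
    · have := congrArg star h1
      rw [star_mul, star_mul, T.grading_star] at this
      rw [e, this]
    · have := congrArg star (h2 (star b) (star_mem hb))
      rw [star_mul, star_mul, map_star, star_star] at this
      rw [e, this]
    · have := congrArg star (h3 i)
      rw [star_mul, star_mul, T.cliff_star, neg_mul, mul_neg, neg_inj] at this
      rw [e, this]
    · rw [e]
      exact h4.adj T.D_selfAdjoint
    · have := congrArg star (h5 (star b) (star_mem hb))
      rw [star_mul, star_mul, map_star, star_star] at this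
      rw [neg_mul, mul_neg, this]

/-! ### The induced action on one-forms, and group cohomology -/

/-- The closed graph of `β_k : b₁ [D₀, b₂] ↦ β_k(b₁) [D₀, β_k(b₂)]`, as a relation on `𝐋(H₀)`:
the closure of the set of pairs `(∑ᵢ bᵢ [D₀, bᵢ'], ∑ᵢ β_k(bᵢ) [D₀, β_k(bᵢ')])`. When `β_k` on the span of
`B · [D₀, 𝓑]` is well-defined and bounded, this is the graph of its extension `β_k : Ω¹ → Ω¹`. -/
def formGraph (T : SpectralTriple r B H₀) (β : EquicontinuousAction m T) (k : Fin m → ℤ) :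
    Submodule ℂ ((H₀ →L[ℂ] H₀) × (H₀ →L[ℂ] H₀)) :=
  (Submodule.span ℂ {p | ∃ b₁ : B, ∃ b₂ ∈ T.smooth,
    p = (T.rep b₁ * T.d b₂, T.rep (β.act k b₁) * T.d (β.act k b₂))}).topologicalClosure

/-- The map `π : b₁ ⊗ b₂ ↦ b₁ [D₀, b₂]` is such that the diagonal action of `ℤᵐ` descends along it to
uniformly bounded operators for the operator norm: for some constant `C`,
`‖π(β_k x)‖ ≤ C ‖π(x)‖` for all `k` and all `x = ∑ᵢ bᵢ ⊗ bᵢ'`. In particular `ker π` is invariant. -/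
def DescendsToForms (T : SpectralTriple r B H₀) (β : EquicontinuousAction m T) : Prop :=
  ∃ C : ℝ, ∀ (k : Fin m → ℤ) (N : ℕ) (b : Fin N → B) (b' : Fin N → T.smooth),
    ‖∑ i, T.rep (β.act k (b i)) * T.d (β.act k (b' i : B))‖ ≤
      C * ‖∑ i, T.rep (b i) * T.d (b' i : B)‖

/-- `Ω¹_sa ∩ 𝓑'` is invariant under the action of `ℤᵐ` on `Ω¹`. -/
def CentralFormsInvariant (T : SpectralTriple r B H₀) (β : EquicontinuousAction m T) : Prop :=
  ∀ k, ∀ x ∈ T.centralForms, ∀ y, (x, y) ∈ T.formGraph β k → y ∈ T.centralForms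

/-- `Z¹(ℤᵐ, Ω¹_sa ∩ 𝓑')`: the maps `ω` with `ω(k + l) = ω(k) + β_k(ω(l))`. -/
def formCocycles (T : SpectralTriple r B H₀) (β : EquicontinuousAction m T) :
    Submodule ℝ ((Fin m → ℤ) → (H₀ →L[ℂ] H₀)) where
  carrier := {ω | (∀ k, ω k ∈ T.centralForms) ∧
    ∀ k l, (ω l, ω (k + l) - ω k) ∈ T.formGraph β k}
  zero_mem' := by
    refine ⟨fun k => zero_mem _, fun k l => ?_⟩
    have h := zero_mem (T.formGraph β k)
    rw [Prod.zero_eq_mk] at h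
    simpa only [Pi.zero_apply, sub_zero] using h
  add_mem' := by
    rintro ω η ⟨h1, h2⟩ ⟨k1, k2⟩
    refine ⟨fun k => add_mem (h1 k) (k1 k), fun k l => ?_⟩
    have := add_mem (h2 k l) (k2 k l)
    rw [Prod.mk_add_mk, sub_add_sub_comm] at this
    exact this
  smul_mem' := by
    rintro c ω ⟨h1, h2⟩
    refine ⟨fun k => Submodule.smul_mem _ c (h1 k), fun k l => ?_⟩
    have := ((T.formGraph β k).restrictScalars ℝ).smul_mem c (h2 k l)
    rw [Prod.smul_mk, smul_sub] at this
    exact this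

/-- `B¹(ℤᵐ, Ω¹_sa ∩ 𝓑')`: the cocycles `ω(k) = β_k(x) - x` with `x ∈ Ω¹_sa ∩ 𝓑'`. -/
def formCoboundaries (T : SpectralTriple r B H₀) (β : EquicontinuousAction m T) :
    Submodule ℝ (T.formCocycles β) where
  carrier := {ω | ∃ x ∈ T.centralForms, ∀ k, (x, (ω : (Fin m → ℤ) → (H₀ →L[ℂ] H₀)) k + x) ∈
    T.formGraph β k}
  zero_mem' := by
    refine ⟨0, zero_mem _, fun k => ?_⟩
    have h := zero_mem (T.formGraph β k)
    rw [Prod.zero_eq_mk] at h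
    simpa only [ZeroMemClass.coe_zero, Pi.zero_apply, add_zero] using h
  add_mem' := by
    rintro ω η ⟨x, hx, h1⟩ ⟨y, hy, h2⟩
    refine ⟨x + y, add_mem hx hy, fun k => ?_⟩
    have := add_mem (h1 k) (h2 k)
    rw [Prod.mk_add_mk, add_add_add_comm] at this
    exact this
  smul_mem' := by
    rintro c ω ⟨x, hx, h1⟩
    refine ⟨c • x, Submodule.smul_mem _ c hx, fun k => ?_⟩
    have := ((T.formGraph β k).restrictScalars ℝ).smul_mem c (h1 k)
    rw [Prod.smul_mk, smul_add] at this
    exact this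

/-- `(4 π² ‖k‖² + 1)^{-1/2}`, with the Euclidean norm of `k`. -/
def weight (k : Fin m → ℤ) : ℝ :=
  (Real.sqrt (4 * Real.pi ^ 2 * ∑ i, (k i : ℝ) ^ 2 + 1))⁻¹

/-- The norm of `Z¹(ℤᵐ, Ω¹_sa ∩ 𝓑')`. -/
def cocycleNorm (ω : (Fin m → ℤ) → (H₀ →L[ℂ] H₀)) : ℝ :=
  ⨆ k, weight k * ‖ω k‖

/-- The group `Z¹(ℤᵐ, U(Z_{D₀}(𝓑)))`: the maps `υ` with `υ(k + l) = υ(k) β_k(υ(l))`. -/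
def unitaryCocycles (T : SpectralTriple r B H₀) (β : EquicontinuousAction m T) :
    Subgroup ((Fin m → ℤ) → unitary B) where
  carrier := {υ | (∀ k, υ k ∈ T.centralUnitaries) ∧
    ∀ k l, (υ (k + l) : B) = (υ k : B) * β.act k (υ l : B)}
  one_mem' := ⟨fun k => one_mem _, fun k l => by simp⟩
  mul_mem' := by
    rintro υ ν ⟨h1, h2⟩ ⟨k1, k2⟩
    refine ⟨fun k => mul_mem (h1 k) (k1 k), fun k l => ?_⟩
    have hc : (ν k : B) * β.act k (υ l : B) = β.act k (υ l : B) * ν k :=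
      (k1 k).2.1 _ (β.act_smooth k _ (h1 l).1)
    simp only [Pi.mul_apply, Submonoid.coe_mul, map_mul, h2, k2]
    rw [mul_assoc, ← mul_assoc (β.act k (υ l : B)), ← hc]
    simp only [mul_assoc]
  inv_mem' := by
    rintro υ ⟨h1, h2⟩
    refine ⟨fun k => inv_mem (h1 k), fun k l => ?_⟩
    have e : ∀ u : unitary B, ((u⁻¹ : unitary B) : B) = star (u : B) := fun u => rfl
    have hc : (υ k : B) * β.act k (υ l : B) = β.act k (υ l : B) * υ k :=
      (h1 k).2.1 _ (β.act_smooth k _ (h1 l).1)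
    simp only [Pi.inv_apply, e, map_star]
    rw [h2, hc, star_mul]

/-- The one-form `υ(k) [D₀, υ(k)*]`. -/
def logDeriv (T : SpectralTriple r B H₀) (υ : (Fin m → ℤ) → unitary B) (k : Fin m → ℤ) :
    H₀ →L[ℂ] H₀ :=
  T.rep (υ k : B) * T.d (star (υ k : B))

/-- The topology on `Z¹(ℤᵐ, U(Z_{D₀}(𝓑)))` inherited from `ℓ^∞(ℤᵐ, 𝐋(H₀))`, that is, the topology of
uniform convergence on `ℤᵐ`. -/
abbrev cocycleUniformTopology (T : SpectralTriple r B H₀) (β : EquicontinuousAction m T) :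
    TopologicalSpace (T.unitaryCocycles β) :=
  TopologicalSpace.induced
    (fun υ => UniformFun.ofFun
      (fun k => T.rep (((υ : (Fin m → ℤ) → unitary B) k : unitary B) : B))) inferInstance

/-- The weakest topology on `Z¹(ℤᵐ, U(Z_{D₀}(𝓑)))` for which the inclusion into `ℓ^∞(ℤᵐ, 𝐋(H₀))` and the
map `υ ↦ υ [D₀, υ*]` into `Z¹(ℤᵐ, Ω¹_sa ∩ 𝓑')`, with its weighted supremum norm, are continuous. -/
abbrev cocycleGaugeTopology (T : SpectralTriple r B H₀) (β : EquicontinuousAction m T) :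
    TopologicalSpace (T.unitaryCocycles β) :=
  T.cocycleUniformTopology β ⊓ TopologicalSpace.induced
    (fun υ => UniformFun.ofFun
      (fun k => weight k • T.logDeriv (υ : (Fin m → ℤ) → unitary B) k)) inferInstance

/-- The norm topology on `𝔚`. -/
abbrev constantNormTopology (T : SpectralTriple r B H₀) : TopologicalSpace T.constantGauge :=
  TopologicalSpace.induced (fun w => ((w : unitary (H₀ →L[ℂ] H₀)) : H₀ →L[ℂ] H₀)) inferInstance

/-- The weakest topology on `𝔚` for which `w ↦ w` and `w ↦ w [D₀, w*]` are norm continuous. -/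
abbrev constantGaugeTopology (T : SpectralTriple r B H₀) : TopologicalSpace T.constantGauge :=
  T.constantNormTopology ⊓ TopologicalSpace.induced
    (fun w => ((w : unitary (H₀ →L[ℂ] H₀)) : H₀ →L[ℂ] H₀) *
      commutator T.D (star ((w : unitary (H₀ →L[ℂ] H₀)) : H₀ →L[ℂ] H₀))) inferInstance

end SpectralTriple

/-! ### The crossed product spectral triple -/

/-- An irreducible `ℤ/2`-graded `*`-representation of `Cl_m ⊗̂ Cl((ℝᵐ)*)` on a finite-dimensional
Hilbert space `V`, written in an orthonormal basis indexed by `ι`: the grading and the actions of the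
generators `e₁, …, e_m` of `Cl_m` and `f₁, …, f_m` of `Cl((ℝᵐ)*)`. -/
structure SpinModule (m : ℕ) (ι : Type*) [Fintype ι] [DecidableEq ι] where
  grading : Matrix ι ι ℂ
  e : Fin m → Matrix ι ι ℂ
  f : Fin m → Matrix ι ι ℂ
  grading_star : star grading = grading
  grading_sq : grading * grading = 1
  e_star : ∀ i, star (e i) = -e i
  f_star : ∀ i, star (f i) = -f i
  e_odd : ∀ i, e i * grading = -(grading * e i)
  f_odd : ∀ i, f i * grading = -(grading * f i)
  e_rel : ∀ i j, e i * e j + e j * e i = if i = j then -2 else 0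
  f_rel : ∀ i j, f i * f j + f j * f i = if i = j then -2 else 0
  e_f : ∀ i j, e i * f j = -(f j * e i)
  nonempty : Nonempty ι
  irreducible : ∀ S : Submodule ℂ (ι → ℂ), (∀ v ∈ S, grading.mulVec v ∈ S) →
    (∀ i, ∀ v ∈ S, (e i).mulVec v ∈ S) → (∀ i, ∀ v ∈ S, (f i).mulVec v ∈ S) → S = ⊥ ∨ S = ⊤

/-- `V ⊗ H₀`, for `V` with an orthonormal basis indexed by `ι`. -/
abbrev Fib (ι H₀ : Type*) [Fintype ι] [NormedAddCommGroup H₀] : Type _ :=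
  PiLp 2 (fun _ : ι => H₀)

/-- `ℓ²(ℤᵐ, V ⊗ H₀)`. -/
abbrev TotalSpace (m : ℕ) (ι H₀ : Type*) [Fintype ι] [NormedAddCommGroup H₀] : Type _ :=
  lp (fun _ : Fin m → ℤ => Fib ι H₀) 2

section Fibre

variable {ι H₀ : Type*} [Fintype ι] [NormedAddCommGroup H₀] [InnerProductSpace ℂ H₀]

/-- The ungraded tensor product `x ⊗ S` on `V ⊗ H₀`. -/
def tens (x : Matrix ι ι ℂ) (S : H₀ →L[ℂ] H₀) : Fib ι H₀ →L[ℂ] Fib ι H₀ :=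
  ((PiLp.continuousLinearEquiv 2 ℂ (fun _ : ι => H₀)).symm : (ι → H₀) →L[ℂ] Fib ι H₀) ∘L
    ContinuousLinearMap.pi (fun i => ∑ j, x i j • (S ∘L PiLp.proj 2 (fun _ : ι => H₀) j))

end Fibre

section Blocks

variable {K W : Type*} [NormedAddCommGroup W] [InnerProductSpace ℂ W]

/-- `X` is the bounded operator on `ℓ²(K, W)` given by `(X ξ)(k) = t(k) ξ(σ(k))`. -/
def IsBlockOp (σ : K → K) (t : K → W →L[ℂ] W)
    (X : lp (fun _ : K => W) 2 →L[ℂ] lp (fun _ : K => W) 2) : Prop :=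
  ∀ ξ : lp (fun _ : K => W) 2, ∀ k, (X ξ : ∀ _ : K, W) k = t k ((ξ : ∀ _ : K, W) (σ k))

open Classical in
/-- The bounded operator `(X ξ)(k) = t(k) ξ(σ(k))` on `ℓ²(K, W)`, for a bounded family `t` and a
bijection `σ` (and `0` if the formula does not define a bounded operator). -/
def blockOp (σ : K → K) (t : K → W →L[ℂ] W) :
    lp (fun _ : K => W) 2 →L[ℂ] lp (fun _ : K => W) 2 :=
  if h : ∃ X, IsBlockOp σ t X then h.choose else 0

/-- The graph of the direct sum of the unbounded operators `t(k)` on `W`: all `(ξ, η)` with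
`ξ(k) ∈ Dom t(k)` and `η(k) = t(k) ξ(k)` for all `k`. -/
def sumGraph (t : K → W →ₗ.[ℂ] W) :
    Submodule ℂ (lp (fun _ : K => W) 2 × lp (fun _ : K => W) 2) where
  carrier := {p | ∀ k, ((p.1 : ∀ _ : K, W) k, (p.2 : ∀ _ : K, W) k) ∈ (t k).graph}
  zero_mem' := fun _ => zero_mem _
  add_mem' := fun h h' k => add_mem (h k) (h' k)
  smul_mem' := fun c _ h k => Submodule.smul_mem _ c (h k)

/-- `Op(t)`, the direct sum of the operators `t(k)`, with domain all `ξ ∈ ℓ²(K, W)` such that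
`ξ(k) ∈ Dom t(k)` for all `k` and `(t(k) ξ(k))_k ∈ ℓ²(K, W)`. When the `t(k)` are bounded operators, it
is the closure of its restriction to the finitely supported `ξ`. -/
def opSum (t : K → W →ₗ.[ℂ] W) : lp (fun _ : K => W) 2 →ₗ.[ℂ] lp (fun _ : K => W) 2 :=
  (sumGraph t).toLinearPMap

end Blocks

namespace SpectralTriple

variable {m r : ℕ} {ι B H₀ : Type*} [Fintype ι] [DecidableEq ι] [CStarAlgebra B]
  [NormedAddCommGroup H₀] [InnerProductSpace ℂ H₀] [CompleteSpace H₀]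

/-- The graded tensor product `id_V ⊗̂ S`: it is `1 ⊗ S` for `S` even and `γ_V ⊗ S` for `S` odd. -/
def idTens (T : SpectralTriple r B H₀) (V : SpinModule m ι) (S : H₀ →L[ℂ] H₀) :
    Fib ι H₀ →L[ℂ] Fib ι H₀ :=
  tens 1 ((2⁻¹ : ℂ) • (S + T.grading * S * T.grading)) +
    tens V.grading ((2⁻¹ : ℂ) • (S - T.grading * S * T.grading))

/-- The unbounded operator `id_V ⊗̂ D₀ = γ_V ⊗ D₀` on `V ⊗ H₀`. -/
def idTensD (T : SpectralTriple r B H₀) (V : SpinModule m ι) : Fib ι H₀ →ₗ.[ℂ] Fib ι H₀ where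
  domain :=
    { carrier := {w | ∀ i, w i ∈ T.D.domain}
      zero_mem' := fun _ => zero_mem _
      add_mem' := fun h h' i => add_mem (h i) (h' i)
      smul_mem' := fun c _ h i => Submodule.smul_mem _ c (h i) }
  toFun :=
    { toFun := fun w => WithLp.toLp 2
        (fun i => ∑ j, V.grading i j • T.D ⟨(w : Fib ι H₀) j, w.2 j⟩)
      map_add' := by
        intro x y
        apply (WithLp.linearEquiv 2 ℂ (ι → H₀)).injective
        funext i
        have h : ∀ j, (⟨((x + y : _) : Fib ι H₀) j, (x + y).2 j⟩ : T.D.domain) =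
            ⟨(x : Fib ι H₀) j, x.2 j⟩ + ⟨(y : Fib ι H₀) j, y.2 j⟩ := fun j => rfl
        simp only [h, LinearPMap.map_add, smul_add, Finset.sum_add_distrib]
        rfl
      map_smul' := by
        intro c x
        apply (WithLp.linearEquiv 2 ℂ (ι → H₀)).injective
        funext i
        have h : ∀ j, (⟨((c • x : _) : Fib ι H₀) j, (c • x).2 j⟩ : T.D.domain) =
            c • ⟨(x : Fib ι H₀) j, x.2 j⟩ := fun j => rfl
        simp only [h, LinearPMap.map_smul, smul_comm _ c, ← Finset.smul_sum]
        rfl }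

/-- `s(k) = -2πi c₀(k)`. -/
def symbol (V : SpinModule m ι) (k : Fin m → ℤ) : Matrix ι ι ℂ :=
  (-2 * Real.pi * Complex.I : ℂ) • ∑ i, (k i : ℂ) • V.f i

/-- `Dv = Op(s ⊗̂ id)`. -/
def verticalDirac (_T : SpectralTriple r B H₀) (V : SpinModule m ι) :
    TotalSpace m ι H₀ →ₗ.[ℂ] TotalSpace m ι H₀ :=
  opSum (fun k => (tens (symbol V k) (1 : H₀ →L[ℂ] H₀) : Fib ι H₀ →ₗ[ℂ] Fib ι H₀).toPMap ⊤)

/-- `Dh = id ⊗̂ D₀`. -/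
def horizontalDirac (T : SpectralTriple r B H₀) (V : SpinModule m ι) :
    TotalSpace m ι H₀ →ₗ.[ℂ] TotalSpace m ι H₀ :=
  opSum (fun _ => T.idTensD V)

/-- The element `b λ_k` of `ℤᵐ ⋉ B` as an operator on `ℓ²(ℤᵐ, V ⊗ H₀)`, where
`(b ξ)(p) = (id ⊗̂ β_p(b)) ξ(p)` and `(λ_k ξ)(p) = ξ(p - k)`. -/
def crossedOp (T : SpectralTriple r B H₀) (β : EquicontinuousAction m T) (ι : Type*) [Fintype ι]
    [DecidableEq ι] (b : B) (k : Fin m → ℤ) : TotalSpace m ι H₀ →L[ℂ] TotalSpace m ι H₀ :=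
  blockOp (fun p => p - k) (fun p => tens (1 : Matrix ι ι ℂ) (T.rep (β.act p b)))

/-- The duality pairing `exp(2πi ∑ⱼ pⱼ tⱼ)` of `ℤᵐ` and `𝕋ᵐ = ℝᵐ/ℤᵐ`. -/
def pairing (p : Fin m → ℤ) (t : Fin m → UnitAddCircle) : ℂ :=
  ∏ j, fourier (p j) (t j)

/-- The `𝕋ᵐ`-spectral triple of the crossed product, with its vertical geometry `(1, c)`: the
grading, the `(m + r)`-multigrading, `c = id ⊗̂ c₀ ⊗̂ id`, the representation `U` of `𝕋ᵐ`, the algebraic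
crossed product `𝒜 = ℤᵐ ⋉ 𝓑`, the closure `D` of `Dv + Dh`, and `Dv`. -/
def crossedProduct (T : SpectralTriple r B H₀) (β : EquicontinuousAction m T)
    (V : SpinModule m ι) :
    GaugeData (Fin m ⊕ Fin r) (Fin m) (Fin m → UnitAddCircle) (TotalSpace m ι H₀) where
  grading := blockOp id (fun _ => tens V.grading T.grading)
  cliff := Sum.elim (fun i => blockOp id (fun _ => tens (V.e i) 1))
    (fun i => blockOp id (fun _ => tens V.grading (T.cliff i)))
  vert i := blockOp id (fun _ => tens (V.f i) 1)
  act t := blockOp id (fun p => pairing p t • ContinuousLinearMap.id ℂ (Fib ι H₀))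
  alg := Submodule.span ℂ {X | ∃ b ∈ T.smooth, ∃ k, X = T.crossedOp β ι b k}
  D := (T.verticalDirac V + T.horizontalDirac V).closure
  Dv := T.verticalDirac V

end SpectralTriple

end CrossGauge

end

set_option linter.unusedSectionVars false

/-! ### Operators on ℓ²(K, W): blocks, direct sums and matrix entries. -/

noncomputable section
namespace CrossGauge

/-! ### Block operators on `ℓ²(K, W)` -/

/-! Everything becomes diagonal over ℤᵐ. The characters of 𝕋ᵐ separate the points of ℤᵐ, so a
𝕋ᵐ-invariant operator is a family of operators Y(p) on V ⊗ H₀ (`isBlockOp_of_invariant`). As Cl_m ⊗̂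
Cl((ℝᵐ)*) acts irreducibly on V, Schur's lemma (`exists_eq_tens_one`, `exists_eq_tens_grading`)
leaves Y(p) = γ ⊗ X(p) for a potential and Y(p) = 1 ⊗ u(p) for a gauge transformation.

The domains are explicit. Since s(p)² = 4π²‖p‖², the weights in the norm of Z¹ identify ℓ²
isometrically with Dom Dv (`graphIso`), and the norm of a diagonal operator on Dom Dv is a weighted
supremum. Since s(p) ⊗ 1 and γ ⊗ D₀ anticommute, the sum Dv + Dh is closed, is described fibre by
fibre, and has its domain inside Dom Dv (`norm_sq_symbol_add`).

Potentials. The commutator of Op(γ ⊗ X) with λ_k has the entries γ ⊗ (X(p) - X(p - k)). In an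
element of the closure of A · [D, 𝒜^𝕋] the entries along a diagonal form an orbit of β
(`mem_formGraph_of_mem_horizontalForms`), so X(l + k) - X(l) = β_l(X(k) - X(0)). Hence ω = X - X(0)
is a cocycle, and M = X(0) is a free constant. Conversely, the commutator with bλ_k is bλ_k times
the diagonal operator of the orbit of ω(k). Uniform boundedness of β on Ω¹ makes this orbit a norm
limit of horizontal forms (`orbit_mem_closure`), and it makes ω grow at most linearly
(`exists_le_growth`), so that Op(ω) is bounded on Dom Dv.

Gauge transformations. That S λ_k S* lies in 𝒜 says u(p) u(p - k)* = β_p(b_k) with a single b_k ∈ 𝓑.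
Then υ(k) = u(k) u(0)* is a unitary cocycle with values in 𝓑, and w = u(0). Conversely, u ↦ u [D₀,
u*] is additive on central unitaries (`logForm_mul`), so υ [D₀, υ*] is a cocycle of one-forms, and
its linear growth shows that Op(wυ) preserves Dom D.

Finally, S D S* - D is the diagonal operator of υ [D₀, υ*] + w [D₀, w*] (`conj_totalDirac_apply`).
The norm estimates for potentials, with ω(0) = 0 and υ(0) = 1 separating the two factors, give the
comparison of topologies; the same formula gives the affine action. -/

theorem exists_lp_of_norm_le {K W : Type*} [NormedAddCommGroup W] {C : ℝ} (hC : 0 ≤ C) (σ : K ≃ K) (f : K → W)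
    (g : lp (fun _ : K => W) 2) (h : ∀ k, ‖f k‖ ≤ C * ‖(g : ∀ _ : K, W) (σ k)‖) :
    ∃ η : lp (fun _ : K => W) 2, (∀ k, (η : ∀ _ : K, W) k = f k) ∧ ‖η‖ ≤ C * ‖g‖ := by
  have h2 : (0 : ℝ) < (2 : ℝ≥0∞).toReal := by norm_num
  have hs : Summable fun k => (C * ‖(g : ∀ _ : K, W) (σ k)‖) ^ (2 : ℝ≥0∞).toReal := by
    have := ((lp.memℓp g).summable h2)
    have := (σ.summable_iff.mpr this).mul_left (C ^ (2 : ℝ≥0∞).toReal)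
    refine this.congr fun k => ?_
    rw [Real.mul_rpow hC (norm_nonneg _)]
    rfl
  have hf : Memℓp f 2 := by
    rw [memℓp_gen_iff h2]
    refine hs.of_nonneg_of_le (fun k => by positivity) fun k => ?_
    gcongr
    exact h k
  refine ⟨⟨f, hf⟩, fun k => rfl, ?_⟩
  refine lp.norm_le_of_tsum_le h2 (by positivity) ?_
  have h3 : Summable fun k => ‖f k‖ ^ (2 : ℝ≥0∞).toReal := hf.summable h2
  calc ∑' k, ‖f k‖ ^ (2 : ℝ≥0∞).toReal
      ≤ ∑' k, (C * ‖(g : ∀ _ : K, W) (σ k)‖) ^ (2 : ℝ≥0∞).toReal :=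
        h3.tsum_le_tsum (fun k => by gcongr; exact h k) hs
    _ = ∑' k, (C ^ (2 : ℝ≥0∞).toReal * ‖(g : ∀ _ : K, W) (σ k)‖ ^ (2 : ℝ≥0∞).toReal) := by
        congr 1; funext k; rw [Real.mul_rpow hC (norm_nonneg _)]
    _ = C ^ (2 : ℝ≥0∞).toReal * ∑' k, ‖(g : ∀ _ : K, W) k‖ ^ (2 : ℝ≥0∞).toReal := by
        rw [tsum_mul_left]
        congr 1
        exact σ.tsum_eq (fun k => ‖(g : ∀ _ : K, W) k‖ ^ (2 : ℝ≥0∞).toReal)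
    _ = (C * ‖g‖) ^ (2 : ℝ≥0∞).toReal := by
        rw [Real.mul_rpow hC (norm_nonneg _), lp.norm_rpow_eq_tsum h2]

section BlockLemmas

variable {K W : Type*} [NormedAddCommGroup W] [InnerProductSpace ℂ W]

theorem IsBlockOp.unique {σ : K → K} {t : K → W →L[ℂ] W}
    {X Y : lp (fun _ : K => W) 2 →L[ℂ] lp (fun _ : K => W) 2}
    (hX : IsBlockOp σ t X) (hY : IsBlockOp σ t Y) : X = Y := by
  ext ξ k
  rw [hX, hY]

theorem exists_isBlockOp {C : ℝ} (hC : 0 ≤ C) (σ : K ≃ K) (t : K → W →L[ℂ] W)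
    (ht : ∀ k, ‖t k‖ ≤ C) : ∃ X, IsBlockOp σ t X ∧ ‖X‖ ≤ C := by
  have key : ∀ ξ : lp (fun _ : K => W) 2, ∃ η : lp (fun _ : K => W) 2,
      (∀ k, (η : ∀ _ : K, W) k = t k ((ξ : ∀ _ : K, W) (σ k))) ∧ ‖η‖ ≤ C * ‖ξ‖ := fun ξ =>
    exists_lp_of_norm_le hC σ _ ξ fun k => ((t k).le_opNorm _).trans (by gcongr; exact ht k)
  choose X hX hn using key
  let L : lp (fun _ : K => W) 2 →ₗ[ℂ] lp (fun _ : K => W) 2 :=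
    { toFun := X
      map_add' := by
        intro x y
        ext k
        rw [lp.coeFn_add, Pi.add_apply, hX, hX, hX, lp.coeFn_add, Pi.add_apply, map_add]
      map_smul' := by
        intro c x
        ext k
        rw [lp.coeFn_smul, Pi.smul_apply, hX, hX, lp.coeFn_smul, Pi.smul_apply, map_smul]
        rfl }
  exact ⟨L.mkContinuous C hn, fun ξ k => hX ξ k, L.mkContinuous_norm_le hC hn⟩

theorem isBlockOp_blockOp {C : ℝ} (σ : K ≃ K) {t : K → W →L[ℂ] W}
    (ht : ∀ k, ‖t k‖ ≤ C) : IsBlockOp σ t (blockOp σ t) := by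
  have h : ∃ X, IsBlockOp σ t X := by
    -- `C` may be negative when `K` is empty, so it is replaced by `max C 0`.
    obtain ⟨X, hX, -⟩ := exists_isBlockOp (le_max_right C 0) σ t
      (fun k => (ht k).trans (le_max_left C 0))
    exact ⟨X, hX⟩
  unfold blockOp
  rw [dif_pos h]
  exact h.choose_spec

theorem isBlockOp_diag {C : ℝ} {t : K → W →L[ℂ] W}
    (ht : ∀ k, ‖t k‖ ≤ C) : IsBlockOp id t (blockOp id t) :=
  isBlockOp_blockOp (Equiv.refl K) ht

theorem isBlockOp_const (t : W →L[ℂ] W) :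
    IsBlockOp (id : K → K) (fun _ => t) (blockOp id (fun _ => t)) :=
  isBlockOp_diag (fun _ => le_rfl)

theorem IsBlockOp.norm_le {C : ℝ} (hC : 0 ≤ C) {σ : K ≃ K} {t : K → W →L[ℂ] W}
    {X : lp (fun _ : K => W) 2 →L[ℂ] lp (fun _ : K => W) 2} (hX : IsBlockOp σ t X)
    (ht : ∀ k, ‖t k‖ ≤ C) : ‖X‖ ≤ C := by
  obtain ⟨Y, hY, hn⟩ := exists_isBlockOp hC σ t ht
  rwa [hX.unique hY]

theorem IsBlockOp.norm_le_of_diag {C : ℝ} (hC : 0 ≤ C) {t : K → W →L[ℂ] W}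
    {X : lp (fun _ : K => W) 2 →L[ℂ] lp (fun _ : K => W) 2} (hX : IsBlockOp id t X)
    (ht : ∀ k, ‖t k‖ ≤ C) : ‖X‖ ≤ C :=
  IsBlockOp.norm_le (σ := Equiv.refl K) hC hX ht

section Algebra

variable {σ σ' : K → K} {t t' : K → W →L[ℂ] W}
  {X X' : lp (fun _ : K => W) 2 →L[ℂ] lp (fun _ : K => W) 2}

theorem IsBlockOp.congr (hX : IsBlockOp σ t X) (hσ : ∀ k, σ k = σ' k) (ht : ∀ k, t k = t' k) :
    IsBlockOp σ' t' X := by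
  intro ξ k
  rw [hX, hσ, ht]

theorem IsBlockOp.mul (hX : IsBlockOp σ t X) (hX' : IsBlockOp σ' t' X') :
    IsBlockOp (σ' ∘ σ) (fun k => t k * t' (σ k)) (X * X') := by
  intro ξ k
  change (X (X' ξ) : ∀ _ : K, W) k = _
  rw [hX, hX']
  rfl

theorem IsBlockOp.add (hX : IsBlockOp σ t X) (hX' : IsBlockOp σ t' X') :
    IsBlockOp σ (fun k => t k + t' k) (X + X') := by
  intro ξ k
  change (X ξ : ∀ _ : K, W) k + (X' ξ : ∀ _ : K, W) k = _
  rw [hX, hX']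
  rfl

theorem IsBlockOp.sub (hX : IsBlockOp σ t X) (hX' : IsBlockOp σ t' X') :
    IsBlockOp σ (fun k => t k - t' k) (X - X') := by
  intro ξ k
  change (X ξ : ∀ _ : K, W) k - (X' ξ : ∀ _ : K, W) k = _
  rw [hX, hX']
  rfl

theorem IsBlockOp.neg (hX : IsBlockOp σ t X) : IsBlockOp σ (fun k => -t k) (-X) := by
  intro ξ k
  change -(X ξ : ∀ _ : K, W) k = _
  rw [hX]
  rfl

theorem IsBlockOp.smul (c : ℂ) (hX : IsBlockOp σ t X) :
    IsBlockOp σ (fun k => c • t k) (c • X) := by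
  intro ξ k
  change c • (X ξ : ∀ _ : K, W) k = _
  rw [hX]
  rfl

theorem isBlockOp_one : IsBlockOp (id : K → K) (fun _ => 1)
    (1 : lp (fun _ : K => W) 2 →L[ℂ] lp (fun _ : K => W) 2) := fun _ _ => rfl

theorem isBlockOp_zero (σ : K → K) : IsBlockOp σ (fun _ => 0)
    (0 : lp (fun _ : K => W) 2 →L[ℂ] lp (fun _ : K => W) 2) := fun _ _ => rfl

end Algebra

theorem IsBlockOp.star [CompleteSpace W] {t : K → W →L[ℂ] W}
    {X : lp (fun _ : K => W) 2 →L[ℂ] lp (fun _ : K => W) 2} {C : ℝ} (ht : ∀ k, ‖t k‖ ≤ C)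
    (hX : IsBlockOp id t X) : IsBlockOp id (fun k => star (t k)) (star X) := by
  have hY := isBlockOp_diag (K := K) (t := fun k => Star.star (t k)) (C := C)
    (fun k => by rw [norm_star]; exact ht k)
  convert hY
  rw [ContinuousLinearMap.star_eq_adjoint, eq_comm, ContinuousLinearMap.eq_adjoint_iff]
  intro x y
  rw [lp.inner_eq_tsum, lp.inner_eq_tsum]
  congr 1
  funext k
  rw [hX, hY]
  simp only [id, ContinuousLinearMap.star_eq_adjoint]
  rw [ContinuousLinearMap.adjoint_inner_left]

/-! ### Direct sums of unbounded operators -/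

theorem mem_graph_opSum {t : K → W →ₗ.[ℂ] W} {ξ η : lp (fun _ : K => W) 2} :
    (ξ, η) ∈ (opSum t).graph ↔ ∀ k, ((ξ : ∀ _ : K, W) k, (η : ∀ _ : K, W) k) ∈ (t k).graph := by
  unfold opSum
  rw [Submodule.toLinearPMap_graph_eq]
  · rfl
  -- `toLinearPMap` has the intended graph only if the relation is single-valued, which holds in
  -- each coordinate.
  · rintro ⟨x, y⟩ hx hx0
    simp only at hx0
    subst hx0
    ext k
    exact (t k).graph_fst_eq_zero_snd (hx k) rfl

/-! ### Matrix entries -/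

variable [DecidableEq K]

/-- The matrix entry `(p, q)` of a bounded operator on `ℓ²(K, W)`. -/
def entry (p q : K) :
    (lp (fun _ : K => W) 2 →L[ℂ] lp (fun _ : K => W) 2) →L[ℂ] (W →L[ℂ] W) :=
  LinearMap.mkContinuous
    { toFun := fun X => (lp.evalCLM ℂ (fun _ : K => W) 2 p) ∘L X ∘L
        (lp.singleContinuousLinearMap ℂ (fun _ : K => W) 2 q)
      map_add' := fun X Y => by ext; simp
      map_smul' := fun c X => by ext; simp }
    1 (by
      intro X
      refine ContinuousLinearMap.opNorm_le_bound _ (by positivity) fun w => ?_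
      refine (lp.norm_apply_le_norm (by norm_num) _ p).trans ?_
      refine (X.le_opNorm _).trans ?_
      rw [one_mul]
      refine le_of_eq ?_
      congr 1
      exact lp.norm_single (E := fun _ : K => W) (p := 2) (by norm_num) q w)

theorem entry_apply (p q : K) (X : lp (fun _ : K => W) 2 →L[ℂ] lp (fun _ : K => W) 2) (w : W) :
    entry p q X w = (X (lp.single 2 q w) : ∀ _ : K, W) p := rfl

theorem norm_entry_le (p q : K) (X : lp (fun _ : K => W) 2 →L[ℂ] lp (fun _ : K => W) 2) :
    ‖entry p q X‖ ≤ ‖X‖ := by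
  refine ContinuousLinearMap.opNorm_le_bound _ (by positivity) fun w => ?_
  rw [entry_apply]
  refine (lp.norm_apply_le_norm (by norm_num) _ p).trans ?_
  refine (X.le_opNorm _).trans ?_
  rw [lp.norm_single (by norm_num)]

/-- Finitely supported truncations converge in ℓ², and `X` followed by evaluation at `p` is
continuous. Hence bounded operators are determined by their matrix entries. -/
theorem hasSum_entry (X : lp (fun _ : K => W) 2 →L[ℂ] lp (fun _ : K => W) 2)
    (ξ : lp (fun _ : K => W) 2) (p : K) :
    HasSum (fun q => entry p q X ((ξ : ∀ _ : K, W) q)) ((X ξ : ∀ _ : K, W) p) := by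
  have h := (lp.hasSum_single (by norm_num) ξ).mapL
    ((lp.evalCLM ℂ (fun _ : K => W) 2 p) ∘L X)
  exact h

theorem ext_entry {X Y : lp (fun _ : K => W) 2 →L[ℂ] lp (fun _ : K => W) 2}
    (h : ∀ p q, entry p q X = entry p q Y) : X = Y := by
  ext ξ p
  have h1 := hasSum_entry X ξ p
  simp only [h] at h1
  exact h1.unique (hasSum_entry Y ξ p)

theorem isBlockOp_iff_entry {σ : K → K} {t : K → W →L[ℂ] W}
    {X : lp (fun _ : K => W) 2 →L[ℂ] lp (fun _ : K => W) 2} :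
    IsBlockOp σ t X ↔ ∀ p q, entry p q X = if σ p = q then t p else 0 := by
  constructor
  · intro h p q
    ext w
    rw [entry_apply, h, lp.single_apply]
    split_ifs with hpq
    · subst hpq; simp
    · simp [hpq]
  · intro h ξ p
    have h1 := hasSum_entry X ξ p
    have h2 : HasSum (fun q => entry p q X ((ξ : ∀ _ : K, W) q))
        (entry p (σ p) X ((ξ : ∀ _ : K, W) (σ p))) :=
      hasSum_single _ fun q hq => by rw [h, if_neg (Ne.symm hq)]; rfl
    rw [h1.unique h2, h, if_pos rfl]

theorem IsBlockOp.entry_eq {σ : K → K} {t : K → W →L[ℂ] W}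
    {X : lp (fun _ : K => W) 2 →L[ℂ] lp (fun _ : K => W) 2} (h : IsBlockOp σ t X) (p : K) :
    entry p (σ p) X = t p := by
  rw [isBlockOp_iff_entry.mp h, if_pos rfl]

theorem IsBlockOp.norm_apply_le {σ : K → K} {t : K → W →L[ℂ] W}
    {X : lp (fun _ : K => W) 2 →L[ℂ] lp (fun _ : K => W) 2} (h : IsBlockOp σ t X) (p : K) :
    ‖t p‖ ≤ ‖X‖ := by
  rw [← h.entry_eq p]
  exact norm_entry_le _ _ _

theorem isBlockOp_of_diagonal {X : lp (fun _ : K => W) 2 →L[ℂ] lp (fun _ : K => W) 2}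
    (h : ∀ p q, p ≠ q → entry p q X = 0) : IsBlockOp id (fun p => entry p p X) X := by
  rw [isBlockOp_iff_entry]
  intro p q
  split_ifs with hpq
  · simp only [id] at hpq; rw [hpq]
  · exact h p q hpq

theorem IsBlockOp.apply_single {t : K → W →L[ℂ] W}
    {X : lp (fun _ : K => W) 2 →L[ℂ] lp (fun _ : K => W) 2} (h : IsBlockOp id t X) (p : K) (w : W) :
    X (lp.single 2 p w) = lp.single 2 p (t p w) := by
  ext k
  rw [h]
  by_cases hk : k = p
  · subst hk; simp
  · simp [lp.single_apply, hk]

end BlockLemmas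

end CrossGauge
end

/-! ### Operators on V ⊗ H₀ and Schur's lemma. -/

noncomputable section
namespace CrossGauge

/-! ### Operators on `V ⊗ H₀` -/

section FibreLemmas

theorem clm_mul_neg {E : Type*} [NormedAddCommGroup E] [InnerProductSpace ℂ E] (A B : E →L[ℂ] E) :
    A * -B = -(A * B) := mul_neg A B

theorem clm_neg_mul {E : Type*} [NormedAddCommGroup E] [InnerProductSpace ℂ E] (A B : E →L[ℂ] E) :
    -A * B = -(A * B) := neg_mul A B

variable {ι H₀ : Type*} [Fintype ι] [NormedAddCommGroup H₀] [InnerProductSpace ℂ H₀]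

theorem tens_apply (x : Matrix ι ι ℂ) (S : H₀ →L[ℂ] H₀) (w : Fib ι H₀) (i : ι) :
    tens x S w i = ∑ j, x i j • S (w j) := by
  simp [tens]

theorem tens_mul (x y : Matrix ι ι ℂ) (S S' : H₀ →L[ℂ] H₀) :
    tens x S * tens y S' = tens (x * y) (S * S') := by
  ext w i
  rw [mul_apply_eq_comp, tens_apply, tens_apply]
  simp only [tens_apply, map_sum, map_smul, Matrix.mul_apply, Finset.sum_smul, Finset.smul_sum,
    smul_smul, mul_apply_eq_comp]
  rw [Finset.sum_comm]

theorem tens_add (x : Matrix ι ι ℂ) (S S' : H₀ →L[ℂ] H₀) :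
    tens x (S + S') = tens x S + tens x S' := by
  ext w i
  simp [tens_apply, Finset.sum_add_distrib]

theorem tens_smul (x : Matrix ι ι ℂ) (c : ℂ) (S : H₀ →L[ℂ] H₀) :
    tens x (c • S) = c • tens x S := by
  ext w i
  simp [tens_apply, Finset.smul_sum, smul_comm c]

theorem tens_neg (x : Matrix ι ι ℂ) (S : H₀ →L[ℂ] H₀) : tens x (-S) = -tens x S := by
  ext w i
  simp [tens_apply]

theorem tens_sub (x : Matrix ι ι ℂ) (S S' : H₀ →L[ℂ] H₀) :
    tens x (S - S') = tens x S - tens x S' := by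
  rw [sub_eq_add_neg, tens_add, tens_neg, sub_eq_add_neg]

theorem tens_zero (x : Matrix ι ι ℂ) : tens x (0 : H₀ →L[ℂ] H₀) = 0 := by
  ext w i
  simp [tens_apply]

theorem tens_neg_left (x : Matrix ι ι ℂ) (S : H₀ →L[ℂ] H₀) : tens (-x) S = -tens x S := by
  ext w i
  simp [tens_apply]

theorem tens_smul_left (x : Matrix ι ι ℂ) (c : ℂ) (S : H₀ →L[ℂ] H₀) :
    tens (c • x) S = c • tens x S := by
  ext w i
  simp [tens_apply, Finset.smul_sum, mul_smul]

theorem inner_tens [CompleteSpace H₀] (x : Matrix ι ι ℂ) (S : H₀ →L[ℂ] H₀) (w w' : Fib ι H₀) :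
    inner ℂ (tens (star x) (star S) w) w' = inner ℂ w (tens x S w') := by
  rw [PiLp.inner_apply, PiLp.inner_apply]
  simp only [tens_apply, sum_inner, inner_sum, inner_smul_left, inner_smul_right]
  rw [Finset.sum_comm]
  refine Finset.sum_congr rfl fun i _ => Finset.sum_congr rfl fun j _ => ?_
  rw [ContinuousLinearMap.star_eq_adjoint, ContinuousLinearMap.adjoint_inner_left,
    Matrix.star_apply]
  simp

theorem star_tens [CompleteSpace H₀] (x : Matrix ι ι ℂ) (S : H₀ →L[ℂ] H₀) :
    star (tens x S) = tens (star x) (star S) := by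
  rw [ContinuousLinearMap.star_eq_adjoint, eq_comm, ContinuousLinearMap.eq_adjoint_iff]
  exact inner_tens x S

/-- The matrix entry `(i, j)` of an operator on `V ⊗ H₀`. -/
def fibEntry [DecidableEq ι] (i j : ι) :
    (Fib ι H₀ →L[ℂ] Fib ι H₀) →L[ℂ] (H₀ →L[ℂ] H₀) :=
  LinearMap.mkContinuous
    { toFun := fun Y => (PiLp.proj 2 (fun _ : ι => H₀) i : Fib ι H₀ →L[ℂ] H₀) ∘L Y ∘L
        (((PiLp.continuousLinearEquiv 2 ℂ (fun _ : ι => H₀)).symm : (ι → H₀) →L[ℂ] Fib ι H₀) ∘L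
          ContinuousLinearMap.single ℂ (fun _ : ι => H₀) j)
      map_add' := fun X Y => by ext; simp
      map_smul' := fun c X => by ext; simp }
    1 (by
      intro Y
      refine ContinuousLinearMap.opNorm_le_bound _ (by positivity) fun h => ?_
      refine (PiLp.norm_apply_le _ i).trans ?_
      refine (Y.le_opNorm _).trans ?_
      rw [one_mul]
      refine le_of_eq ?_
      congr 1
      exact PiLp.norm_single (p := 2) (β := fun _ : ι => H₀) j h)

theorem fibEntry_apply [DecidableEq ι] (i j : ι) (Y : Fib ι H₀ →L[ℂ] Fib ι H₀) (h : H₀) :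
    fibEntry i j Y h = Y (WithLp.toLp 2 (Pi.single j h)) i := rfl

theorem norm_fibEntry_le [DecidableEq ι] (i j : ι) (Y : Fib ι H₀ →L[ℂ] Fib ι H₀) :
    ‖fibEntry i j Y‖ ≤ ‖Y‖ := by
  refine ContinuousLinearMap.opNorm_le_bound _ (by positivity) fun h => ?_
  rw [fibEntry_apply]
  refine (PiLp.norm_apply_le _ i).trans ?_
  refine (Y.le_opNorm _).trans ?_
  refine le_of_eq ?_
  congr 1
  exact PiLp.norm_single (p := 2) (β := fun _ : ι => H₀) j h

theorem apply_eq_sum_fibEntry [DecidableEq ι] (Y : Fib ι H₀ →L[ℂ] Fib ι H₀) (w : Fib ι H₀)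
    (i : ι) : Y w i = ∑ j, fibEntry i j Y (w j) := by
  have hw : w = ∑ j, WithLp.toLp 2 (Pi.single j (w j)) := by
    ext k
    simp [Finset.sum_apply, Pi.single_apply]
  conv_lhs => rw [hw, map_sum]
  simp [fibEntry_apply]

theorem ext_fibEntry [DecidableEq ι] {Y Z : Fib ι H₀ →L[ℂ] Fib ι H₀}
    (h : ∀ i j, fibEntry i j Y = fibEntry i j Z) : Y = Z := by
  ext w i
  rw [apply_eq_sum_fibEntry, apply_eq_sum_fibEntry]
  simp only [h]

theorem fibEntry_tens [DecidableEq ι] (i j : ι) (x : Matrix ι ι ℂ) (S : H₀ →L[ℂ] H₀) :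
    fibEntry i j (tens x S) = x i j • S := by
  ext h
  rw [fibEntry_apply, tens_apply, Finset.sum_eq_single j]
  · simp
  · intro k _ hk
    simp [hk]
  · simp

theorem fibEntry_tens_mul [DecidableEq ι] (i k : ι) (x : Matrix ι ι ℂ)
    (Y : Fib ι H₀ →L[ℂ] Fib ι H₀) :
    fibEntry i k (tens x 1 * Y) = ∑ j, x i j • fibEntry j k Y := by
  ext h
  rw [fibEntry_apply, mul_apply_eq_comp, tens_apply]
  simp [fibEntry_apply]

theorem fibEntry_mul_tens [DecidableEq ι] (i k : ι) (x : Matrix ι ι ℂ)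
    (Y : Fib ι H₀ →L[ℂ] Fib ι H₀) :
    fibEntry i k (Y * tens x 1) = ∑ j, x j k • fibEntry i j Y := by
  ext h
  rw [fibEntry_apply, mul_apply_eq_comp, apply_eq_sum_fibEntry]
  have h1 : ∀ j, tens x (1 : H₀ →L[ℂ] H₀) (WithLp.toLp 2 (Pi.single k h)) j = x j k • h := by
    intro j
    have := congrArg (fun S => S h) (fibEntry_tens j k x (1 : H₀ →L[ℂ] H₀))
    simpa [fibEntry_apply] using this
  rw [sum_apply]
  refine Finset.sum_congr rfl fun j _ => ?_
  rw [h1, map_smul]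
  rfl

theorem tens_one_one [DecidableEq ι] : tens (1 : Matrix ι ι ℂ) (1 : H₀ →L[ℂ] H₀) = 1 := by
  ext w i
  simp [tens_apply, Matrix.one_apply]

theorem tens_one_apply [DecidableEq ι] (S : H₀ →L[ℂ] H₀) (w : Fib ι H₀) (i : ι) :
    tens (1 : Matrix ι ι ℂ) S w i = S (w i) := by
  simp [tens_apply, Matrix.one_apply]

theorem norm_tens_one [DecidableEq ι] [Nonempty ι] (S : H₀ →L[ℂ] H₀) :
    ‖tens (1 : Matrix ι ι ℂ) S‖ = ‖S‖ := by
  apply le_antisymm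
  · refine ContinuousLinearMap.opNorm_le_bound _ (norm_nonneg _) fun w => ?_
    rw [PiLp.norm_eq_of_L2, PiLp.norm_eq_of_L2]
    refine Real.sqrt_le_iff.mpr ⟨by positivity, ?_⟩
    rw [mul_pow, Real.sq_sqrt (by positivity), Finset.mul_sum]
    refine Finset.sum_le_sum fun i _ => ?_
    rw [tens_one_apply, ← mul_pow]
    gcongr
    exact S.le_opNorm _
  · obtain ⟨i⟩ := ‹Nonempty ι›
    have := norm_fibEntry_le i i (tens (1 : Matrix ι ι ℂ) S)
    rwa [fibEntry_tens, Matrix.one_apply_eq, one_smul] at this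

theorem tens_one_injective [DecidableEq ι] [Nonempty ι] {S S' : H₀ →L[ℂ] H₀}
    (h : tens (1 : Matrix ι ι ℂ) S = tens 1 S') : S = S' := by
  obtain ⟨i⟩ := ‹Nonempty ι›
  have := congrArg (fibEntry i i) h
  simpa [fibEntry_tens] using this

/-- A matrix with scalar x*x is a multiple of an isometry, and so is x ⊗ 1. It is used for the
symbol s(k), with c = 4π²‖k‖². -/
theorem norm_sq_tens [DecidableEq ι] [CompleteSpace H₀] {x : Matrix ι ι ℂ} {c : ℝ}
    (h : star x * x = (c : ℂ) • 1) (w : Fib ι H₀) :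
    ‖tens x (1 : H₀ →L[ℂ] H₀) w‖ ^ 2 = c * ‖w‖ ^ 2 := by
  have h1 := inner_self_eq_norm_sq_to_K (𝕜 := ℂ) (tens x (1 : H₀ →L[ℂ] H₀) w)
  have h2 := inner_self_eq_norm_sq_to_K (𝕜 := ℂ) w
  rw [← inner_tens, star_one, ← mul_apply_eq_comp, tens_mul, h, one_mul,
    tens_smul_left, tens_one_one, smul_apply, one_apply_eq_self,
    inner_smul_left, h2] at h1
  simp only [Complex.conj_ofReal] at h1
  apply Complex.ofReal_injective
  push_cast
  exact h1.symm

theorem norm_tens_isometry [DecidableEq ι] [CompleteSpace H₀] {x : Matrix ι ι ℂ}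
    (h : star x * x = 1) (w : Fib ι H₀) : ‖tens x (1 : H₀ →L[ℂ] H₀) w‖ = ‖w‖ := by
  have := norm_sq_tens (c := 1) (by simpa using h) w
  rw [one_mul] at this
  exact (sq_eq_sq₀ (norm_nonneg _) (norm_nonneg _)).mp this

theorem norm_tens_of_isometry [DecidableEq ι] [Nonempty ι] [CompleteSpace H₀] {x : Matrix ι ι ℂ}
    (h : star x * x = 1) (S : H₀ →L[ℂ] H₀) : ‖tens x S‖ = ‖S‖ := by
  rw [← norm_tens_one (ι := ι) S]
  have e : tens x S = tens x 1 * tens 1 S := by rw [tens_mul, mul_one, one_mul]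
  apply le_antisymm
  · refine ContinuousLinearMap.opNorm_le_bound _ (norm_nonneg _) fun w => ?_
    rw [e, mul_apply_eq_comp, norm_tens_isometry h]
    exact ContinuousLinearMap.le_opNorm _ _
  · refine ContinuousLinearMap.opNorm_le_bound _ (norm_nonneg _) fun w => ?_
    rw [← norm_tens_isometry h, ← mul_apply_eq_comp, ← e]
    exact ContinuousLinearMap.le_opNorm _ _

end FibreLemmas

/-! ### Schur's lemma for spin modules -/

namespace SpinModule

variable {m : ℕ} {ι : Type*} [Fintype ι] [DecidableEq ι] (V : SpinModule m ι)

theorem e_sq (i : Fin m) : V.e i * V.e i = -1 := by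
  have h := V.e_rel i i
  rw [if_pos rfl] at h
  have h2 : (2 : ℂ) • (V.e i * V.e i) = (2 : ℂ) • (-1 : Matrix ι ι ℂ) := by
    rw [two_smul, two_smul, h]
    norm_num
  exact smul_right_injective _ (two_ne_zero) h2

theorem f_sq (i : Fin m) : V.f i * V.f i = -1 := by
  have h := V.f_rel i i
  rw [if_pos rfl] at h
  have h2 : (2 : ℂ) • (V.f i * V.f i) = (2 : ℂ) • (-1 : Matrix ι ι ℂ) := by
    rw [two_smul, two_smul, h]
    norm_num
  exact smul_right_injective _ (two_ne_zero) h2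

/-- An eigenspace of `N` exists over ℂ and is a nonzero graded submodule, so irreducibility makes it
the whole space. -/
theorem exists_eq_smul_one_of_commute (N : Matrix ι ι ℂ) (hg : Commute N V.grading)
    (he : ∀ i, Commute N (V.e i)) (hf : ∀ i, Commute N (V.f i)) : ∃ c : ℂ, N = c • 1 := by
  have := V.nonempty
  obtain ⟨c, hc⟩ := Module.End.exists_eigenvalue (Matrix.toLin' N)
  have inv : ∀ x : Matrix ι ι ℂ, Commute N x → ∀ v ∈ Module.End.eigenspace (Matrix.toLin' N) c,
      x.mulVec v ∈ Module.End.eigenspace (Matrix.toLin' N) c := by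
    intro x hx v hv
    rw [Module.End.mem_eigenspace_iff, Matrix.toLin'_apply] at hv ⊢
    rw [Matrix.mulVec_mulVec, hx.eq, ← Matrix.mulVec_mulVec, hv, Matrix.mulVec_smul]
  rcases V.irreducible _ (inv _ hg) (fun i => inv _ (he i)) (fun i => inv _ (hf i)) with h | h
  · exact absurd h hc
  · refine ⟨c, Matrix.toLin'.injective (LinearMap.ext fun v => ?_)⟩
    have hv : v ∈ Module.End.eigenspace (Matrix.toLin' N) c := by rw [h]; trivial
    rw [Module.End.mem_eigenspace_iff] at hv
    rw [hv, Matrix.toLin'_apply, Matrix.smul_mulVec, Matrix.one_mulVec]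

/-- The product of the `e i * f i` over a list of indices. -/
def volume (l : List (Fin m)) : Matrix ι ι ℂ := (l.map fun i => V.e i * V.f i).prod

/-- Passing `e j` through `e i * f i` costs two signs when i ≠ j, and they cancel. -/
theorem e_mul_f_mul_e (i j : Fin m) (h : i ≠ j) :
    V.e i * V.f i * V.e j = V.e j * (V.e i * V.f i) := by
  have h1 := V.e_rel i j
  rw [if_neg h] at h1
  have h1 := eq_neg_of_add_eq_zero_left h1
  have h2 := V.e_f j i
  rw [mul_assoc, ← neg_eq_iff_eq_neg.mpr h2, mul_neg, ← mul_assoc, h1]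
  simp [mul_assoc]

theorem e_mul_f_mul_f (i j : Fin m) (h : i ≠ j) :
    V.e i * V.f i * V.f j = V.f j * (V.e i * V.f i) := by
  have h1 := V.f_rel i j
  rw [if_neg h] at h1
  have h1 := eq_neg_of_add_eq_zero_left h1
  have h2 := V.e_f i j
  rw [mul_assoc, h1, mul_neg, ← mul_assoc, h2]
  simp [mul_assoc]

/-- For equal indices `e i` commutes with itself, so only the sign from `f i` remains. -/
theorem e_mul_f_mul_e_self (i : Fin m) :
    V.e i * V.f i * V.e i = -(V.e i * (V.e i * V.f i)) := by
  have h : V.f i * V.e i = -(V.e i * V.f i) := by rw [V.e_f, neg_neg]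
  rw [mul_assoc, h, mul_neg]

theorem e_mul_f_mul_f_self (i : Fin m) :
    V.e i * V.f i * V.f i = -(V.f i * (V.e i * V.f i)) := by
  rw [V.e_f i i]
  simp [mul_assoc, V.e_f]

/-- Only the factor of index `j` contributes a sign, and it occurs at most once in a list without
repetition. -/
theorem volume_mul {x : Matrix ι ι ℂ} {j : Fin m}
    (h : ∀ i, i ≠ j → V.e i * V.f i * x = x * (V.e i * V.f i))
    (h' : V.e j * V.f j * x = -(x * (V.e j * V.f j))) (l : List (Fin m)) (hl : l.Nodup) :
    V.volume l * x = (if j ∈ l then -1 else 1 : ℂ) • (x * V.volume l) := by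
  induction l with
  | nil => simp [volume]
  | cons i l ih =>
    rw [List.nodup_cons] at hl
    have e : V.volume (i :: l) = V.e i * V.f i * V.volume l := by simp [volume]
    rw [e, mul_assoc, ih hl.2]
    by_cases hij : i = j
    · subst hij
      rw [if_neg hl.1, if_pos (by simp), one_smul, ← mul_assoc, h', neg_smul, one_smul]
      simp [mul_assoc]
    · have hm : j ∈ i :: l ↔ j ∈ l := by
        simp [Ne.symm hij]
      simp only [hm, mul_smul_comm]
      rw [← mul_assoc, h i hij, mul_assoc]

theorem volume_mul_grading (l : List (Fin m)) :
    V.volume l * V.grading = V.grading * V.volume l := by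
  induction l with
  | nil => simp [volume]
  | cons i l ih =>
    have e : V.volume (i :: l) = V.e i * V.f i * V.volume l := by simp [volume]
    rw [e, mul_assoc, ih, ← mul_assoc, mul_assoc (V.e i), V.f_odd, mul_neg, ← mul_assoc, V.e_odd]
    simp [mul_assoc]

theorem isUnit_volume (l : List (Fin m)) : IsUnit (V.volume l) := by
  induction l with
  | nil => simp [volume]
  | cons i l ih =>
    have e : V.volume (i :: l) = V.e i * V.f i * V.volume l := by simp [volume]
    rw [e]
    refine (IsUnit.mul ?_ ?_).mul ih
    · exact IsUnit.of_mul_eq_one (-V.e i) (by rw [mul_neg, V.e_sq, neg_neg])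
    · exact IsUnit.of_mul_eq_one (-V.f i) (by rw [mul_neg, V.f_sq, neg_neg])

theorem commute_volume {N : Matrix ι ι ℂ} (he : ∀ i, Commute N (V.e i))
    (hf : ∀ i, Commute N (V.f i)) (l : List (Fin m)) : Commute N (V.volume l) := by
  induction l with
  | nil => simp [volume]
  | cons i l ih =>
    have e : V.volume (i :: l) = V.e i * V.f i * V.volume l := by simp [volume]
    rw [e]
    exact ((he i).mul_right (hf i)).mul_right ih

/-- The grading is a multiple of the volume element, so that the ungraded module is irreducible. -/
theorem exists_eq_smul_one (N : Matrix ι ι ℂ)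
    (he : ∀ i, Commute N (V.e i)) (hf : ∀ i, Commute N (V.f i)) : ∃ c : ℂ, N = c • 1 := by
  refine V.exists_eq_smul_one_of_commute N ?_ he hf
  -- The volume element ω anticommutes with all generators and commutes with γ. So γω commutes with
  -- everything and is a scalar; as `N` commutes with the invertible ω, it also commutes with γ.
  set ω := V.volume (List.finRange m) with hω
  have hωe : ∀ j, ω * V.e j = -(V.e j * ω) := fun j => by
    rw [hω, V.volume_mul (fun i hi => V.e_mul_f_mul_e i j hi) (V.e_mul_f_mul_e_self j) _
      (List.nodup_finRange m), if_pos (List.mem_finRange j), neg_smul, one_smul]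
  have hωf : ∀ j, ω * V.f j = -(V.f j * ω) := fun j => by
    rw [hω, V.volume_mul (fun i hi => V.e_mul_f_mul_f i j hi) (V.e_mul_f_mul_f_self j) _
      (List.nodup_finRange m), if_pos (List.mem_finRange j), neg_smul, one_smul]
  have hωg : ω * V.grading = V.grading * ω := V.volume_mul_grading _
  obtain ⟨c, hc⟩ := V.exists_eq_smul_one_of_commute (V.grading * ω)
    (by rw [commute_iff_eq, mul_assoc, hωg])
    (fun i => by
      rw [commute_iff_eq, mul_assoc, hωe, mul_neg, ← mul_assoc, ← mul_assoc, V.e_odd, neg_mul])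
    (fun i => by
      rw [commute_iff_eq, mul_assoc, hωf, mul_neg, ← mul_assoc, ← mul_assoc, V.f_odd, neg_mul])
  have hN : N * ω = ω * N := V.commute_volume he hf _
  rw [commute_iff_eq]
  apply (V.isUnit_volume (List.finRange m)).mul_right_cancel
  rw [← hω, mul_assoc, hc, mul_assoc, hN, ← mul_assoc, hc]
  simp

variable {H₀ : Type*} [NormedAddCommGroup H₀] [InnerProductSpace ℂ H₀]

/-- An operator on `V ⊗ H₀` that commutes with the Clifford actions on `V` is of the form `1 ⊗ X`. -/
theorem exists_eq_tens_one (Y : Fib ι H₀ →L[ℂ] Fib ι H₀)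
    (he : ∀ i, Y * tens (V.e i) 1 = tens (V.e i) 1 * Y)
    (hf : ∀ i, Y * tens (V.f i) 1 = tens (V.f i) 1 * Y) :
    ∃ X : H₀ →L[ℂ] H₀, Y = tens 1 X := by
  obtain ⟨i₀⟩ := V.nonempty
  -- For fixed vectors g, h the inner products ⟨g, Y_ij h⟩ form a scalar matrix-valued coefficient
  -- of `Y`, to which the finite-dimensional Schur lemma applies.
  have comm : ∀ (x : Matrix ι ι ℂ) (g h : H₀), Y * tens x 1 = tens x 1 * Y →
      Commute (Matrix.of fun i j => (inner ℂ g (fibEntry i j Y h) : ℂ)) x := by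
    intro x g h hx
    rw [commute_iff_eq]
    ext i k
    have := congrArg (fun Z => inner ℂ g (fibEntry i k Z h)) hx
    simp only [fibEntry_mul_tens, fibEntry_tens_mul, sum_apply,
      smul_apply, inner_sum, inner_smul_right] at this
    simp only [Matrix.mul_apply, Matrix.of_apply]
    rw [← this]
    exact Finset.sum_congr rfl fun j _ => mul_comm _ _
  have key : ∀ g h : H₀, ∃ c : ℂ, ∀ i j, inner ℂ g (fibEntry i j Y h) =
      if i = j then c else 0 := by
    intro g h
    obtain ⟨c, hc⟩ := V.exists_eq_smul_one _ (fun i => comm _ g h (he i))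
      (fun i => comm _ g h (hf i))
    refine ⟨c, fun i j => ?_⟩
    have := congrFun (congrFun hc i) j
    simpa [Matrix.one_apply] using this
  refine ⟨fibEntry i₀ i₀ Y, ext_fibEntry fun i j => ?_⟩
  rw [fibEntry_tens]
  ext h
  refine ext_inner_left ℂ fun g => ?_
  obtain ⟨c, hc⟩ := key g h
  rw [hc, smul_apply, inner_smul_right, hc, if_pos rfl, Matrix.one_apply]
  split_ifs <;> simp

theorem tens_grading_sq : tens V.grading (1 : H₀ →L[ℂ] H₀) * tens V.grading 1 = 1 := by
  rw [tens_mul, V.grading_sq, one_mul, tens_one_one]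

/-- An operator on `V ⊗ H₀` that anticommutes with the Clifford actions on `V` is of the form
`γ ⊗ X`. -/
theorem exists_eq_tens_grading (Y : Fib ι H₀ →L[ℂ] Fib ι H₀)
    (he : ∀ i, Y * tens (V.e i) 1 = -(tens (V.e i) 1 * Y))
    (hf : ∀ i, Y * tens (V.f i) 1 = -(tens (V.f i) 1 * Y)) :
    ∃ X : H₀ →L[ℂ] H₀, Y = tens V.grading X := by
  -- γ ⊗ 1 also anticommutes with the generators, so (γ ⊗ 1) Y commutes with them and the ungraded
  -- case applies.
  have aux : ∀ x : Matrix ι ι ℂ, x * V.grading = -(V.grading * x) →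
      Y * tens x 1 = -(tens x 1 * Y) →
      tens V.grading 1 * Y * tens x 1 = tens x 1 * (tens V.grading 1 * Y) := by
    intro x hx hY
    rw [mul_assoc, hY, clm_mul_neg, ← mul_assoc, ← mul_assoc, tens_mul, tens_mul, hx,
      tens_neg_left, clm_neg_mul]
  obtain ⟨X, hX⟩ := V.exists_eq_tens_one (tens V.grading 1 * Y)
    (fun i => aux _ (V.e_odd i) (he i)) (fun i => aux _ (V.f_odd i) (hf i))
  refine ⟨X, ?_⟩
  have := congrArg (fun Z => tens V.grading 1 * Z) hX
  simp only [← mul_assoc, V.tens_grading_sq] at this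
  rwa [one_mul, tens_mul, mul_one, one_mul] at this

theorem norm_tens_grading [CompleteSpace H₀] (S : H₀ →L[ℂ] H₀) : ‖tens V.grading S‖ = ‖S‖ := by
  have := V.nonempty
  exact norm_tens_of_isometry (by rw [V.grading_star, V.grading_sq]) S

theorem tens_grading_injective {S S' : H₀ →L[ℂ] H₀}
    (h : tens V.grading S = tens V.grading S') : S = S' := by
  have := V.nonempty
  have := congrArg (fun Z => tens V.grading 1 * Z) h
  simp only [tens_mul, V.grading_sq, one_mul] at this
  exact tens_one_injective this

end SpinModule

end CrossGauge
end

/-! ### Commutators with D₀, one-forms, and the growth of cocycles. -/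

noncomputable section
namespace CrossGauge

/-! ### Commutators -/

section CommutatorLemmas

variable {E : Type*} [NormedAddCommGroup E] [InnerProductSpace ℂ E]

theorem IsCommutator.add {T : E →ₗ.[ℂ] E} {S S' X X' : E →L[ℂ] E}
    (h : IsCommutator T S X) (h' : IsCommutator T S' X') :
    IsCommutator T (S + S') (X + X') := by
  intro ξ
  obtain ⟨h1, e1⟩ := h ξ
  obtain ⟨h2, e2⟩ := h' ξ
  refine ⟨T.domain.add_mem h1 h2, ?_⟩
  have : T ⟨(S + S') ξ, T.domain.add_mem h1 h2⟩ = T ⟨S ξ, h1⟩ + T ⟨S' ξ, h2⟩ :=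
    T.map_add ⟨S ξ, h1⟩ ⟨S' ξ, h2⟩
  rw [this, add_apply, add_apply, ← e1, ← e2]
  abel

theorem IsCommutator.smul {T : E →ₗ.[ℂ] E} {S X : E →L[ℂ] E} (c : ℂ)
    (h : IsCommutator T S X) : IsCommutator T (c • S) (c • X) := by
  intro ξ
  obtain ⟨h1, e1⟩ := h ξ
  refine ⟨T.domain.smul_mem c h1, ?_⟩
  have : T ⟨(c • S) ξ, T.domain.smul_mem c h1⟩ = c • T ⟨S ξ, h1⟩ := T.map_smul c ⟨S ξ, h1⟩
  rw [this, smul_apply, smul_apply, ← e1, smul_sub]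

theorem IsCommutator.mem_graph {T : E →ₗ.[ℂ] E} {S X : E →L[ℂ] E} (h : IsCommutator T S X)
    {x y : E} (hx : (x, y) ∈ T.graph) : (S x, S y + X x) ∈ T.graph := by
  rw [LinearPMap.mem_graph_iff] at hx
  obtain ⟨ξ, rfl, rfl⟩ := hx
  obtain ⟨h1, e1⟩ := h ξ
  rw [LinearPMap.mem_graph_iff]
  exact ⟨⟨_, h1⟩, rfl, by rw [← e1]; simp⟩

theorem AnticommutesWith.mem_graph {T : E →ₗ.[ℂ] E} {S : E →L[ℂ] E} (h : AnticommutesWith T S)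
    {x y : E} (hx : (x, y) ∈ T.graph) : (S x, -S y) ∈ T.graph := by
  rw [LinearPMap.mem_graph_iff] at hx
  obtain ⟨ξ, rfl, rfl⟩ := hx
  obtain ⟨h1, e1⟩ := h ξ
  rw [LinearPMap.mem_graph_iff]
  exact ⟨⟨_, h1⟩, rfl, e1⟩

/-- Computing T on S g x = g S x in two ways gives the relation on the dense domain. With S = b it
makes [D₀, b] odd and supercommuting with the multigrading. -/
theorem IsCommutator.anticomm {T : E →ₗ.[ℂ] E} {S X g : E →L[ℂ] E}
    (hT : Dense (T.domain : Set E)) (h : IsCommutator T S X) (hg : AnticommutesWith T g)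
    (hS : S * g = g * S) : X * g = -(g * X) := by
  apply DFunLike.ext'
  refine Continuous.ext_on hT (X * g).continuous (-(g * X)).continuous ?_
  intro x hx
  have hS' : ∀ v, S (g v) = g (S v) := fun v => congrArg (fun R => R v) hS
  have h0 : (x, T ⟨x, hx⟩) ∈ T.graph := T.mem_graph ⟨x, hx⟩
  have h1 := h.mem_graph (hg.mem_graph h0)
  have h2 := hg.mem_graph (h.mem_graph h0)
  rw [hS'] at h1
  have h3 := LinearPMap.mem_graph_snd_inj T h1 h2 rfl
  change X (g x) = -(g (X x))
  rw [map_neg, hS', map_add, neg_add] at h3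
  exact add_left_cancel h3

/-- The Leibniz rule for the two orders of S S' = S' S has one common term on each side, which
cancels. -/
theorem IsCommutator.mul_comm_of_commute {T : E →ₗ.[ℂ] E} {S X S' X' : E →L[ℂ] E}
    (hT : Dense (T.domain : Set E)) (h : IsCommutator T S X) (h' : IsCommutator T S' X')
    (hS : S * S' = S' * S) (hX : X * S' = S' * X) : S * X' = X' * S := by
  have h1 := h.mul h'
  have h2 := h'.mul h
  rw [hS] at h1
  have h3 := h1.unique hT h2
  rw [hX, add_comm] at h3
  exact add_right_cancel h3

end CommutatorLemmas

/-! ### The base spectral triple -/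

namespace SpectralTriple

variable {m r : ℕ} {B H₀ : Type*} [CStarAlgebra B] [NormedAddCommGroup H₀]
  [InnerProductSpace ℂ H₀] [CompleteSpace H₀]

section Base

variable (T : SpectralTriple r B H₀)

theorem norm_rep (b : B) : ‖T.rep b‖ = ‖b‖ :=
  NonUnitalStarAlgHom.norm_map T.rep T.rep_injective b

theorem isometry_rep : Isometry T.rep :=
  AddMonoidHomClass.isometry_of_norm T.rep T.norm_rep

theorem dense_domain : Dense (T.D.domain : Set H₀) := T.D_selfAdjoint.dense_domain

/-- The closed subspace of all `x` with `x g = c g x`. -/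
theorem isClosed_mul_eq_smul_mul (g : H₀ →L[ℂ] H₀) (c : ℂ) :
    IsClosed {x : H₀ →L[ℂ] H₀ | x * g = c • (g * x)} :=
  isClosed_eq (by fun_prop) (by fun_prop)

theorem commute_of_smooth {X : H₀ →L[ℂ] H₀} (h : ∀ b ∈ T.smooth, X * T.rep b = T.rep b * X)
    (b : B) : X * T.rep b = T.rep b * X := by
  have hc : Continuous T.rep := T.isometry_rep.continuous
  have hcl : IsClosed {b : B | X * T.rep b = T.rep b * X} :=
    isClosed_eq (by fun_prop) (by fun_prop)
  have := T.smooth_dense.closure_eq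
  have h2 : closure (T.smooth : Set B) ⊆ {b : B | X * T.rep b = T.rep b * X} :=
    closure_minimal h hcl
  rw [this] at h2
  exact h2 (Set.mem_univ b)

/-- Such relations survive linear combinations and norm limits, so they need checking only on
generators. The scalar `c` covers commutation (c = 1) and anticommutation (c = -1) at once. -/
theorem oneForms_mul_eq {g : H₀ →L[ℂ] H₀} {c : ℂ}
    (h : ∀ b₁, ∀ b₂ ∈ T.smooth, T.rep b₁ * T.d b₂ * g = c • (g * (T.rep b₁ * T.d b₂)))
    {x : H₀ →L[ℂ] H₀} (hx : x ∈ T.oneForms) : x * g = c • (g * x) := by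
  let P : Submodule ℂ (H₀ →L[ℂ] H₀) :=
    { carrier := {x | x * g = c • (g * x)}
      zero_mem' := by simp
      add_mem' := fun {a b} (ha : _ = _) (hb : _ = _) => by
        change (a + b) * g = _
        rw [add_mul, ha, hb, mul_add, smul_add]
      smul_mem' := fun k a (ha : _ = _) => by
        change (k • a) * g = _
        rw [smul_mul_assoc, ha, mul_smul_comm, smul_comm] }
  have h1 : T.oneForms ≤ P := by
    refine Submodule.topologicalClosure_minimal _ (Submodule.span_le.mpr ?_)
      (isClosed_mul_eq_smul_mul g c)
    rintro _ ⟨b₁, b₂, hb₂, rfl⟩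
    exact h b₁ b₂ hb₂
  exact h1 hx

theorem oneForms_odd {x : H₀ →L[ℂ] H₀} (hx : x ∈ T.oneForms) :
    x * T.grading = -(T.grading * x) := by
  have := T.oneForms_mul_eq (g := T.grading) (c := -1) (fun b₁ b₂ hb => by
    have h := (T.isCommutator_d hb).anticomm T.dense_domain T.D_odd (T.rep_even b₂)
    rw [mul_assoc, h, mul_neg, ← mul_assoc, T.rep_even, mul_assoc, neg_smul, one_smul]) hx
  rwa [neg_smul, one_smul] at this

theorem oneForms_cliff {x : H₀ →L[ℂ] H₀} (hx : x ∈ T.oneForms) (i : Fin r) :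
    x * T.cliff i = -(T.cliff i * x) := by
  have := T.oneForms_mul_eq (g := T.cliff i) (c := -1) (fun b₁ b₂ hb => by
    have h := (T.isCommutator_d hb).anticomm T.dense_domain (T.D_cliff i) (T.rep_cliff b₂ i)
    rw [mul_assoc, h, mul_neg, ← mul_assoc, T.rep_cliff, mul_assoc, neg_smul, one_smul]) hx
  rwa [neg_smul, one_smul] at this

/-- `w` commutes with each [D₀, b] by comparing Leibniz rules, and with B by density. This is why
conjugation by constant gauge transformations leaves the cocycle part of a potential alone. -/
theorem oneForms_comm_of_isCommutator {w X : H₀ →L[ℂ] H₀} (hw : IsCommutator T.D w X)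
    (hb : ∀ b ∈ T.smooth, w * T.rep b = T.rep b * w)
    (hX : ∀ b ∈ T.smooth, X * T.rep b = T.rep b * X)
    {x : H₀ →L[ℂ] H₀} (hx : x ∈ T.oneForms) : x * w = w * x := by
  have := T.oneForms_mul_eq (g := w) (c := 1) (fun b₁ b₂ hb₂ => by
    have h := hw.mul_comm_of_commute T.dense_domain (T.isCommutator_d hb₂) (hb _ hb₂) (hX _ hb₂)
    have h2 := T.commute_of_smooth hb b₁
    change _ * T.d b₂ = T.d b₂ * _ at h
    rw [mul_assoc, ← h, ← mul_assoc, ← h2, mul_assoc, one_smul]) hx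
  rwa [one_smul] at this

theorem rep_mul_d_mem_oneForms (b₁ : B) {b₂ : B} (hb : b₂ ∈ T.smooth) :
    T.rep b₁ * T.d b₂ ∈ T.oneForms :=
  Submodule.le_topologicalClosure _ (Submodule.subset_span ⟨b₁, b₂, hb, rfl⟩)

theorem centralForms_odd {x : H₀ →L[ℂ] H₀} (hx : x ∈ T.centralForms) :
    x * T.grading = -(T.grading * x) := T.oneForms_odd hx.1

theorem centralForms_comm {x : H₀ →L[ℂ] H₀} (hx : x ∈ T.centralForms) (b : B) :
    x * T.rep b = T.rep b * x := T.commute_of_smooth hx.2.2 b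

end Base

section Action

variable {T : SpectralTriple r B H₀} (β : EquicontinuousAction m T)

theorem _root_.CrossGauge.EquicontinuousAction.act_zero (b : B) : β.act 0 b = b := by
  have := β.act_add 0 0 b
  rw [add_zero] at this
  exact ((β.act 0).injective this).symm

theorem _root_.CrossGauge.EquicontinuousAction.act_act_neg (k : Fin m → ℤ) (b : B) :
    β.act k (β.act (-k) b) = b := by
  rw [← β.act_add, add_neg_cancel, β.act_zero]

theorem _root_.CrossGauge.EquicontinuousAction.norm_act (k : Fin m → ℤ) (b : B) :
    ‖β.act k b‖ = ‖b‖ :=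
  StarAlgEquiv.norm_map (β.act k) b

theorem _root_.CrossGauge.EquicontinuousAction.norm_rep_act (k : Fin m → ℤ) (b : B) :
    ‖T.rep (β.act k b)‖ = ‖b‖ := by
  rw [T.norm_rep, β.norm_act]

theorem _root_.CrossGauge.EquicontinuousAction.exists_norm_d_le {b : B} (hb : b ∈ T.smooth) :
    ∃ C : ℝ, ∀ k, ‖T.d (β.act k b)‖ ≤ C := β.act_bdd b hb

/-- The generators of the graph of the action on one-forms. -/
def formGenerators (T : SpectralTriple r B H₀) (β : EquicontinuousAction m T) (k : Fin m → ℤ) :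
    Set ((H₀ →L[ℂ] H₀) × (H₀ →L[ℂ] H₀)) :=
  {p | ∃ b₁ : B, ∃ b₂ ∈ T.smooth,
    p = (T.rep b₁ * T.d b₂, T.rep (β.act k b₁) * T.d (β.act k b₂))}

theorem formGraph_induction {k : Fin m → ℤ}
    {P : Submodule ℂ ((H₀ →L[ℂ] H₀) × (H₀ →L[ℂ] H₀))}
    (hP : IsClosed (P : Set ((H₀ →L[ℂ] H₀) × (H₀ →L[ℂ] H₀))))
    (h : ∀ b₁, ∀ b₂ ∈ T.smooth,
      (T.rep b₁ * T.d b₂, T.rep (β.act k b₁) * T.d (β.act k b₂)) ∈ P) :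
    T.formGraph β k ≤ P := by
  refine Submodule.topologicalClosure_minimal _ (Submodule.span_le.mpr ?_) hP
  rintro _ ⟨b₁, b₂, hb₂, rfl⟩
  exact h b₁ b₂ hb₂

theorem mem_formGraph (k : Fin m → ℤ) (b₁ : B) {b₂ : B} (hb : b₂ ∈ T.smooth) :
    (T.rep b₁ * T.d b₂, T.rep (β.act k b₁) * T.d (β.act k b₂)) ∈ T.formGraph β k :=
  Submodule.le_topologicalClosure _ (Submodule.subset_span ⟨b₁, b₂, hb, rfl⟩)

theorem formGraph_fst_mem {k : Fin m → ℤ} {x y : H₀ →L[ℂ] H₀} (h : (x, y) ∈ T.formGraph β k) :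
    x ∈ T.oneForms := by
  have : T.formGraph β k ≤ T.oneForms.comap (LinearMap.fst ℂ _ _) :=
    formGraph_induction β ((Submodule.isClosed_topologicalClosure _).preimage continuous_fst)
      fun b₁ b₂ hb => T.rep_mul_d_mem_oneForms b₁ hb
  exact this h

theorem formGraph_zero_eq {x y : H₀ →L[ℂ] H₀} (h : (x, y) ∈ T.formGraph β 0) : x = y := by
  have : T.formGraph β 0 ≤ LinearMap.eqLocus (LinearMap.fst ℂ (H₀ →L[ℂ] H₀) (H₀ →L[ℂ] H₀))
      (LinearMap.snd ℂ _ _) :=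
    formGraph_induction β (isClosed_eq continuous_fst continuous_snd)
      fun b₁ b₂ hb => by
        rw [LinearMap.mem_eqLocus]
        simp [β.act_zero]
  exact this h

/-- Scalars are absorbed into the first factors, which gives the finite sums for which
`DescendsToForms` is stated. -/
theorem exists_sum_of_mem_span {k : Fin m → ℤ} {p : (H₀ →L[ℂ] H₀) × (H₀ →L[ℂ] H₀)}
    (h : p ∈ Submodule.span ℂ (formGenerators T β k)) :
    ∃ (N : ℕ) (b : Fin N → B) (b' : Fin N → T.smooth),
      p = (∑ i, T.rep (b i) * T.d (b' i : B),
        ∑ i, T.rep (β.act k (b i)) * T.d (β.act k (b' i : B))) := by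
  induction h using Submodule.span_induction with
  | mem x hx =>
    obtain ⟨b₁, b₂, hb, rfl⟩ := hx
    exact ⟨1, fun _ => b₁, fun _ => ⟨b₂, hb⟩, by simp⟩
  | zero => exact ⟨0, Fin.elim0, Fin.elim0, by simp; rfl⟩
  | add x y _ _ hx hy =>
    obtain ⟨N, b, b', rfl⟩ := hx
    obtain ⟨M, c, c', rfl⟩ := hy
    refine ⟨N + M, Fin.append b c, Fin.append b' c', ?_⟩
    simp [Fin.sum_univ_add]
  | smul a x _ hx =>
    obtain ⟨N, b, b', rfl⟩ := hx
    refine ⟨N, fun i => a • b i, b', ?_⟩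
    simp [Finset.smul_sum]

/-- The uniform bound is a closed condition on pairs, so it passes from finite sums to the closure.
In particular `formGraph` is single-valued, with a bound independent of `k`. -/
theorem exists_formGraph_norm_le (hker : T.DescendsToForms β) :
    ∃ C : ℝ, 0 ≤ C ∧ ∀ k, ∀ x y, (x, y) ∈ T.formGraph β k → ‖y‖ ≤ C * ‖x‖ := by
  obtain ⟨C, hC⟩ := hker
  -- The given constant need not be nonnegative if there are no nonzero forms.
  refine ⟨|C|, abs_nonneg _, fun k x y h => ?_⟩
  have hcl : IsClosed {p : (H₀ →L[ℂ] H₀) × (H₀ →L[ℂ] H₀) | ‖p.2‖ ≤ |C| * ‖p.1‖} :=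
    isClosed_le (by fun_prop) (by fun_prop)
  have : closure (Submodule.span ℂ (formGenerators T β k) : Set _) ⊆
      {p : (H₀ →L[ℂ] H₀) × (H₀ →L[ℂ] H₀) | ‖p.2‖ ≤ |C| * ‖p.1‖} := by
    refine closure_minimal ?_ hcl
    intro p hp
    obtain ⟨N, b, b', rfl⟩ := exists_sum_of_mem_span β hp
    exact (hC k N b b').trans (by gcongr; exact le_abs_self C)
  exact this h

end Action

/-! ### Weights and the growth of cocycles -/

/-- `(4 π² ‖k‖² + 1)^{1/2}`. -/
def growth (k : Fin m → ℤ) : ℝ := Real.sqrt (4 * Real.pi ^ 2 * ∑ i, (k i : ℝ) ^ 2 + 1)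

theorem weight_eq (k : Fin m → ℤ) : weight k = (growth k)⁻¹ := rfl

theorem growth_sq (k : Fin m → ℤ) :
    growth k ^ 2 = 4 * Real.pi ^ 2 * ∑ i, (k i : ℝ) ^ 2 + 1 := by
  unfold growth
  rw [Real.sq_sqrt]
  have : 0 ≤ ∑ i, (k i : ℝ) ^ 2 := Finset.sum_nonneg fun i _ => sq_nonneg _
  positivity

theorem one_le_growth (k : Fin m → ℤ) : 1 ≤ growth k := by
  unfold growth
  rw [Real.one_le_sqrt]
  have : 0 ≤ ∑ i, (k i : ℝ) ^ 2 := Finset.sum_nonneg fun i _ => sq_nonneg _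
  have : 0 ≤ 4 * Real.pi ^ 2 * ∑ i, (k i : ℝ) ^ 2 := by positivity
  linarith

theorem growth_pos (k : Fin m → ℤ) : 0 < growth k := zero_lt_one.trans_le (one_le_growth k)

theorem weight_pos (k : Fin m → ℤ) : 0 < weight k := inv_pos.mpr (growth_pos k)

theorem weight_le_one (k : Fin m → ℤ) : weight k ≤ 1 := inv_le_one_of_one_le₀ (one_le_growth k)

theorem growth_mul_weight (k : Fin m → ℤ) : growth k * weight k = 1 :=
  mul_inv_cancel₀ (growth_pos k).ne'

theorem weight_mul_growth (k : Fin m → ℤ) : weight k * growth k = 1 :=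
  inv_mul_cancel₀ (growth_pos k).ne'

theorem weight_zero : weight (0 : Fin m → ℤ) = 1 := by
  simp [weight]

theorem abs_le_growth (k : Fin m → ℤ) (i : Fin m) : |(k i : ℝ)| ≤ growth k := by
  rw [← abs_of_pos (growth_pos k), ← sq_le_sq, growth_sq]
  have h1 : (k i : ℝ) ^ 2 ≤ ∑ i, (k i : ℝ) ^ 2 :=
    Finset.single_le_sum (f := fun i => (k i : ℝ) ^ 2) (fun i _ => sq_nonneg _) (Finset.mem_univ i)
  have h2 : (1 : ℝ) ≤ 4 * Real.pi ^ 2 := by nlinarith [Real.pi_gt_three]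
  nlinarith [sq_nonneg (k i : ℝ)]

/-- From ‖k + l‖² ≤ 2‖k‖² + 2‖l‖²; the constant is not sharp. It makes translations bounded for the
graph norm of Dv. -/
theorem growth_add_le (k l : Fin m → ℤ) : growth (k + l) ≤ 2 * (growth k * growth l) := by
  rw [← abs_of_pos (growth_pos (k + l)),
    ← abs_of_pos (show 0 < 2 * (growth k * growth l) by
      have := growth_pos k; have := growth_pos l; positivity), ← sq_le_sq]
  rw [mul_pow, mul_pow, growth_sq, growth_sq, growth_sq]
  have h1 : ∑ i, ((k + l) i : ℝ) ^ 2 ≤ 2 * ∑ i, (k i : ℝ) ^ 2 + 2 * ∑ i, (l i : ℝ) ^ 2 := by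
    rw [Finset.mul_sum, Finset.mul_sum, ← Finset.sum_add_distrib]
    refine Finset.sum_le_sum fun i _ => ?_
    rw [Pi.add_apply]
    push_cast
    nlinarith [sq_nonneg ((k i : ℝ) - l i)]
  have hk : 0 ≤ ∑ i, (k i : ℝ) ^ 2 := Finset.sum_nonneg fun i _ => sq_nonneg _
  have hl : 0 ≤ ∑ i, (l i : ℝ) ^ 2 := Finset.sum_nonneg fun i _ => sq_nonneg _
  have hp : 0 ≤ 4 * Real.pi ^ 2 := by positivity
  have h2 := mul_le_mul_of_nonneg_left h1 hp
  have h3 := mul_nonneg hp hk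
  have h4 := mul_nonneg hp hl
  nlinarith [mul_nonneg h3 h4]

/-- A subadditive function on `ℤᵐ`, up to a constant, grows at most linearly. -/
theorem exists_le_growth {f : (Fin m → ℤ) → ℝ} {C : ℝ} (hC : 0 ≤ C) (hf : ∀ k, 0 ≤ f k)
    (h0 : f 0 = 0) (h : ∀ k l, f (k + l) ≤ f k + C * f l) :
    ∃ R : ℝ, ∀ k, f k ≤ R * growth k := by
  -- In each step `C` multiplies only the newly added `f v`, so no powers of `C` accumulate.
  have nat : ∀ (n : ℕ) (v : Fin m → ℤ), f (n • v) ≤ n * (C * f v) := by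
    intro n v
    induction n with
    | zero => simp [h0]
    | succ n ih =>
      rw [succ_nsmul]
      refine (h _ _).trans ?_
      push_cast
      linarith
  -- `f` need not be even, so `g i` bounds both directions along the i-th axis.
  set g : Fin m → ℝ := fun i => C * f (Pi.single i 1) + C * f (-Pi.single i 1) with hg
  have hgnn : ∀ i, 0 ≤ g i := fun i =>
    add_nonneg (mul_nonneg hC (hf _)) (mul_nonneg hC (hf _))
  have int : ∀ (n : ℤ) (i : Fin m), f (Pi.single i n) ≤ |(n : ℝ)| * g i := by
    intro n i
    obtain ⟨a, rfl | rfl⟩ := n.eq_nat_or_neg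
    · have e : (Pi.single i (a : ℤ) : Fin m → ℤ) = a • Pi.single i 1 := by
        rw [← Pi.single_smul]; simp
      rw [e]
      refine (nat _ _).trans ?_
      have : |(((a : ℕ) : ℤ) : ℝ)| = a := by simp
      rw [this]
      gcongr
      exact le_add_of_nonneg_right (mul_nonneg hC (hf _))
    · have e : (Pi.single i (-(a : ℤ)) : Fin m → ℤ) = a • (-Pi.single i 1) := by
        rw [smul_neg, ← Pi.single_smul, Pi.single_neg]; simp
      rw [e]
      refine (nat _ _).trans ?_
      have : |((-((a : ℕ) : ℤ) : ℤ) : ℝ)| = a := by simp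
      rw [this]
      gcongr
      exact le_add_of_nonneg_left (mul_nonneg hC (hf _))
  -- Coordinates are added one at a time, the new one always as the second argument of `h`, the one
  -- that carries the factor `C`.
  have fin : ∀ (k : Fin m → ℤ) (s : Finset (Fin m)),
      f (∑ i ∈ s, Pi.single i (k i)) ≤ ∑ i ∈ s, C * (growth k * g i) := by
    intro k s
    induction s using Finset.induction_on with
    | empty => simp [h0]
    | insert i s hi ih =>
      rw [Finset.sum_insert hi, Finset.sum_insert hi, add_comm]
      refine (h _ _).trans ?_
      rw [add_comm]
      refine add_le_add ?_ ih
      gcongr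
      exact (int _ _).trans (by gcongr; exacts [hgnn i, abs_le_growth k i])
  refine ⟨C * ∑ i, g i, fun k => ?_⟩
  have := fin k Finset.univ
  rw [Finset.univ_sum_single] at this
  refine this.trans (le_of_eq ?_)
  rw [Finset.mul_sum, Finset.sum_mul]
  exact Finset.sum_congr rfl fun i _ => by ring

section Cocycles

variable {T : SpectralTriple r B H₀} {β : EquicontinuousAction m T}

theorem formCocycles_zero {ω : (Fin m → ℤ) → (H₀ →L[ℂ] H₀)} (hω : ω ∈ T.formCocycles β) :
    ω 0 = 0 := by
  have := formGraph_zero_eq β (hω.2 0 0)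
  rwa [add_zero, sub_self] at this

/-- The cocycle identity and the uniform bound on β give ‖ω(k + l)‖ ≤ ‖ω(k)‖ + C‖ω(l)‖, hence linear
growth. This is the finiteness of the norm on Z¹. -/
theorem exists_norm_cocycle_le (hker : T.DescendsToForms β) {ω : (Fin m → ℤ) → (H₀ →L[ℂ] H₀)}
    (hω : ω ∈ T.formCocycles β) : ∃ R : ℝ, ∀ k, ‖ω k‖ ≤ R * growth k := by
  obtain ⟨C, hC, h⟩ := exists_formGraph_norm_le β hker
  refine exists_le_growth hC (fun k => norm_nonneg _) (by rw [formCocycles_zero hω, norm_zero])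
    fun k l => ?_
  have h1 := h _ _ _ (hω.2 k l)
  calc ‖ω (k + l)‖ = ‖ω k + (ω (k + l) - ω k)‖ := by rw [add_sub_cancel]
    _ ≤ _ := (norm_add_le _ _).trans (by gcongr)

theorem weight_mul_le_iff {k : Fin m → ℤ} {a R : ℝ} : weight k * a ≤ R ↔ a ≤ R * growth k := by
  rw [weight_eq, inv_mul_le_iff₀ (growth_pos k), mul_comm]

theorem bddAbove_cocycle (hker : T.DescendsToForms β) {ω : (Fin m → ℤ) → (H₀ →L[ℂ] H₀)}
    (hω : ω ∈ T.formCocycles β) : BddAbove (Set.range fun k => weight k * ‖ω k‖) := by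
  obtain ⟨R, hR⟩ := exists_norm_cocycle_le hker hω
  refine ⟨R, ?_⟩
  rintro _ ⟨k, rfl⟩
  exact weight_mul_le_iff.mpr (hR k)

end Cocycles

end SpectralTriple

end CrossGauge
end

/-! ### Logarithmic derivatives of central unitaries and of constant gauge transformations. -/

noncomputable section
namespace CrossGauge

/-! ### Logarithmic derivatives -/

theorem unitary_mul_star {R : Type*} [Monoid R] [StarMul R] (u : unitary R) :
    (u : R) * star (u : R) = 1 := Unitary.mul_star_self_of_mem u.2

namespace SpectralTriple

variable {m r : ℕ} {B H₀ : Type*} [CStarAlgebra B] [NormedAddCommGroup H₀]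
  [InnerProductSpace ℂ H₀] [CompleteSpace H₀]

section Central

variable (T : SpectralTriple r B H₀)

/-- The one-form `u [D₀, u*]`. -/
def logForm (u : B) : H₀ →L[ℂ] H₀ := T.rep u * T.d (star u)

/-- The bounded operator `w [D₀, w*]`. -/
def constForm (w : H₀ →L[ℂ] H₀) : H₀ →L[ℂ] H₀ := w * commutator T.D (star w)

variable {T}

theorem rep_mul_rep_star (u : unitary B) : T.rep u * T.rep (star u : B) = 1 := by
  rw [← map_mul, unitary_mul_star, map_one]

theorem rep_star_mul_rep (u : unitary B) : T.rep (star u : B) * T.rep u = 1 := by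
  rw [← map_mul, Unitary.coe_star_mul_self, map_one]

theorem centralUnitaries_comm {u : unitary B} (hu : u ∈ T.centralUnitaries) (b : B) :
    T.rep u * T.rep b = T.rep b * T.rep u :=
  T.commute_of_smooth (fun b hb => by rw [← map_mul, hu.2.1 b hb, map_mul]) b

/-- The Leibniz rule applied to u u* = 1. -/
theorem d_eq_neg_logForm_mul {u : unitary B} (hu : (u : B) ∈ T.smooth) :
    T.d u = -(T.logForm u * T.rep u) := by
  have h := T.d_mul hu (star_mem hu)
  rw [unitary_mul_star, T.d_one] at h
  have h2 : T.d u * T.rep (star (u : B)) = -(T.rep u * T.d (star (u : B))) :=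
    eq_neg_of_add_eq_zero_left h.symm
  have h3 := congrArg (fun x => x * T.rep (u : B)) h2
  simp only [mul_assoc, rep_star_mul_rep, mul_one] at h3
  rw [h3, logForm]
  simp [mul_assoc]

theorem logForm_self_adjoint {u : unitary B} (hu : (u : B) ∈ T.smooth) :
    star (T.logForm u) = T.logForm u := by
  calc star (T.logForm u) = -T.d u * T.rep (star (u : B)) := by
        rw [logForm, star_mul, ← map_star, T.d_star hu, star_neg, star_star]
    _ = T.logForm u := by
        rw [d_eq_neg_logForm_mul hu, neg_neg, mul_assoc, rep_mul_rep_star, mul_one]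

theorem logForm_mem_oneForms {u : unitary B} (hu : (u : B) ∈ T.smooth) :
    T.logForm u ∈ T.oneForms :=
  T.rep_mul_d_mem_oneForms _ (star_mem hu)

theorem logForm_mem_centralForms {u : unitary B} (hu : u ∈ T.centralUnitaries) :
    T.logForm u ∈ T.centralForms := by
  refine ⟨logForm_mem_oneForms hu.1, logForm_self_adjoint hu.1, fun b hb => ?_⟩
  have h1 : T.d (star u : B) * T.rep b = T.rep b * T.d (star u : B) :=
    (inv_mem hu).2.2 b hb
  rw [logForm, mul_assoc, h1, ← mul_assoc, centralUnitaries_comm hu, mul_assoc]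

/-- As [D₀, u] = -(u [D₀, u*]) u, the commutator condition can be read off from the one-form u [D₀,
u*]. This transfers invariance of the central forms to unitaries. -/
theorem mem_centralUnitaries_of_logForm {u : unitary B} (h : (u : B) ∈ T.smooth)
    (hb : ∀ b ∈ T.smooth, (u : B) * b = b * u) (hl : T.logForm u ∈ T.centralForms) :
    u ∈ T.centralUnitaries := by
  refine ⟨h, hb, fun b hb' => ?_⟩
  rw [d_eq_neg_logForm_mul h, neg_mul, mul_neg, mul_assoc, ← map_mul, hb b hb', map_mul,
    ← mul_assoc, hl.2.2 b hb', mul_assoc]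

/-- The Leibniz rule produces u (v [D₀, v*]) u*, and the conjugation disappears because central
forms commute with B. -/
theorem logForm_mul {u v : unitary B} (hu : u ∈ T.centralUnitaries)
    (hv : v ∈ T.centralUnitaries) :
    T.logForm ((u : B) * v) = T.logForm u + T.logForm v := by
  have h1 := T.centralForms_comm (logForm_mem_centralForms hv) (u : B)
  have h2 : T.logForm ((u : B) * v) =
      T.rep u * (T.rep v * T.d (star (v : B))) * T.rep (star (u : B)) +
        T.rep u * (T.rep v * T.rep (star (v : B))) * T.d (star (u : B)) := by
    rw [logForm, star_mul, T.d_mul (star_mem hv.1) (star_mem hu.1), map_mul]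
    simp only [mul_add, mul_assoc]
  rw [h2, rep_mul_rep_star, mul_one, ← logForm, ← logForm, ← h1, mul_assoc, rep_mul_rep_star,
    mul_one, add_comm]

theorem logForm_star {u : unitary B} (hu : u ∈ T.centralUnitaries) :
    T.logForm (star u : B) = -T.logForm u := by
  have h := logForm_mul hu (inv_mem hu)
  have e : ((u⁻¹ : unitary B) : B) = star (u : B) := rfl
  rw [e, unitary_mul_star] at h
  have h1 : T.logForm (1 : B) = 0 := by rw [logForm, star_one, T.d_one, mul_zero]
  rw [h1] at h
  exact eq_neg_of_add_eq_zero_right h.symm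

end Central

section Cocycle

variable {T : SpectralTriple r B H₀} {β : EquicontinuousAction m T}

/-- The action of `ℤᵐ` on unitaries. -/
def actUnitary (β : EquicontinuousAction m T) (k : Fin m → ℤ) (u : unitary B) : unitary B :=
  ⟨β.act k u, by
    rw [Unitary.mem_iff, ← map_star, ← map_mul, ← map_mul]
    simp⟩

/-- β_k carries u [D₀, u*] to the corresponding form of β_k(u), so invariance of Ω¹_sa ∩ 𝓑' gives
the commutator condition. Centrality is transported by writing b as β_k(β_{-k}(b)). -/
theorem actUnitary_mem (hinv : T.CentralFormsInvariant β) (k : Fin m → ℤ) {u : unitary B}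
    (hu : u ∈ T.centralUnitaries) : actUnitary β k u ∈ T.centralUnitaries := by
  have h1 : (T.logForm u, T.logForm (actUnitary β k u)) ∈ T.formGraph β k := by
    have := mem_formGraph β k (u : B) (star_mem hu.1)
    rwa [map_star] at this
  refine mem_centralUnitaries_of_logForm (β.act_smooth k _ hu.1) (fun b hb => ?_)
    (hinv k _ (logForm_mem_centralForms hu) _ h1)
  have h2 := hu.2.1 _ (β.act_smooth (-k) b hb)
  have h3 := congrArg (β.act k) h2
  rwa [map_mul, map_mul, β.act_act_neg] at h3

/-- Additivity of the logarithmic derivative on the product υ(k) β_k(υ(l)) is the additive cocycle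
identity. -/
theorem logDeriv_mem (hinv : T.CentralFormsInvariant β) {υ : (Fin m → ℤ) → unitary B}
    (hυ : υ ∈ T.unitaryCocycles β) : T.logDeriv υ ∈ T.formCocycles β := by
  refine ⟨fun k => logForm_mem_centralForms (hυ.1 k), fun k l => ?_⟩
  have h := mem_formGraph β k (υ l : B) (star_mem (hυ.1 l).1)
  have e : T.logDeriv υ (k + l) - T.logDeriv υ k =
      T.rep (β.act k (υ l : B)) * T.d (β.act k (star (υ l : B))) := by
    have h2 := logForm_mul (hυ.1 k) (actUnitary_mem hinv k (hυ.1 l))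
    change T.logForm (υ (k + l) : B) - T.logForm (υ k : B) = _
    rw [hυ.2]
    change T.logForm ((υ k : B) * (actUnitary β k (υ l) : B)) - _ = _
    rw [h2, add_sub_cancel_left, map_star]
    rfl
  rw [e]
  exact h

theorem unitaryCocycles_zero {υ : (Fin m → ℤ) → unitary B} (hυ : υ ∈ T.unitaryCocycles β) :
    υ 0 = 1 := by
  have h := hυ.2 0 0
  rw [add_zero, β.act_zero] at h
  have h2 : υ 0 * υ 0 = υ 0 := Subtype.ext h.symm
  exact mul_eq_left.mp h2

end Cocycle

/-! ### Constant gauge transformations -/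

section Constant

variable {T : SpectralTriple r B H₀} {w : unitary (H₀ →L[ℂ] H₀)}

theorem constantGauge_isCommutator (hw : w ∈ T.constantGauge) :
    IsCommutator T.D (w : H₀ →L[ℂ] H₀) (commutator T.D w) := by
  obtain ⟨X, hX, -⟩ := hw.2.2.2
  exact isCommutator_commutator ⟨X, hX⟩

theorem constantGauge_commutator_comm (hw : w ∈ T.constantGauge) (b : B) :
    commutator T.D (w : H₀ →L[ℂ] H₀) * T.rep b = T.rep b * commutator T.D (w : H₀ →L[ℂ] H₀) := by
  obtain ⟨X, hX, hX'⟩ := hw.2.2.2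
  rw [hX.commutator_eq T.dense_domain]
  exact T.commute_of_smooth hX' b

theorem constantGauge_comm (hw : w ∈ T.constantGauge) (b : B) :
    (w : H₀ →L[ℂ] H₀) * T.rep b = T.rep b * w := T.commute_of_smooth hw.2.1 b

theorem constantGauge_comm_oneForms (hw : w ∈ T.constantGauge) {x : H₀ →L[ℂ] H₀}
    (hx : x ∈ T.oneForms) : x * w = w * x :=
  T.oneForms_comm_of_isCommutator (constantGauge_isCommutator hw) hw.2.1
    (fun b _ => constantGauge_commutator_comm hw b) hx

theorem star_mem_constantGauge (hw : w ∈ T.constantGauge) : star w ∈ T.constantGauge :=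
  inv_mem hw

theorem commutator_constantGauge_star (hw : w ∈ T.constantGauge) :
    commutator T.D (star (w : H₀ →L[ℂ] H₀)) = -star (commutator T.D (w : H₀ →L[ℂ] H₀)) :=
  ((constantGauge_isCommutator hw).adj T.D_selfAdjoint).commutator_eq T.dense_domain

theorem commutator_eq_neg_constForm_mul (hw : w ∈ T.constantGauge) :
    commutator T.D (w : H₀ →L[ℂ] H₀) = -(T.constForm w * w) := by
  have h1 := (constantGauge_isCommutator hw).mul
    (constantGauge_isCommutator (star_mem_constantGauge hw))
  rw [Unitary.coe_star, unitary_mul_star] at h1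
  have h2 := h1.unique T.dense_domain (isCommutator_one T.D)
  have h3 := congrArg (fun x => x * (w : H₀ →L[ℂ] H₀)) (eq_neg_of_add_eq_zero_left h2)
  simp only [mul_assoc, Unitary.coe_star_mul_self, mul_one] at h3
  rw [h3, constForm]
  simp [mul_assoc]

theorem constForm_mem (hw : w ∈ T.constantGauge) : T.constForm w ∈ T.oddCommutant := by
  have hs := star_mem_constantGauge hw
  refine ⟨?_, ?_, fun b => ?_, fun i => ?_⟩
  · calc star (T.constForm w)
          = -commutator T.D (w : H₀ →L[ℂ] H₀) * star (w : H₀ →L[ℂ] H₀) := by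
          rw [constForm, star_mul, commutator_constantGauge_star hw, star_neg, star_star]
      _ = T.constForm w := by
          rw [commutator_eq_neg_constForm_mul hw, neg_neg, mul_assoc, unitary_mul_star, mul_one]
  · have h := (constantGauge_isCommutator hs).anticomm T.dense_domain T.D_odd hs.1
    rw [Unitary.coe_star] at h
    rw [constForm, mul_assoc, h, mul_neg, ← mul_assoc, hw.1, mul_assoc]
  · have h := constantGauge_commutator_comm hs b
    rw [Unitary.coe_star] at h
    rw [constForm, mul_assoc, h, ← mul_assoc, constantGauge_comm hw, mul_assoc]
  · have h := (constantGauge_isCommutator hs).anticomm T.dense_domain (T.D_cliff i) (hs.2.2.1 i)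
    rw [Unitary.coe_star] at h
    rw [constForm, mul_assoc, h, mul_neg, ← mul_assoc, hw.2.2.1, mul_assoc]

/-- Unlike `logForm`, this is only a cocycle for conjugation: `w` need not commute with w' [D₀,
w'*]. -/
theorem constForm_mul {w' : unitary (H₀ →L[ℂ] H₀)} (hw : w ∈ T.constantGauge)
    (hw' : w' ∈ T.constantGauge) :
    T.constForm ((w : H₀ →L[ℂ] H₀) * w') =
      T.constForm w + (w : H₀ →L[ℂ] H₀) * T.constForm w' * star (w : H₀ →L[ℂ] H₀) := by
  have h := (constantGauge_isCommutator (star_mem_constantGauge hw')).mul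
    (constantGauge_isCommutator (star_mem_constantGauge hw))
  have h2 := h.commutator_eq T.dense_domain
  rw [Unitary.coe_star, Unitary.coe_star] at h2
  rw [constForm, star_mul, h2, mul_add, add_comm, constForm, constForm]
  congr 1
  · rw [mul_assoc, ← mul_assoc (w' : H₀ →L[ℂ] H₀), unitary_mul_star, one_mul]

theorem constForm_star (hw : w ∈ T.constantGauge) :
    T.constForm (star (w : H₀ →L[ℂ] H₀)) =
      -(star (w : H₀ →L[ℂ] H₀) * T.constForm w * w) := by
  rw [constForm, star_star, commutator_eq_neg_constForm_mul hw]
  simp [mul_assoc]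

theorem conj_mem_oddCommutant (hw : w ∈ T.constantGauge) {M : H₀ →L[ℂ] H₀}
    (hM : M ∈ T.oddCommutant) :
    (w : H₀ →L[ℂ] H₀) * M * star (w : H₀ →L[ℂ] H₀) ∈ T.oddCommutant := by
  have hs := star_mem_constantGauge hw
  refine ⟨?_, ?_, fun b => ?_, fun i => ?_⟩
  · simp only [star_mul, star_star, hM.1, mul_assoc]
  · have h := hs.1
    rw [Unitary.coe_star] at h
    rw [mul_assoc, h, ← mul_assoc, mul_assoc _ M, hM.2.1, mul_neg, ← mul_assoc, hw.1]
    simp [mul_assoc]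
  · have h := constantGauge_comm hs b
    rw [Unitary.coe_star] at h
    rw [mul_assoc, h, ← mul_assoc, mul_assoc _ M, hM.2.2.1, ← mul_assoc, constantGauge_comm hw]
    simp only [mul_assoc]
  · have h := hs.2.2.1 i
    rw [Unitary.coe_star] at h
    rw [mul_assoc, h, ← mul_assoc, mul_assoc _ M, hM.2.2.2, mul_neg, ← mul_assoc, hw.2.2.1]
    simp [mul_assoc]

/-! The operators `w υ` on `H₀`. -/

variable {u : unitary B}

theorem gauge_mul_star (w : unitary (H₀ →L[ℂ] H₀)) (u : unitary B) :
    ((w : H₀ →L[ℂ] H₀) * T.rep u) * star ((w : H₀ →L[ℂ] H₀) * T.rep u) = 1 := by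
  rw [star_mul, ← map_star, mul_assoc, ← mul_assoc (T.rep (u : B)), rep_mul_rep_star, one_mul,
    unitary_mul_star]

theorem gauge_star_mul (w : unitary (H₀ →L[ℂ] H₀)) (u : unitary B) :
    star ((w : H₀ →L[ℂ] H₀) * T.rep u) * ((w : H₀ →L[ℂ] H₀) * T.rep u) = 1 := by
  rw [star_mul, ← map_star, mul_assoc, ← mul_assoc (star (w : H₀ →L[ℂ] H₀)),
    Unitary.coe_star_mul_self, one_mul, rep_star_mul_rep]

theorem gauge_even (hw : w ∈ T.constantGauge) (b : B) :
    (w : H₀ →L[ℂ] H₀) * T.rep b * T.grading = T.grading * ((w : H₀ →L[ℂ] H₀) * T.rep b) := by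
  rw [mul_assoc, T.rep_even, ← mul_assoc, hw.1, mul_assoc]

theorem gauge_cliff (hw : w ∈ T.constantGauge) (b : B) (i : Fin r) :
    (w : H₀ →L[ℂ] H₀) * T.rep b * T.cliff i = T.cliff i * ((w : H₀ →L[ℂ] H₀) * T.rep b) := by
  rw [mul_assoc, T.rep_cliff, ← mul_assoc, hw.2.2.1, mul_assoc]

theorem gauge_comm (hw : w ∈ T.constantGauge) (hu : u ∈ T.centralUnitaries) (b : B) :
    (w : H₀ →L[ℂ] H₀) * T.rep u * T.rep b = T.rep b * ((w : H₀ →L[ℂ] H₀) * T.rep u) := by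
  rw [mul_assoc, centralUnitaries_comm hu, ← mul_assoc, constantGauge_comm hw, mul_assoc]

/-- The Leibniz rule for u* w*, where w* moves past u [D₀, u*] because it commutes with one-forms.
Thus (wu) [D₀, (wu)*] splits as the sum of the two logarithmic derivatives. -/
theorem isCommutator_gauge_star (hw : w ∈ T.constantGauge) (hu : u ∈ T.centralUnitaries) :
    IsCommutator T.D (star ((w : H₀ →L[ℂ] H₀) * T.rep u))
      (star ((w : H₀ →L[ℂ] H₀) * T.rep u) * (T.logForm u + T.constForm w)) := by
  have h1 := (T.isCommutator_d (star_mem hu.1)).mul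
    (constantGauge_isCommutator (star_mem_constantGauge hw))
  rw [Unitary.coe_star, map_star, ← star_mul] at h1
  convert h1 using 1
  rw [mul_add, constForm, star_mul, ← map_star]
  congr 1
  · have hl := constantGauge_comm_oneForms (star_mem_constantGauge hw)
      (logForm_mem_oneForms hu.1)
    rw [Unitary.coe_star] at hl
    rw [mul_assoc, ← hl, logForm, ← mul_assoc, ← mul_assoc, rep_star_mul_rep, one_mul]
  · rw [mul_assoc, ← mul_assoc (star (w : H₀ →L[ℂ] H₀)), Unitary.coe_star_mul_self, one_mul]

theorem isCommutator_gauge (hw : w ∈ T.constantGauge) (hu : u ∈ T.centralUnitaries) :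
    IsCommutator T.D ((w : H₀ →L[ℂ] H₀) * T.rep u)
      (-((T.logForm u + T.constForm w) * ((w : H₀ →L[ℂ] H₀) * T.rep u))) := by
  have h := (isCommutator_gauge_star hw hu).adj T.D_selfAdjoint
  rw [star_star, star_mul (star ((w : H₀ →L[ℂ] H₀) * T.rep u)), star_star, star_add, logForm_self_adjoint hu.1, (constForm_mem hw).1] at h
  exact h

end Constant

/-! ### The operators `id ⊗̂ S` -/

section IdTens

variable {ι : Type*} [Fintype ι] [DecidableEq ι] (T : SpectralTriple r B H₀)
  (V : SpinModule m ι)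

theorem idTens_of_odd {S : H₀ →L[ℂ] H₀} (h : S * T.grading = -(T.grading * S)) :
    T.idTens V S = tens V.grading S := by
  have h1 : T.grading * S * T.grading = -S := by
    rw [mul_assoc, h, mul_neg, ← mul_assoc, T.grading_sq, one_mul]
  rw [idTens, h1, add_neg_cancel, smul_zero, tens_zero, zero_add, sub_neg_eq_add, ← two_smul ℂ,
    smul_smul, inv_mul_cancel₀ two_ne_zero, one_smul]

theorem idTens_of_even {S : H₀ →L[ℂ] H₀} (h : S * T.grading = T.grading * S) :
    T.idTens V S = tens 1 S := by
  have h1 : T.grading * S * T.grading = S := by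
    rw [mul_assoc, h, ← mul_assoc, T.grading_sq, one_mul]
  rw [idTens, h1, sub_self, smul_zero, tens_zero, add_zero, ← two_smul ℂ,
    smul_smul, inv_mul_cancel₀ two_ne_zero, one_smul]

end IdTens

end SpectralTriple

end CrossGauge
end

/-! ### The fibrewise Dirac operators and the graph norm of Dv. -/

noncomputable section
namespace CrossGauge

theorem closure_eq_of_isClosed {E F : Type*} [NormedAddCommGroup E] [NormedSpace ℂ E]
    [NormedAddCommGroup F] [NormedSpace ℂ F] {f : E →ₗ.[ℂ] F} (hf : f.IsClosed) :
    f.closure = f := by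
  refine LinearPMap.eq_of_eq_graph ?_
  rw [← hf.isClosable.graph_closure_eq_closure_graph]
  exact IsClosed.submodule_topologicalClosure_eq hf

theorem hasSum_norm_sq {K W : Type*} [NormedAddCommGroup W] (ξ : lp (fun _ : K => W) 2) :
    HasSum (fun k => ‖(ξ : ∀ _ : K, W) k‖ ^ 2) (‖ξ‖ ^ 2) := by
  have := lp.hasSum_norm (by norm_num) ξ
  simpa using this

namespace SpinModule

variable {m : ℕ} {ι : Type*} [Fintype ι] [DecidableEq ι] (V : SpinModule m ι)

theorem star_symbol (k : Fin m → ℤ) : star (SpectralTriple.symbol V k) = SpectralTriple.symbol V k := by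
  have h : ∀ i : Fin m, star ((k i : ℂ) • V.f i) = -((k i : ℂ) • V.f i) := fun i => by
    rw [star_smul, V.f_star, smul_neg]
    simp
  rw [SpectralTriple.symbol, star_smul, star_sum]
  rw [Finset.sum_congr rfl fun i _ => h i, Finset.sum_neg_distrib, smul_neg, ← neg_smul]
  congr 1
  simp

theorem symbol_sq (k : Fin m → ℤ) :
    SpectralTriple.symbol V k * SpectralTriple.symbol V k = ((4 * Real.pi ^ 2 * ∑ i, (k i : ℝ) ^ 2 : ℝ) : ℂ) • 1 := by
  set A := ∑ i, (k i : ℂ) • V.f i with hA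
  have h1 : A * A = ∑ i, ∑ j, ((k i : ℂ) * k j) • (V.f i * V.f j) := by
    rw [hA, Finset.sum_mul]
    simp only [Finset.mul_sum, smul_mul_smul_comm]
  have h2 : A * A = ∑ i, ∑ j, ((k i : ℂ) * k j) • (V.f j * V.f i) := by
    rw [h1, Finset.sum_comm]
    exact Finset.sum_congr rfl fun i _ => Finset.sum_congr rfl fun j _ => by
      rw [mul_comm (k j : ℂ)]
  -- Adding the double sum in its two orders brings in the anticommutators, of which only the
  -- diagonal ones survive.
  have h3 : (2 : ℂ) • (A * A) = (2 : ℂ) • ((-∑ i, (k i : ℂ) ^ 2) • (1 : Matrix ι ι ℂ)) := by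
    rw [two_smul]
    conv_lhs => lhs; rw [h1]
    conv_lhs => rhs; rw [h2]
    simp only [← Finset.sum_add_distrib, ← smul_add, V.f_rel]
    simp only [smul_ite, smul_zero, Finset.sum_ite_eq, Finset.mem_univ, if_true]
    rw [← Finset.sum_neg_distrib, Finset.sum_smul, Finset.smul_sum]
    refine Finset.sum_congr rfl fun i _ => ?_
    rw [smul_smul, show (-2 : Matrix ι ι ℂ) = (-2 : ℂ) • 1 by
      rw [neg_smul, ofNat_smul_eq_nsmul, nsmul_eq_mul, mul_one]; rfl, smul_smul]
    congr 1
    ring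
  have h4 := smul_right_injective _ (two_ne_zero (α := ℂ)) h3
  rw [SpectralTriple.symbol, smul_mul_smul_comm, ← hA]
  replace h4 : A * A = _ := h4
  rw [h4, smul_smul]
  congr 1
  push_cast
  have := Complex.I_sq
  linear_combination (-4 * (Real.pi : ℂ) ^ 2 * ∑ i, (k i : ℂ) ^ 2) * this

theorem symbol_grading (k : Fin m → ℤ) :
    SpectralTriple.symbol V k * V.grading = -(V.grading * SpectralTriple.symbol V k) := by
  rw [SpectralTriple.symbol, smul_mul_assoc, mul_smul_comm, ← smul_neg, Finset.sum_mul, Finset.mul_sum,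
    ← Finset.sum_neg_distrib]
  congr 1
  refine Finset.sum_congr rfl fun i _ => ?_
  rw [smul_mul_assoc, mul_smul_comm, V.f_odd, smul_neg]

end SpinModule

namespace SpectralTriple

variable {m r : ℕ} {ι B H₀ : Type*} [Fintype ι] [DecidableEq ι] [CStarAlgebra B]
  [NormedAddCommGroup H₀] [InnerProductSpace ℂ H₀] [CompleteSpace H₀]
  (T : SpectralTriple r B H₀) (V : SpinModule m ι)

/-! ### The fibrewise Dirac operators -/

/-- The operator `s(k) ⊗ 1` on `V ⊗ H₀`. -/
def fibSymbol (V : SpinModule m ι) (H₀ : Type*) [NormedAddCommGroup H₀] [InnerProductSpace ℂ H₀]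
    (k : Fin m → ℤ) : Fib ι H₀ →L[ℂ] Fib ι H₀ := tens (symbol V k) 1

theorem norm_sq_fibSymbol (k : Fin m → ℤ) (w : Fib ι H₀) :
    ‖fibSymbol V H₀ k w‖ ^ 2 = (growth k ^ 2 - 1) * ‖w‖ ^ 2 := by
  rw [fibSymbol, growth_sq, add_sub_cancel_right]
  exact norm_sq_tens (by rw [V.star_symbol, V.symbol_sq]) w

theorem norm_sq_add_norm_sq_fibSymbol (k : Fin m → ℤ) (w : Fib ι H₀) :
    ‖w‖ ^ 2 + ‖fibSymbol V H₀ k w‖ ^ 2 = (growth k * ‖w‖) ^ 2 := by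
  rw [norm_sq_fibSymbol]
  ring

theorem norm_fibSymbol_le (k : Fin m → ℤ) (w : Fib ι H₀) :
    ‖fibSymbol V H₀ k w‖ ≤ growth k * ‖w‖ := by
  have := growth_pos k
  rw [← sq_le_sq₀ (norm_nonneg _) (by positivity), ← norm_sq_add_norm_sq_fibSymbol V]
  exact le_add_of_nonneg_left (sq_nonneg _)

/-- `γ ⊗ 1`. -/
abbrev fibGrading (V : SpinModule m ι) (H₀ : Type*) [NormedAddCommGroup H₀]
    [InnerProductSpace ℂ H₀] : Fib ι H₀ →L[ℂ] Fib ι H₀ := tens V.grading 1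

theorem fibGrading_fibGrading (w : Fib ι H₀) : fibGrading V H₀ (fibGrading V H₀ w) = w := by
  have := congrArg (fun Z => Z w) (V.tens_grading_sq (H₀ := H₀))
  exact this

/-- As γ² = 1, applying γ ⊗ 1 to v = (γ ⊗ D₀) w decouples the coordinates. Closedness, symmetry and
commutation rules are then inherited from D₀. -/
theorem mem_graph_idTensD {w v : Fib ι H₀} :
    (w, v) ∈ (T.idTensD V).graph ↔ ∀ i, (w i, fibGrading V H₀ v i) ∈ T.D.graph := by
  have key : ∀ x : (T.idTensD V).domain, T.idTensD V x =
      fibGrading V H₀ (WithLp.toLp 2 fun i => T.D ⟨(x : Fib ι H₀) i, x.2 i⟩) := by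
    intro x
    ext i
    rw [tens_apply]
    rfl
  constructor
  · intro h i
    rw [LinearPMap.mem_graph_iff] at h
    obtain ⟨x, rfl, rfl⟩ := h
    rw [key, fibGrading_fibGrading]
    exact T.D.mem_graph ⟨(x : Fib ι H₀) i, x.2 i⟩
  · intro h
    have hw : ∀ i, w i ∈ T.D.domain := fun i => LinearPMap.mem_domain_of_mem_graph (h i)
    rw [LinearPMap.mem_graph_iff]
    refine ⟨⟨w, hw⟩, rfl, ?_⟩
    rw [key]
    have : (WithLp.toLp 2 fun i => T.D ⟨w i, hw i⟩ : Fib ι H₀) = fibGrading V H₀ v := by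
      ext i
      exact LinearPMap.mem_graph_snd_inj T.D (T.D.mem_graph ⟨w i, hw i⟩) (h i) rfl
    change fibGrading V H₀ (WithLp.toLp 2 fun i => T.D ⟨w i, hw i⟩) = v
    rw [this, fibGrading_fibGrading]

theorem isClosed_graph_idTensD :
    IsClosed ((T.idTensD V).graph : Set (Fib ι H₀ × Fib ι H₀)) := by
  have hD : IsClosed (T.D.graph : Set (H₀ × H₀)) := T.D_selfAdjoint.isClosed
  have : ((T.idTensD V).graph : Set (Fib ι H₀ × Fib ι H₀)) =
      ⋂ i, {p : Fib ι H₀ × Fib ι H₀ | (p.1 i, fibGrading V H₀ p.2 i) ∈ T.D.graph} := by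
    ext ⟨w, v⟩
    simp only [SetLike.mem_coe, T.mem_graph_idTensD V, Set.mem_iInter, Set.mem_ofPred_eq]
  rw [this]
  refine isClosed_iInter fun i => hD.preimage ?_
  have h1 : Continuous fun w : Fib ι H₀ => w i := (PiLp.proj (𝕜 := ℂ) 2 (fun _ : ι => H₀) i).continuous
  exact (h1.comp continuous_fst).prodMk (h1.comp ((fibGrading V H₀).continuous.comp continuous_snd))

/-- The common source of the rules for moving x ⊗ S through γ ⊗ D₀: c = 1 serves operators with
bounded commutator, c = -1 those that anticommute with D₀, and the sign due to x sits in γxγ. -/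
theorem tens_mem_graph_idTensD {x : Matrix ι ι ℂ} {S X : H₀ →L[ℂ] H₀} {c : ℂ}
    (hS : ∀ h h', (h, h') ∈ T.D.graph → (S h, c • S h' + X h) ∈ T.D.graph)
    {w v : Fib ι H₀} (h : (w, v) ∈ (T.idTensD V).graph) :
    (tens x S w, c • tens (V.grading * x * V.grading) S v + tens (V.grading * x) X w) ∈
      (T.idTensD V).graph := by
  rw [mem_graph_idTensD] at h ⊢
  intro i
  have e : fibGrading V H₀ (c • tens (V.grading * x * V.grading) S v + tens (V.grading * x) X w) =
      c • tens x S (fibGrading V H₀ v) + tens x X w := by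
    rw [map_add, map_smul, ← mul_apply_eq_comp, ← mul_apply_eq_comp, ← mul_apply_eq_comp, tens_mul,
      tens_mul, tens_mul]
    simp only [← mul_assoc, V.grading_sq, one_mul, mul_one]
  rw [e]
  have h2 : (tens x S w i, (c • tens x S (fibGrading V H₀ v) + tens x X w : Fib ι H₀) i) =
      ∑ j, x i j • (S (w j), c • S (fibGrading V H₀ v j) + X (w j)) := by
    rw [Prod.ext_iff]
    simp only [Prod.fst_sum, Prod.snd_sum, Prod.smul_fst, Prod.smul_snd]
    refine ⟨tens_apply _ _ _ _, ?_⟩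
    rw [PiLp.add_apply, PiLp.smul_apply, tens_apply, tens_apply, Finset.smul_sum,
      ← Finset.sum_add_distrib]
    exact Finset.sum_congr rfl fun j _ => by rw [smul_add, smul_comm]
  rw [h2]
  exact Submodule.sum_mem _ fun j _ => Submodule.smul_mem _ _ (hS _ _ (h j))

theorem tens_one_mem_graph_idTensD {S X : H₀ →L[ℂ] H₀} (hS : IsCommutator T.D S X)
    {w v : Fib ι H₀} (h : (w, v) ∈ (T.idTensD V).graph) :
    (tens 1 S w, tens 1 S v + tens V.grading X w) ∈ (T.idTensD V).graph := by
  have := T.tens_mem_graph_idTensD V (x := 1) (S := S) (X := X) (c := 1)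
    (fun a b hab => by rw [one_smul]; exact hS.mem_graph hab) h
  rwa [one_smul, mul_one, V.grading_sq] at this

theorem tens_anticomm_mem_graph_idTensD {x : Matrix ι ι ℂ} (hx : x * V.grading = -(V.grading * x))
    {w v : Fib ι H₀} (h : (w, v) ∈ (T.idTensD V).graph) :
    (tens x 1 w, -tens x 1 v) ∈ (T.idTensD V).graph := by
  have := T.tens_mem_graph_idTensD V (x := x) (S := 1) (X := 0) (c := 1)
    (fun a b hab => by simpa using hab) h
  rw [mul_assoc, hx, mul_neg, ← mul_assoc, V.grading_sq, one_mul, one_smul, tens_zero,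
    tens_neg_left] at this
  simpa using this

theorem tens_grading_mem_graph_idTensD {S : H₀ →L[ℂ] H₀} (hS : AnticommutesWith T.D S)
    {w v : Fib ι H₀} (h : (w, v) ∈ (T.idTensD V).graph) :
    (tens V.grading S w, -tens V.grading S v) ∈ (T.idTensD V).graph := by
  have := T.tens_mem_graph_idTensD V (x := V.grading) (S := S) (X := 0) (c := -1)
    (fun a b hab => by simpa using hS.mem_graph hab) h
  rw [V.grading_sq, one_mul, tens_zero] at this
  simpa using this

theorem inner_idTensD_symm {w v w' v' : Fib ι H₀} (h : (w, v) ∈ (T.idTensD V).graph)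
    (h' : (w', v') ∈ (T.idTensD V).graph) : inner ℂ w v' = inner ℂ v w' := by
  have hform : T.D.IsFormalAdjoint T.D := by
    have h1 := LinearPMap.adjoint_isFormalAdjoint T.dense_domain
    have hs : T.D.adjoint = T.D := T.D_selfAdjoint
    rwa [hs] at h1
  have hsymm : ∀ a b a' b' : H₀, (a, b) ∈ T.D.graph → (a', b') ∈ T.D.graph →
      (inner ℂ a b' : ℂ) = inner ℂ b a' := by
    intro a b a' b' hab hab'
    rw [LinearPMap.mem_graph_iff] at hab hab'
    obtain ⟨x, rfl, rfl⟩ := hab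
    obtain ⟨x', rfl, rfl⟩ := hab'
    exact (hform x x').symm
  have hg := T.tens_mem_graph_idTensD V (x := V.grading) (S := 1) (X := 0) (c := 1)
    (fun a b hab => by simpa using hab) h
  rw [V.grading_sq, one_mul, tens_zero] at hg
  simp only [one_smul, zero_apply, add_zero] at hg
  rw [mem_graph_idTensD] at hg h'
  rw [← fibGrading_fibGrading V v', ← inner_tens, star_one, V.grading_star,
    ← fibGrading_fibGrading V v, PiLp.inner_apply, PiLp.inner_apply]
  refine Finset.sum_congr rfl fun i _ => ?_
  have := hsymm _ _ _ _ (hg i) (h' i)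
  rw [this, fibGrading_fibGrading]

/-- s(k) ⊗ 1 and γ ⊗ D₀ are symmetric and anticommute, so the cross term has real part zero. This
identity lets D control its vertical and horizontal parts separately. -/
theorem norm_sq_symbol_add {k : Fin m → ℤ} {w v : Fib ι H₀}
    (h : (w, v) ∈ (T.idTensD V).graph) :
    ‖fibSymbol V H₀ k w + v‖ ^ 2 = ‖fibSymbol V H₀ k w‖ ^ 2 + ‖v‖ ^ 2 := by
  have h1 := T.tens_anticomm_mem_graph_idTensD V (V.symbol_grading k) h
  have h2 := T.inner_idTensD_symm V h1 h
  have h3 : inner ℂ v (fibSymbol V H₀ k w) = inner ℂ (fibSymbol V H₀ k v) w := by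
    rw [fibSymbol, ← inner_tens, star_one, V.star_symbol]
  change inner ℂ (fibSymbol V H₀ k w) v = inner ℂ (-fibSymbol V H₀ k v) w at h2
  rw [inner_neg_left, ← h3, ← inner_conj_symm v] at h2
  have h4 := congrArg Complex.re h2
  rw [Complex.neg_re, Complex.conj_re] at h4
  have h5 : (inner ℂ (fibSymbol V H₀ k w) v : ℂ).re = 0 := by linarith
  rw [@norm_add_sq ℂ]
  change _ + 2 * (inner ℂ (fibSymbol V H₀ k w) v : ℂ).re + _ = _
  rw [h5]
  ring

theorem dense_domain_idTensD : Dense {w : Fib ι H₀ | ∃ v, (w, v) ∈ (T.idTensD V).graph} := by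
  have h1 : Dense (Set.pi Set.univ fun _ : ι => (T.D.domain : Set H₀)) :=
    dense_pi _ fun i _ => T.dense_domain
  have h2 := h1.preimage
    (PiLp.continuousLinearEquiv 2 ℂ (fun _ : ι => H₀)).toHomeomorph.isOpenMap
  refine h2.mono fun w hw => ?_
  have hw' : w ∈ (T.idTensD V).domain := fun i => hw i trivial
  exact LinearPMap.mem_domain_iff.mp hw'

/-! ### The vertical Dirac operator -/

theorem mem_graph_verticalDirac {ξ η : TotalSpace m ι H₀} :
    (ξ, η) ∈ (T.verticalDirac V).graph ↔ ∀ k, η k = fibSymbol V H₀ k (ξ k) := by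
  rw [verticalDirac, mem_graph_opSum]
  refine forall_congr' fun k => ?_
  rw [LinearPMap.mem_graph_iff]
  constructor
  · rintro ⟨y, h1, h2⟩
    simp only at h1 h2
    refine h2.symm.trans ?_
    exact congrArg (fibSymbol V H₀ k) h1
  · intro h
    exact ⟨⟨ξ k, trivial⟩, rfl, h.symm⟩

theorem verticalDirac_apply (ξ : (T.verticalDirac V).domain) (k : Fin m → ℤ) :
    (T.verticalDirac V ξ : ∀ _, Fib ι H₀) k = fibSymbol V H₀ k (ξ.1 k) :=
  (T.mem_graph_verticalDirac V).mp ((T.verticalDirac V).mem_graph ξ) k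

/-- In the fibre over k the squared graph norm is ‖w‖² + ‖s(k)w‖² = (`growth k` · ‖w‖)², so the
domain is a weighted ℓ² space. -/
theorem mem_domain_verticalDirac {ξ : TotalSpace m ι H₀} :
    ξ ∈ (T.verticalDirac V).domain ↔
      ∃ ζ : TotalSpace m ι H₀, ∀ k, ζ k = (growth k : ℂ) • ξ k := by
  rw [LinearPMap.mem_domain_iff]
  constructor
  · rintro ⟨η, h⟩
    rw [mem_graph_verticalDirac] at h
    have h1 : Memℓp (fun k => (growth k : ℂ) • ξ k) 2 := by
      refine Memℓp.mono ((lp.memℓp ξ).norm.add (lp.memℓp η).norm) fun k => ?_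
      have hg := growth_pos k
      rw [norm_smul, Complex.norm_real, Real.norm_of_nonneg hg.le]
      change _ ≤ ‖ξ k‖ + ‖η k‖
      rw [← sq_le_sq₀ (by positivity) (by positivity), ← norm_sq_add_norm_sq_fibSymbol V, h]
      nlinarith [norm_nonneg (ξ k), norm_nonneg (fibSymbol V H₀ k (ξ k)),
        mul_nonneg (norm_nonneg (ξ k)) (norm_nonneg (fibSymbol V H₀ k (ξ k)))]
    exact ⟨⟨_, h1⟩, fun k => rfl⟩
  · rintro ⟨ζ, h⟩
    obtain ⟨η, hη, -⟩ := exists_lp_of_norm_le zero_le_one (Equiv.refl _)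
      (fun k => fibSymbol V H₀ k (ξ k)) ζ (fun k => by
        rw [one_mul, Equiv.refl_apply, h, norm_smul, Complex.norm_real,
          Real.norm_of_nonneg (growth_pos k).le]
        exact norm_fibSymbol_le V k _)
    exact ⟨η, (T.mem_graph_verticalDirac V).mpr hη⟩

/-- The operator `(4 π² ‖k‖² + 1)^{-1/2}` on `ℓ²(ℤᵐ, V ⊗ H₀)`. -/
def weightOp (m : ℕ) (ι H₀ : Type*) [Fintype ι] [NormedAddCommGroup H₀] [InnerProductSpace ℂ H₀] :
    TotalSpace m ι H₀ →L[ℂ] TotalSpace m ι H₀ :=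
  blockOp id (fun k => (weight k : ℂ) • 1)

theorem isBlockOp_weightOp : IsBlockOp id (fun k => (weight k : ℂ) • 1) (weightOp m ι H₀) := by
  refine isBlockOp_diag (C := 1) fun k => ContinuousLinearMap.opNorm_le_bound _ zero_le_one
    fun w => ?_
  rw [smul_apply, one_apply_eq_self, norm_smul, Complex.norm_real,
    Real.norm_of_nonneg (weight_pos k).le]
  gcongr
  exact weight_le_one k

theorem weightOp_apply (ζ : TotalSpace m ι H₀) (k : Fin m → ℤ) :
    weightOp m ι H₀ ζ k = (weight k : ℂ) • ζ k := isBlockOp_weightOp ζ k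

theorem weightOp_mem_domain (ζ : TotalSpace m ι H₀) :
    weightOp m ι H₀ ζ ∈ (T.verticalDirac V).domain := by
  rw [mem_domain_verticalDirac]
  refine ⟨ζ, fun k => ?_⟩
  rw [weightOp_apply, smul_smul, ← Complex.ofReal_mul, growth_mul_weight, Complex.ofReal_one,
    one_smul]

theorem norm_toGraphDom_sq (ξ : (T.verticalDirac V).domain) :
    ‖toGraphDom (T.verticalDirac V) ξ‖ ^ 2 = ‖ξ.1‖ ^ 2 + ‖T.verticalDirac V ξ‖ ^ 2 := by
  have := WithLp.prod_norm_sq_eq_of_L2 (WithLp.toLp 2 (ξ.1, T.verticalDirac V ξ))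
  exact this

theorem exists_toGraphDom_eq {E : Type*} [NormedAddCommGroup E] [InnerProductSpace ℂ E]
    {T : E →ₗ.[ℂ] E} (g : GraphDom T) : ∃ ξ : T.domain, toGraphDom T ξ = g := by
  have hg : WithLp.ofLp g.1 ∈ T.graph := g.2
  rw [LinearPMap.mem_graph_iff] at hg
  obtain ⟨ξ, h1, h2⟩ := hg
  refine ⟨ξ, ?_⟩
  apply Subtype.ext (p := (· ∈ hilbertGraph T))
  apply (WithLp.linearEquiv 2 ℂ (E × E)).injective
  exact Prod.ext h1 h2

/-- The isometric isomorphism of `ℓ²(ℤᵐ, V ⊗ H₀)` with `Dom Dv`, given by the weights. -/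
def graphIso : TotalSpace m ι H₀ ≃ₗᵢ[ℂ] GraphDom (T.verticalDirac V) :=
  LinearIsometryEquiv.ofSurjective
    { toLinearMap := toGraphDom (T.verticalDirac V) ∘ₗ
        LinearMap.codRestrict (T.verticalDirac V).domain
          (weightOp m ι H₀ : TotalSpace m ι H₀ →ₗ[ℂ] TotalSpace m ι H₀)
          (T.weightOp_mem_domain V)
      norm_map' := by
        intro ζ
        rw [← sq_eq_sq₀ (norm_nonneg _) (norm_nonneg _)]
        refine (T.norm_toGraphDom_sq V _).trans ?_
        refine ((hasSum_norm_sq _).add (hasSum_norm_sq _)).unique ?_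
        convert hasSum_norm_sq ζ using 2 with k
        rw [verticalDirac_apply, norm_sq_add_norm_sq_fibSymbol]
        change (growth k * ‖weightOp m ι H₀ ζ k‖) ^ 2 = _
        rw [weightOp_apply, norm_smul, Complex.norm_real, Real.norm_of_nonneg (weight_pos k).le,
          ← mul_assoc, growth_mul_weight, one_mul] }
    (by
      intro g
      obtain ⟨ξ, rfl⟩ := exists_toGraphDom_eq g
      obtain ⟨ζ, h⟩ := (T.mem_domain_verticalDirac V).mp ξ.2
      refine ⟨ζ, ?_⟩
      change toGraphDom _ _ = _
      congr 1
      apply Subtype.ext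
      ext1
      funext k
      change weightOp m ι H₀ ζ k = _
      rw [weightOp_apply, h, smul_smul, ← Complex.ofReal_mul, weight_mul_growth,
        Complex.ofReal_one, one_smul])

end SpectralTriple

end CrossGauge
end

/-! ### The operator D and the operators preserving its domain. -/

noncomputable section
namespace CrossGauge
namespace SpectralTriple

variable {m r : ℕ} {ι B H₀ : Type*} [Fintype ι] [DecidableEq ι] [CStarAlgebra B]
  [NormedAddCommGroup H₀] [InnerProductSpace ℂ H₀] [CompleteSpace H₀]
  (T : SpectralTriple r B H₀) (V : SpinModule m ι)

theorem graphIso_apply (ζ : TotalSpace m ι H₀) :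
    T.graphIso V ζ = toGraphDom (T.verticalDirac V) ⟨weightOp m ι H₀ ζ, T.weightOp_mem_domain V ζ⟩ :=
  rfl

theorem graphIso_symm_toGraphDom (ξ : (T.verticalDirac V).domain) (k : Fin m → ℤ) :
    (T.graphIso V).symm (toGraphDom (T.verticalDirac V) ξ) k = (growth k : ℂ) • ξ.1 k := by
  obtain ⟨ζ, h⟩ := (T.mem_domain_verticalDirac V).mp ξ.2
  have : toGraphDom (T.verticalDirac V) ξ = T.graphIso V ζ := by
    rw [graphIso_apply]
    congr 1
    apply Subtype.ext
    ext1
    funext k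
    refine Eq.trans ?_ (weightOp_apply ζ k).symm
    rw [h, smul_smul, ← Complex.ofReal_mul, weight_mul_growth, Complex.ofReal_one, one_smul]
  rw [this, LinearIsometryEquiv.symm_apply_apply, h]

/-! ### The Dirac operator -/

theorem mem_graph_horizontalDirac {ξ η : TotalSpace m ι H₀} :
    (ξ, η) ∈ (T.horizontalDirac V).graph ↔ ∀ k, (ξ k, η k) ∈ (T.idTensD V).graph :=
  mem_graph_opSum

theorem mem_graph_add {ξ η : TotalSpace m ι H₀} :
    (ξ, η) ∈ (T.verticalDirac V + T.horizontalDirac V).graph ↔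
      ∀ k, (ξ k, η k - fibSymbol V H₀ k (ξ k)) ∈ (T.idTensD V).graph := by
  constructor
  · intro h k
    rw [LinearPMap.mem_graph_iff] at h
    obtain ⟨x, rfl, rfl⟩ := h
    have h1 := (T.mem_graph_horizontalDirac V).mp
      ((T.horizontalDirac V).mem_graph ⟨x.1, x.2.2⟩) k
    have h2 := T.verticalDirac_apply V ⟨x.1, x.2.1⟩ k
    have h3 : ((T.verticalDirac V + T.horizontalDirac V) x : ∀ _, Fib ι H₀) k =
        fibSymbol V H₀ k (x.1 k) + (T.horizontalDirac V ⟨x.1, x.2.2⟩ : ∀ _, Fib ι H₀) k := by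
      rw [← h2]
      rfl
    rw [h3, add_sub_cancel_left]
    exact h1
  · intro h
    -- Here the Pythagorean identity is needed: the vertical part of η is dominated by η, so both
    -- parts are separately square-summable.
    obtain ⟨η', hη', -⟩ := exists_lp_of_norm_le zero_le_one (Equiv.refl _)
      (fun k => fibSymbol V H₀ k (ξ k)) η (fun k => by
        have := T.norm_sq_symbol_add V (k := k) (h k)
        rw [add_sub_cancel] at this
        rw [one_mul, Equiv.refl_apply, ← sq_le_sq₀ (norm_nonneg _) (norm_nonneg _), this]
        exact le_add_of_nonneg_right (sq_nonneg _))
    have h1 : (ξ, η') ∈ (T.verticalDirac V).graph := (T.mem_graph_verticalDirac V).mpr hη'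
    have h2 : (ξ, η - η') ∈ (T.horizontalDirac V).graph := by
      rw [mem_graph_horizontalDirac]
      intro k
      have := h k
      rwa [← hη'] at this
    rw [LinearPMap.mem_graph_iff] at h1 h2 ⊢
    obtain ⟨⟨x, hx⟩, hx1, hx2⟩ := h1
    obtain ⟨⟨y, hy⟩, hy1, hy2⟩ := h2
    simp only at hx1 hx2 hy1 hy2
    subst hx1
    subst hy1
    refine ⟨⟨y, hx, hy⟩, rfl, ?_⟩
    change T.verticalDirac V ⟨y, hx⟩ + T.horizontalDirac V ⟨y, hy⟩ = η
    rw [hx2, hy2, add_sub_cancel]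

/-- The fibrewise description exhibits the graph as an intersection of closed conditions, so taking
the closure in the definition of D changes nothing. -/
theorem isClosed_add : (T.verticalDirac V + T.horizontalDirac V).IsClosed := by
  have : ((T.verticalDirac V + T.horizontalDirac V).graph :
      Set (TotalSpace m ι H₀ × TotalSpace m ι H₀)) =
      ⋂ k, {p | (p.1 k, p.2 k - fibSymbol V H₀ k (p.1 k)) ∈ (T.idTensD V).graph} := by
    ext ⟨ξ, η⟩
    simp only [SetLike.mem_coe, T.mem_graph_add V, Set.mem_iInter, Set.mem_ofPred_eq]
  rw [LinearPMap.IsClosed, this]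
  refine isClosed_iInter fun k => (T.isClosed_graph_idTensD V).preimage ?_
  have h1 : Continuous fun ξ : TotalSpace m ι H₀ => ξ k :=
    (lp.evalCLM ℂ (fun _ : Fin m → ℤ => Fib ι H₀) 2 k).continuous
  exact (h1.comp continuous_fst).prodMk ((h1.comp continuous_snd).sub
    ((fibSymbol V H₀ k).continuous.comp (h1.comp continuous_fst)))

/-- The Dirac operator `D`, the closure of `Dv + Dh`. -/
def totalDirac : TotalSpace m ι H₀ →ₗ.[ℂ] TotalSpace m ι H₀ :=
  (T.verticalDirac V + T.horizontalDirac V).closure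

theorem mem_graph_totalDirac {ξ η : TotalSpace m ι H₀} :
    (ξ, η) ∈ (T.totalDirac V).graph ↔
      ∀ k, (ξ k, η k - fibSymbol V H₀ k (ξ k)) ∈ (T.idTensD V).graph := by
  rw [totalDirac, closure_eq_of_isClosed (T.isClosed_add V), mem_graph_add]

theorem domain_totalDirac_le : (T.totalDirac V).domain ≤ (T.verticalDirac V).domain := by
  rw [totalDirac, closure_eq_of_isClosed (T.isClosed_add V)]
  exact inf_le_left

theorem totalDirac_apply_mem (ξ : (T.totalDirac V).domain) (k : Fin m → ℤ) :
    (ξ.1 k, T.totalDirac V ξ k - fibSymbol V H₀ k (ξ.1 k)) ∈ (T.idTensD V).graph :=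
  (T.mem_graph_totalDirac V).mp ((T.totalDirac V).mem_graph ξ) k

theorem exists_growth_smul {ξ : TotalSpace m ι H₀} (hξ : ξ ∈ (T.totalDirac V).domain) :
    ∃ ζ : TotalSpace m ι H₀, ∀ k, ζ k = (growth k : ℂ) • ξ k :=
  (T.mem_domain_verticalDirac V).mp (T.domain_totalDirac_le V hξ)

theorem single_mem_graph_totalDirac (p : Fin m → ℤ) {w v : Fib ι H₀}
    (h : (w, v) ∈ (T.idTensD V).graph) :
    ((lp.single 2 p w : TotalSpace m ι H₀), lp.single 2 p (fibSymbol V H₀ p w + v)) ∈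
      (T.totalDirac V).graph := by
  rw [mem_graph_totalDirac]
  intro k
  by_cases hk : k = p
  · subst hk
    rw [lp.single_apply_self, lp.single_apply_self, add_sub_cancel_left]
    exact h
  · rw [lp.single_apply_ne _ _ _ hk, lp.single_apply_ne _ _ _ hk, map_zero, sub_zero]
    exact zero_mem _

theorem single_mem_domain_totalDirac (p : Fin m → ℤ) {w v : Fib ι H₀}
    (h : (w, v) ∈ (T.idTensD V).graph) :
    (lp.single 2 p w : TotalSpace m ι H₀) ∈ (T.totalDirac V).domain :=
  LinearPMap.mem_domain_of_mem_graph (T.single_mem_graph_totalDirac V p h)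

theorem clm_ext_of_domain {X Y : Fib ι H₀ →L[ℂ] Fib ι H₀}
    (h : ∀ w v, (w, v) ∈ (T.idTensD V).graph → X w = Y w) : X = Y := by
  apply DFunLike.ext'
  refine Continuous.ext_on (T.dense_domain_idTensD V) X.continuous Y.continuous ?_
  rintro w ⟨v, hv⟩
  exact h w v hv

/-- Vectors supported at one point with value in the domain of γ ⊗ D₀ span a dense subspace. They
serve as test vectors throughout. -/
theorem ext_of_single {X Y : TotalSpace m ι H₀ →L[ℂ] TotalSpace m ι H₀}
    (h : ∀ p w v, (w, v) ∈ (T.idTensD V).graph → X (lp.single 2 p w) = Y (lp.single 2 p w)) :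
    X = Y := by
  refine ext_entry fun p q => T.clm_ext_of_domain V fun w v hw => ?_
  rw [entry_apply, entry_apply, h q w v hw]

theorem dense_domain_totalDirac : Dense ((T.totalDirac V).domain : Set (TotalSpace m ι H₀)) := by
  intro ξ
  have h1 := lp.hasSum_single (p := 2) (by norm_num) ξ
  have hs : ∀ k, (lp.single 2 k (ξ k) : TotalSpace m ι H₀) ∈
      ((T.totalDirac V).domain).topologicalClosure := by
    intro k
    have h2 := (T.dense_domain_idTensD V).closure_eq
    have h3 : (ξ k) ∈ closure {w : Fib ι H₀ | ∃ v, (w, v) ∈ (T.idTensD V).graph} := by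
      rw [h2]; trivial
    have h4 : Continuous fun w : Fib ι H₀ => (lp.single 2 k w : TotalSpace m ι H₀) :=
      (lp.singleContinuousLinearMap ℂ (fun _ : Fin m → ℤ => Fib ι H₀) 2 k).continuous
    refine map_mem_closure h4 h3 ?_
    rintro w ⟨v, hv⟩
    exact T.single_mem_domain_totalDirac V k hv
  have h5 : ξ ∈ ((T.totalDirac V).domain).topologicalClosure :=
    (Submodule.isClosed_topologicalClosure _).mem_of_tendsto h1
      (Filter.Eventually.of_forall fun s => Submodule.sum_mem _ fun k _ => hs k)
  exact h5

theorem weightOp_single (p : Fin m → ℤ) (w : Fib ι H₀) :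
    weightOp m ι H₀ (lp.single 2 p w) = lp.single 2 p ((weight p : ℂ) • w) :=
  isBlockOp_weightOp.apply_single p w

/-- Dom D is dense in Dom Dv for the graph norm: `graphIso` multiplies a vector supported at one
point by a scalar. So an operator given on Dom D has at most one continuous extension to Dom Dv. -/
theorem graphDom_ext {Ω Ω' : GraphDom (T.verticalDirac V) →L[ℂ] TotalSpace m ι H₀}
    (h : ∀ (ξ : TotalSpace m ι H₀) (_ : ξ ∈ (T.totalDirac V).domain)
      (hv : ξ ∈ (T.verticalDirac V).domain),
      Ω (toGraphDom _ ⟨ξ, hv⟩) = Ω' (toGraphDom _ ⟨ξ, hv⟩)) : Ω = Ω' := by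
  have h1 : Ω ∘L (T.graphIso V : TotalSpace m ι H₀ →L[ℂ] GraphDom (T.verticalDirac V)) =
      Ω' ∘L (T.graphIso V : TotalSpace m ι H₀ →L[ℂ] GraphDom (T.verticalDirac V)) := by
    refine T.ext_of_single V fun p w v hw => ?_
    change Ω (T.graphIso V _) = Ω' (T.graphIso V _)
    rw [graphIso_apply]
    refine h _ ?_ _
    rw [weightOp_single]
    exact T.single_mem_domain_totalDirac V p ((T.idTensD V).graph.smul_mem (weight p : ℂ) hw)
  ext g : 1
  have := congrArg (fun Z => Z ((T.graphIso V).symm g)) h1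
  simpa using this

/-! ### Operators preserving the domains -/

section Preserve

variable {T V} {l : Fin m → ℤ} {t : (Fin m → ℤ) → Fib ι H₀ →L[ℂ] Fib ι H₀}
  {X : TotalSpace m ι H₀ →L[ℂ] TotalSpace m ι H₀} {C : ℝ}

theorem growth_le_mul_growth_sub (p l : Fin m → ℤ) :
    growth p ≤ 2 * growth l * growth (p - l) := by
  have := growth_add_le (p - l) l
  rw [sub_add_cancel] at this
  linarith

/-- Bounded block operators along translations act on `Dom Dv`, boundedly for the graph norm. -/
theorem exists_lift_verticalDirac (hX : IsBlockOp (fun p => p - l) t X) (ht : ∀ p, ‖t p‖ ≤ C) :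
    ∃ Y : GraphDom (T.verticalDirac V) →L[ℂ] GraphDom (T.verticalDirac V),
      ∀ ξ : (T.verticalDirac V).domain, ∃ h : X ξ ∈ (T.verticalDirac V).domain,
        Y (toGraphDom _ ξ) = toGraphDom _ ⟨X ξ, h⟩ := by
  have hC : 0 ≤ C := (norm_nonneg _).trans (ht 0)
  -- Conjugated by `graphIso`, the blocks acquire the ratio of growth at `p` and at `p - l`, which
  -- is at most `2 * growth l`.
  have hb : ∀ p, ‖((growth p * weight (p - l) : ℝ) : ℂ) • t p‖ ≤ 2 * growth l * C := by
    intro p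
    have h1 := growth_pos p
    have h2 := weight_pos (p - l)
    rw [norm_smul, Complex.norm_real, Real.norm_of_nonneg (by positivity)]
    refine mul_le_mul ?_ (ht p) (norm_nonneg _) (by have := growth_pos l; positivity)
    calc growth p * weight (p - l) ≤ 2 * growth l * growth (p - l) * weight (p - l) := by
          gcongr; exact growth_le_mul_growth_sub p l
      _ = 2 * growth l := by rw [mul_assoc, growth_mul_weight, mul_one]
  have hZ := isBlockOp_blockOp (Equiv.subRight l) hb
  set Z := blockOp (Equiv.subRight l) fun p => ((growth p * weight (p - l) : ℝ) : ℂ) • t p with hZd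
  refine ⟨((T.graphIso V : TotalSpace m ι H₀ →L[ℂ] GraphDom (T.verticalDirac V)) ∘L Z) ∘L
    ((T.graphIso V).symm : GraphDom (T.verticalDirac V) →L[ℂ] TotalSpace m ι H₀), fun ξ => ?_⟩
  have key : ∀ p, Z ((T.graphIso V).symm (toGraphDom _ ξ)) p = (growth p : ℂ) • X ξ p := by
    intro p
    rw [hZ, hX]
    change ((growth p * weight (p - l) : ℝ) : ℂ) •
      t p ((T.graphIso V).symm (toGraphDom _ ξ) (p - l)) = _
    rw [graphIso_symm_toGraphDom, map_smul, smul_smul, ← Complex.ofReal_mul, mul_assoc,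
      weight_mul_growth, mul_one]
  have hm : X ξ ∈ (T.verticalDirac V).domain :=
    (T.mem_domain_verticalDirac V).mpr ⟨_, key⟩
  refine ⟨hm, ?_⟩
  change T.graphIso V (Z ((T.graphIso V).symm (toGraphDom _ ξ))) = _
  apply (T.graphIso V).symm.injective
  rw [LinearIsometryEquiv.symm_apply_apply]
  ext1
  funext p
  exact (key p).trans (T.graphIso_symm_toGraphDom V ⟨X ξ, hm⟩ p).symm

/-- The image splits into three square-summable parts. The vertical part and the commutator part `y`
are bounded by the sequence `growth` times ξ, which lies in ℓ² because Dom D ⊆ Dom Dv; the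
horizontal part is bounded by η through the Pythagorean identity. So commutators of linear growth
are allowed. -/
theorem exists_mem_graph_totalDirac {C' : ℝ} {c : ℂ} {y : (Fin m → ℤ) → Fib ι H₀ →L[ℂ] Fib ι H₀}
    (hX : IsBlockOp (fun p => p - l) t X) (ht : ∀ p, ‖t p‖ ≤ C) (hy : ∀ p, ‖y p‖ ≤ C' * growth p)
    (h : ∀ p w v, (w, v) ∈ (T.idTensD V).graph → (t p w, c • t p v + y p w) ∈ (T.idTensD V).graph)
    {ξ η : TotalSpace m ι H₀} (hξ : (ξ, η) ∈ (T.totalDirac V).graph) :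
    ∃ η' : TotalSpace m ι H₀, (X ξ, η') ∈ (T.totalDirac V).graph ∧ ∀ p, η' p =
      fibSymbol V H₀ p (t p (ξ (p - l))) +
        (c • t p (η (p - l) - fibSymbol V H₀ (p - l) (ξ (p - l))) + y p (ξ (p - l))) := by
  have hC : 0 ≤ C := (norm_nonneg _).trans (ht 0)
  have hC' : 0 ≤ C' := by
    have h0 := (norm_nonneg _).trans (hy 0)
    exact nonneg_of_mul_nonneg_left h0 (growth_pos _)
  have hdom : ξ ∈ (T.totalDirac V).domain := LinearPMap.mem_domain_of_mem_graph hξ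
  obtain ⟨ζ, hζ⟩ := T.exists_growth_smul V hdom
  have hζn : ∀ k, ‖ζ k‖ = growth k * ‖ξ k‖ := fun k => by
    rw [hζ, norm_smul, Complex.norm_real, Real.norm_of_nonneg (growth_pos k).le]
  have hl := growth_pos l
  have hgl : ∀ p, growth p * ‖ξ (p - l)‖ ≤ 2 * growth l * ‖ζ (p - l)‖ := fun p => by
    rw [hζn, ← mul_assoc]
    gcongr
    exact growth_le_mul_growth_sub p l
  obtain ⟨η₁, hη₁, -⟩ := exists_lp_of_norm_le (C := C * (2 * growth l)) (by positivity)
    (Equiv.subRight l) (fun p => fibSymbol V H₀ p (t p (ξ (p - l)))) ζ (fun p => by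
      have hg := growth_pos p
      calc ‖fibSymbol V H₀ p (t p (ξ (p - l)))‖ ≤ growth p * (C * ‖ξ (p - l)‖) :=
            (norm_fibSymbol_le V p _).trans (by
              gcongr; exact ((t p).le_opNorm _).trans (by gcongr; exact ht p))
        _ = C * (growth p * ‖ξ (p - l)‖) := by ring
        _ ≤ C * (2 * growth l * ‖ζ (p - l)‖) := mul_le_mul_of_nonneg_left (hgl p) ‹_›
        _ = _ := by rw [← mul_assoc]; rfl)
  obtain ⟨η₂, hη₂, -⟩ := exists_lp_of_norm_le (C := ‖c‖ * C) (by positivity)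
    (Equiv.subRight l)
    (fun p => c • t p (η (p - l) - fibSymbol V H₀ (p - l) (ξ (p - l)))) η (fun p => by
      rw [norm_smul, mul_assoc]
      gcongr
      refine ((t p).le_opNorm _).trans (mul_le_mul (ht p) ?_ (norm_nonneg _) hC)
      have h1 := T.norm_sq_symbol_add V (k := p - l) ((T.mem_graph_totalDirac V).mp hξ (p - l))
      rw [add_sub_cancel] at h1
      rw [← sq_le_sq₀ (norm_nonneg _) (norm_nonneg _)]
      change _ ≤ ‖η (p - l)‖ ^ 2
      rw [h1]
      exact le_add_of_nonneg_left (sq_nonneg _))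
  obtain ⟨η₃, hη₃, -⟩ := exists_lp_of_norm_le (C := C' * (2 * growth l)) (by positivity)
    (Equiv.subRight l) (fun p => y p (ξ (p - l))) ζ (fun p => by
      calc ‖y p (ξ (p - l))‖ ≤ C' * growth p * ‖ξ (p - l)‖ :=
            ((y p).le_opNorm _).trans (by gcongr; exact hy p)
        _ = C' * (growth p * ‖ξ (p - l)‖) := by ring
        _ ≤ C' * (2 * growth l * ‖ζ (p - l)‖) := mul_le_mul_of_nonneg_left (hgl p) ‹_›
        _ = _ := by rw [← mul_assoc]; rfl)
  have hval : ∀ p, (η₁ + (η₂ + η₃)) p = fibSymbol V H₀ p (t p (ξ (p - l))) +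
        (c • t p (η (p - l) - fibSymbol V H₀ (p - l) (ξ (p - l))) + y p (ξ (p - l))) := by
    intro p
    rw [← hη₁, ← hη₂, ← hη₃]
    rfl
  refine ⟨η₁ + (η₂ + η₃), ?_, hval⟩
  rw [mem_graph_totalDirac]
  intro p
  rw [hval, hX, add_sub_cancel_left]
  exact h p _ _ ((T.mem_graph_totalDirac V).mp hξ (p - l))

end Preserve

end SpectralTriple

end CrossGauge
end

/-! ### The crossed product, its fixed points and its horizontal one-forms. -/

noncomputable section
namespace CrossGauge
namespace SpectralTriple

variable {m r : ℕ} {ι B H₀ : Type*} [Fintype ι] [DecidableEq ι] [CStarAlgebra B]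
  [NormedAddCommGroup H₀] [InnerProductSpace ℂ H₀] [CompleteSpace H₀]
  (T : SpectralTriple r B H₀) (β : EquicontinuousAction m T) (V : SpinModule m ι)

/-! ### The crossed product -/

theorem norm_tens_rep_act_le (p : Fin m → ℤ) (b : B) :
    ‖tens (1 : Matrix ι ι ℂ) (T.rep (β.act p b))‖ ≤ ‖b‖ := by
  -- Without a spin module at hand `ι` may be empty, and then all operators on the fibre vanish.
  by_cases h : Nonempty ι
  · rw [norm_tens_one, β.norm_rep_act]
  · rw [not_nonempty_iff] at h
    rw [Subsingleton.elim (tens (1 : Matrix ι ι ℂ) (T.rep (β.act p b))) 0, norm_zero]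
    exact norm_nonneg _

theorem isBlockOp_crossedOp (b : B) (k : Fin m → ℤ) :
    IsBlockOp (fun p => p - k) (fun p => tens (1 : Matrix ι ι ℂ) (T.rep (β.act p b)))
      (T.crossedOp β ι b k) :=
  isBlockOp_blockOp (Equiv.subRight k) (fun p => T.norm_tens_rep_act_le β p b)

theorem isBlockOp_crossedOp_zero (b : B) :
    IsBlockOp id (fun p => tens (1 : Matrix ι ι ℂ) (T.rep (β.act p b)))
      (T.crossedOp β ι b 0) :=
  (T.isBlockOp_crossedOp β b 0).congr (fun p => sub_zero p) (fun _ => rfl)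

theorem norm_crossedOp_le (b : B) (k : Fin m → ℤ) : ‖T.crossedOp β ι b k‖ ≤ ‖b‖ :=
  IsBlockOp.norm_le (σ := Equiv.subRight k) (norm_nonneg b) (T.isBlockOp_crossedOp β b k)
    (fun p => T.norm_tens_rep_act_le β p b)

theorem crossedOp_one_zero : T.crossedOp β ι 1 0 = 1 := by
  refine (T.isBlockOp_crossedOp_zero β 1).unique ?_
  refine isBlockOp_one.congr (fun _ => rfl) fun p => ?_
  rw [map_one, map_one, tens_one_one]

theorem crossedOp_add (b b' : B) (k : Fin m → ℤ) :
    T.crossedOp β ι (b + b') k = T.crossedOp β ι b k + T.crossedOp β ι b' k := by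
  refine (T.isBlockOp_crossedOp β _ k).unique ?_
  refine ((T.isBlockOp_crossedOp β b k).add (T.isBlockOp_crossedOp β b' k)).congr
    (fun _ => rfl) fun p => ?_
  rw [map_add, map_add, tens_add]

theorem crossedOp_smul (c : ℂ) (b : B) (k : Fin m → ℤ) :
    T.crossedOp β ι (c • b) k = c • T.crossedOp β ι b k := by
  refine (T.isBlockOp_crossedOp β _ k).unique ?_
  refine ((T.isBlockOp_crossedOp β b k).smul c).congr (fun _ => rfl) fun p => ?_
  rw [map_smul, map_smul, tens_smul]

/-- Since b acts at p through β_p, the translation λ_k implements β_{-k} in this representation: λ_k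
b' = β_{-k}(b') λ_k. -/
theorem crossedOp_mul_crossedOp_zero (b b' : B) (k : Fin m → ℤ) :
    T.crossedOp β ι b k * T.crossedOp β ι b' 0 = T.crossedOp β ι (b * β.act (-k) b') k := by
  refine ((T.isBlockOp_crossedOp β b k).mul (T.isBlockOp_crossedOp_zero β b')).unique ?_
  refine (T.isBlockOp_crossedOp β _ k).congr (fun _ => rfl) fun p => ?_
  rw [tens_mul, one_mul, ← map_mul, map_mul, ← β.act_add, ← sub_eq_add_neg]

/-- `b ↦ b λ_k` as a continuous linear map. -/
def crossedOpL (ι : Type*) [Fintype ι] [DecidableEq ι] (k : Fin m → ℤ) :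
    B →L[ℂ] TotalSpace m ι H₀ →L[ℂ] TotalSpace m ι H₀ :=
  LinearMap.mkContinuous
    { toFun := fun b => T.crossedOp β ι b k
      map_add' := fun b b' => T.crossedOp_add β b b' k
      map_smul' := fun c b => T.crossedOp_smul β c b k } 1
    (fun b => by rw [one_mul]; exact T.norm_crossedOp_le β b k)

theorem crossedOp_mem_alg {b : B} (hb : b ∈ T.smooth) (k : Fin m → ℤ) :
    T.crossedOp β ι b k ∈ (T.crossedProduct β V).alg :=
  Submodule.subset_span ⟨b, hb, k, rfl⟩

theorem crossedOp_mem_algA (b : B) (k : Fin m → ℤ) :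
    T.crossedOp β ι b k ∈ (T.crossedProduct β V).algA := by
  have h : b ∈ closure (T.smooth : Set B) := by rw [T.smooth_dense.closure_eq]; trivial
  exact map_mem_closure (f := fun b => T.crossedOp β ι b k) (T.crossedOpL β ι k).continuous h
    (fun b hb => T.crossedOp_mem_alg β V hb k)

theorem one_mem_alg : (1 : TotalSpace m ι H₀ →L[ℂ] TotalSpace m ι H₀) ∈
    (T.crossedProduct β V).alg := by
  rw [← T.crossedOp_one_zero β]
  exact T.crossedOp_mem_alg β V (one_mem _) 0

/-! ### The action of the torus -/

theorem norm_pairing (p : Fin m → ℤ) (t : Fin m → UnitAddCircle) : ‖pairing p t‖ = 1 := by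
  rw [pairing, norm_prod]
  exact Finset.prod_eq_one fun j _ => by rw [fourier_apply]; exact Circle.norm_coe _

theorem exists_pairing_ne {p q : Fin m → ℤ} (h : p ≠ q) :
    ∃ t : Fin m → UnitAddCircle, pairing p t ≠ pairing q t := by
  obtain ⟨j, hj⟩ := Function.ne_iff.mp h
  have hj' : (p j : ℂ) - q j ≠ 0 := by
    rw [sub_ne_zero]
    exact_mod_cast hj
  -- Chosen so that 2πi (p_j - q_j) x = πi; the two characters then differ by the factor -1.
  set x : ℝ := (2 * ((p j : ℝ) - q j))⁻¹ with hx
  refine ⟨Pi.single j (x : UnitAddCircle), fun heq => ?_⟩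
  have key : ∀ r : Fin m → ℤ, pairing r (Pi.single j (x : UnitAddCircle)) =
      Complex.exp (2 * Real.pi * Complex.I * r j * x) := by
    intro r
    rw [pairing, Finset.prod_eq_single j]
    · rw [Pi.single_eq_same, fourier_coe_apply]
      simp
    · intro i _ hi
      rw [Pi.single_eq_of_ne hi, fourier_eval_zero]
    · simp
  rw [key, key] at heq
  have h1 : 2 * Real.pi * Complex.I * p j * x =
      2 * Real.pi * Complex.I * q j * x + Real.pi * Complex.I := by
    rw [hx]
    push_cast
    field_simp
    ring
  rw [h1, Complex.exp_add, Complex.exp_pi_mul_I] at heq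
  have h2 := Complex.exp_ne_zero (2 * Real.pi * Complex.I * q j * x)
  apply h2
  linear_combination (-1 / 2 : ℂ) * heq

theorem isBlockOp_act (t : Fin m → UnitAddCircle) :
    IsBlockOp id (fun p => pairing p t • (1 : Fib ι H₀ →L[ℂ] Fib ι H₀))
      ((T.crossedProduct β V).act t) := by
  refine isBlockOp_diag (C := 1) fun p =>
    ContinuousLinearMap.opNorm_le_bound _ zero_le_one fun w => ?_
  change ‖pairing p t • w‖ ≤ _
  rw [norm_smul, norm_pairing]

/-- Invariance multiplies the entry (p, q) by the characters of p and of q with the same result, and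
for p ≠ q some group element tells them apart. -/
theorem isBlockOp_of_invariant {X : TotalSpace m ι H₀ →L[ℂ] TotalSpace m ι H₀}
    (h : ∀ t, X * (T.crossedProduct β V).act t = (T.crossedProduct β V).act t * X) :
    IsBlockOp id (fun p => entry p p X) X := by
  refine isBlockOp_of_diagonal fun p q hpq => ?_
  obtain ⟨t, ht⟩ := exists_pairing_ne hpq
  have hU := T.isBlockOp_act β V t
  ext1 w
  have h1 := congrArg (fun Z : TotalSpace m ι H₀ →L[ℂ] TotalSpace m ι H₀ =>
    Z (lp.single 2 q w) p) (h t)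
  simp only [mul_apply_eq_comp] at h1
  rw [hU.apply_single, hU, smul_apply, one_apply_eq_self, lp.single_smul, map_smul] at h1
  change pairing q t • X (lp.single 2 q w) p = pairing p t • X (lp.single 2 q w) p at h1
  change X (lp.single 2 q w) p = 0
  have h2 : (pairing p t - pairing q t) • X (lp.single 2 q w) p = 0 := by
    rw [sub_smul, h1, sub_self]
  exact (smul_eq_zero.mp h2).resolve_left (sub_ne_zero.mpr ht)

theorem IsBlockOp.comm_act {t : (Fin m → ℤ) → Fib ι H₀ →L[ℂ] Fib ι H₀}
    {X : TotalSpace m ι H₀ →L[ℂ] TotalSpace m ι H₀} (hX : IsBlockOp id t X)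
    (g : Fin m → UnitAddCircle) :
    X * (T.crossedProduct β V).act g = (T.crossedProduct β V).act g * X := by
  have hU := T.isBlockOp_act β V g
  refine (hX.mul hU).unique ((hU.mul hX).congr (fun _ => rfl) fun p => ?_)
  ext1 w
  simp

/-! ### The fixed point algebras -/

/-- The k-th Fourier coefficient: along the diagonal (p, p - k) only the terms bλ_k contribute, and
they contribute the orbit of b. -/
theorem exists_entry_eq {a : TotalSpace m ι H₀ →L[ℂ] TotalSpace m ι H₀}
    (ha : a ∈ (T.crossedProduct β V).alg) (k : Fin m → ℤ) :
    ∃ b ∈ T.smooth, ∀ p, entry p (p - k) a = tens 1 (T.rep (β.act p b)) := by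
  change a ∈ Submodule.span ℂ _ at ha
  induction ha using Submodule.span_induction with
  | mem x hx =>
    obtain ⟨b, hb, l, rfl⟩ := hx
    by_cases hkl : l = k
    · subst hkl
      exact ⟨b, hb, fun p => (T.isBlockOp_crossedOp β b l).entry_eq p⟩
    · refine ⟨0, zero_mem _, fun p => ?_⟩
      rw [isBlockOp_iff_entry.mp (T.isBlockOp_crossedOp β b l), if_neg (by simpa using hkl),
        map_zero, map_zero, tens_zero]
  | zero => exact ⟨0, zero_mem _, fun p => by rw [map_zero, map_zero, map_zero, tens_zero]⟩
  | add x y _ _ hx hy =>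
    obtain ⟨b, hb, h⟩ := hx
    obtain ⟨b', hb', h'⟩ := hy
    exact ⟨b + b', add_mem hb hb', fun p => by
      rw [map_add, map_add, map_add, tens_add, h, h']⟩
  | smul c x _ hx =>
    obtain ⟨b, hb, h⟩ := hx
    exact ⟨c • b, T.smooth.smul_mem hb c, fun p => by
      rw [map_smul, map_smul, map_smul, tens_smul, h]⟩

/-- The entry (0, 0) stays in the closed isometric copy of B and defines b. On 𝒜 the distances from
the entry at p to β_p(b) and from the entry at 0 to b agree, as β_p is isometric; this comparison
passes to the closure. -/
theorem exists_diagonal_eq {a : TotalSpace m ι H₀ →L[ℂ] TotalSpace m ι H₀}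
    (ha : a ∈ (T.crossedProduct β V).algA) :
    ∃ b, ∀ p, entry p p a = tens 1 (T.rep (β.act p b)) := by
  have := V.nonempty
  let j : B →+ (Fib ι H₀ →L[ℂ] Fib ι H₀) :=
    { toFun := fun b => tens 1 (T.rep b)
      map_zero' := by rw [map_zero, tens_zero]
      map_add' := fun b b' => by rw [map_add, tens_add] }
  have hj : Isometry j := AddMonoidHomClass.isometry_of_norm j fun b => by
    change ‖tens (1 : Matrix ι ι ℂ) (T.rep b)‖ = _
    rw [norm_tens_one, T.norm_rep]
  have halg : ∀ a ∈ (T.crossedProduct β V).alg, ∃ b, ∀ p, entry p p a = j (β.act p b) := by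
    intro a ha
    obtain ⟨b, -, hb⟩ := T.exists_entry_eq β V ha 0
    refine ⟨b, fun p => ?_⟩
    have h := hb p
    rw [sub_zero] at h
    exact h
  have h0 : entry (0 : Fin m → ℤ) 0 a ∈ Set.range j := by
    have hcl : IsClosed (Set.range j) := hj.isClosedEmbedding.isClosed_range
    rw [← hcl.closure_eq]
    refine map_mem_closure (entry (0 : Fin m → ℤ) 0).continuous ha ?_
    intro a ha
    obtain ⟨b, hb⟩ := halg a ha
    exact ⟨β.act 0 b, (hb 0).symm⟩
  obtain ⟨b, hb⟩ := h0
  refine ⟨b, fun p => ?_⟩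
  have hcl : IsClosed {a : TotalSpace m ι H₀ →L[ℂ] TotalSpace m ι H₀ |
      ‖entry p p a - j (β.act p b)‖ ≤ ‖entry (0 : Fin m → ℤ) 0 a - j b‖} :=
    isClosed_le ((entry p p).continuous.sub continuous_const).norm
      ((entry (0 : Fin m → ℤ) 0).continuous.sub continuous_const).norm
  have h2 : closure ((T.crossedProduct β V).alg : Set _) ⊆ _ := closure_minimal (by
    intro a ha
    obtain ⟨b', hb'⟩ := halg a ha
    change ‖entry p p a - j (β.act p b)‖ ≤ ‖entry (0 : Fin m → ℤ) 0 a - j b‖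
    rw [hb', hb', β.act_zero, ← map_sub, ← map_sub, ← map_sub, hj.norm_map_of_map_zero
      (map_zero j), hj.norm_map_of_map_zero (map_zero j), β.norm_act]) hcl
  have h3 : ‖entry p p a - j (β.act p b)‖ ≤ ‖entry (0 : Fin m → ℤ) 0 a - j b‖ := h2 ha
  rw [hb, sub_self, norm_zero] at h3
  exact sub_eq_zero.mp (norm_le_zero_iff.mp h3)

theorem mem_fixedA_iff {a : TotalSpace m ι H₀ →L[ℂ] TotalSpace m ι H₀} :
    a ∈ (T.crossedProduct β V).fixedA ↔ ∃ b, a = T.crossedOp β ι b 0 := by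
  constructor
  · rintro ⟨ha, hg⟩
    obtain ⟨b, hb⟩ := T.exists_diagonal_eq β V ha
    refine ⟨b, ?_⟩
    have h1 := T.isBlockOp_of_invariant β V fun t => (hg t).symm
    exact h1.unique ((T.isBlockOp_crossedOp_zero β b).congr (fun _ => rfl) fun p => (hb p).symm)
  · rintro ⟨b, rfl⟩
    exact ⟨T.crossedOp_mem_algA β V b 0, fun g =>
      (IsBlockOp.comm_act T β V (T.isBlockOp_crossedOp_zero β b) g).symm⟩

theorem mem_fixedAlg_iff {a : TotalSpace m ι H₀ →L[ℂ] TotalSpace m ι H₀} :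
    a ∈ (T.crossedProduct β V).fixedAlg ↔ ∃ b ∈ T.smooth, a = T.crossedOp β ι b 0 := by
  constructor
  · rintro ⟨ha, -, hg⟩
    obtain ⟨b, hbs, hb⟩ := T.exists_entry_eq β V ha 0
    refine ⟨b, hbs, ?_⟩
    have h1 := T.isBlockOp_of_invariant β V fun t => (hg t).symm
    exact h1.unique ((T.isBlockOp_crossedOp_zero β b).congr (fun _ => rfl) fun p => by
      rw [← hb p, sub_zero])
  · rintro ⟨b, hb, rfl⟩
    exact ⟨T.crossedOp_mem_alg β V hb 0, (T.mem_fixedA_iff β V).mpr ⟨b, rfl⟩⟩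

/-! ### Domains -/

theorem exists_norm_tens_d_le {b : B} (hb : b ∈ T.smooth) :
    ∃ C : ℝ, ∀ p, ‖tens V.grading (T.d (β.act p b))‖ ≤ C := by
  obtain ⟨C, hC⟩ := β.exists_norm_d_le hb
  exact ⟨C, fun p => by rw [V.norm_tens_grading]; exact hC p⟩

/-- Metric equicontinuity bounds the commutator terms γ ⊗ [D₀, β_p(b)] uniformly in p. -/
theorem crossedOp_mem_graph {b : B} (hb : b ∈ T.smooth) (k : Fin m → ℤ)
    {ξ η : TotalSpace m ι H₀} (hξ : (ξ, η) ∈ (T.totalDirac V).graph) :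
    ∃ η' : TotalSpace m ι H₀, (T.crossedOp β ι b k ξ, η') ∈ (T.totalDirac V).graph ∧ ∀ p, η' p =
      fibSymbol V H₀ p (tens 1 (T.rep (β.act p b)) (ξ (p - k))) +
        ((1 : ℂ) • tens 1 (T.rep (β.act p b)) (η (p - k) - fibSymbol V H₀ (p - k) (ξ (p - k))) +
          tens V.grading (T.d (β.act p b)) (ξ (p - k))) := by
  obtain ⟨C, hC⟩ := T.exists_norm_tens_d_le β V hb
  have hC0 : 0 ≤ C := (norm_nonneg _).trans (hC 0)
  refine exists_mem_graph_totalDirac (C' := C) (T.isBlockOp_crossedOp β b k)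
    (fun p => T.norm_tens_rep_act_le β p b)
    (fun p => (hC p).trans (le_mul_of_one_le_right hC0 (one_le_growth p))) ?_ hξ
  intro p w v h
  rw [one_smul]
  exact T.tens_one_mem_graph_idTensD V (T.isCommutator_d (β.act_smooth p b hb)) h

theorem alg_mem_domain {a : TotalSpace m ι H₀ →L[ℂ] TotalSpace m ι H₀}
    (ha : a ∈ (T.crossedProduct β V).alg) {ξ : TotalSpace m ι H₀}
    (hξ : ξ ∈ (T.totalDirac V).domain) : a ξ ∈ (T.totalDirac V).domain := by
  change a ∈ Submodule.span ℂ _ at ha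
  induction ha using Submodule.span_induction with
  | mem x hx =>
    obtain ⟨b, hb, l, rfl⟩ := hx
    obtain ⟨η, hη⟩ := LinearPMap.mem_domain_iff.mp hξ
    obtain ⟨η', h, -⟩ := T.crossedOp_mem_graph β V hb l hη
    exact LinearPMap.mem_domain_of_mem_graph h
  | zero => exact zero_mem _
  | add x y _ _ hx hy => exact add_mem hx hy
  | smul c x _ hx => exact Submodule.smul_mem _ c hx

theorem alg_lift {a : TotalSpace m ι H₀ →L[ℂ] TotalSpace m ι H₀}
    (ha : a ∈ (T.crossedProduct β V).alg) :
    ∃ Y : GraphDom (T.verticalDirac V) →L[ℂ] GraphDom (T.verticalDirac V),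
      ∀ ξ : (T.verticalDirac V).domain, ∃ h : a ξ ∈ (T.verticalDirac V).domain,
        Y (toGraphDom _ ξ) = toGraphDom _ ⟨a ξ, h⟩ := by
  change a ∈ Submodule.span ℂ _ at ha
  induction ha using Submodule.span_induction with
  | mem x hx =>
    obtain ⟨b, hb, l, rfl⟩ := hx
    exact exists_lift_verticalDirac (T.isBlockOp_crossedOp β b l)
      (fun p => T.norm_tens_rep_act_le β p b)
  | zero => exact ⟨0, fun ξ => ⟨zero_mem _, (map_zero (toGraphDom (T.verticalDirac V))).symm⟩⟩
  | add x y _ _ hx hy =>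
    obtain ⟨Y, hY⟩ := hx
    obtain ⟨Y', hY'⟩ := hy
    refine ⟨Y + Y', fun ξ => ?_⟩
    obtain ⟨h, e⟩ := hY ξ
    obtain ⟨h', e'⟩ := hY' ξ
    refine ⟨add_mem h h', ?_⟩
    rw [add_apply, e, e', ← map_add]
    rfl
  | smul c x _ hx =>
    obtain ⟨Y, hY⟩ := hx
    refine ⟨c • Y, fun ξ => ?_⟩
    obtain ⟨h, e⟩ := hY ξ
    refine ⟨Submodule.smul_mem _ c h, ?_⟩
    rw [smul_apply, e, ← map_smul]
    rfl

/-- 1 ∈ 𝒜 and Dom D ⊆ Dom Dv, so the factor 𝒜 · Dom Dv imposes nothing and all conditions of the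
gauge theory live on Dom D. -/
theorem coreDom_eq : (T.crossedProduct β V).coreDom = (T.totalDirac V).domain := by
  refine le_antisymm inf_le_left (le_inf le_rfl fun ξ hξ => ?_)
  exact Submodule.subset_span ⟨1, T.one_mem_alg β V, ξ, T.domain_totalDirac_le V hξ, rfl⟩

/-! ### Horizontal one-forms -/

theorem isBlockOp_diag_d {b : B} (hb : b ∈ T.smooth) :
    IsBlockOp id (fun p => tens V.grading (T.d (β.act p b)))
      (blockOp id fun p => tens V.grading (T.d (β.act p b))) := by
  obtain ⟨C, hC⟩ := T.exists_norm_tens_d_le β V hb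
  exact isBlockOp_diag hC

/-- s(p) ⊗ 1 commutes with 1 ⊗ β_p(b), so only the horizontal part of D contributes. -/
theorem isCommutator_crossedOp {b : B} (hb : b ∈ T.smooth) :
    IsCommutator (T.totalDirac V) (T.crossedOp β ι b 0)
      (blockOp id fun p => tens V.grading (T.d (β.act p b))) := by
  intro ξ
  obtain ⟨η', h1, h2⟩ := T.crossedOp_mem_graph β V hb 0 ((T.totalDirac V).mem_graph ξ)
  have hm := LinearPMap.mem_domain_of_mem_graph h1
  refine ⟨hm, ?_⟩
  have h3 : T.totalDirac V ⟨_, hm⟩ = η' :=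
    LinearPMap.mem_graph_snd_inj _ ((T.totalDirac V).mem_graph ⟨_, hm⟩) h1 rfl
  rw [h3]
  ext1
  funext p
  change η' p - T.crossedOp β ι b 0 (T.totalDirac V ξ) p = _
  rw [h2, T.isBlockOp_diag_d β V hb, T.isBlockOp_crossedOp_zero β b]
  have hcomm : fibSymbol V H₀ p (tens 1 (T.rep (β.act p b)) (ξ.1 p)) =
      tens 1 (T.rep (β.act p b)) (fibSymbol V H₀ p (ξ.1 p)) := by
    rw [fibSymbol, ← mul_apply_eq_comp, ← mul_apply_eq_comp, tens_mul, tens_mul]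
    simp
  simp only [sub_zero, id, one_smul, map_sub]
  rw [hcomm]
  abel

theorem commutator_crossedOp {b : B} (hb : b ∈ T.smooth) :
    commutator (T.crossedProduct β V).D (T.crossedOp β ι b 0) =
      blockOp id fun p => tens V.grading (T.d (β.act p b)) :=
  (T.isCommutator_crossedOp β V hb).commutator_eq (T.dense_domain_totalDirac V)

/-- The coefficient of `γ ⊗ X` in the matrix entry `(p, q)`. -/
def gradedEntry (i : ι) (p q : Fin m → ℤ) :
    (TotalSpace m ι H₀ →L[ℂ] TotalSpace m ι H₀) →L[ℂ] (H₀ →L[ℂ] H₀) :=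
  fibEntry i i ∘L (ContinuousLinearMap.mul ℂ (Fib ι H₀ →L[ℂ] Fib ι H₀) (fibGrading V H₀)) ∘L
    entry p q

theorem gradedEntry_of_entry {i : ι} {p q : Fin m → ℤ}
    {X : TotalSpace m ι H₀ →L[ℂ] TotalSpace m ι H₀} {S : H₀ →L[ℂ] H₀}
    (h : entry p q X = tens V.grading S) : gradedEntry V i p q X = S := by
  change fibEntry i i (fibGrading V H₀ * entry p q X) = S
  rw [h, tens_mul, V.grading_sq, one_mul, fibEntry_tens, Matrix.one_apply_eq, one_smul]

/-- On its diagonal bλ_n [D, b₂] has the entries γ ⊗ β_p(b) [D₀, β_{p-n}(b₂)], so moving from (k, 0)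
to (l + k, l) applies β_l. Being a closed linear relation, this survives in the closure of A · [D,
𝒜^𝕋]; it is the source of the cocycle identity for potentials. -/
theorem mem_formGraph_of_mem_horizontalForms {Z : TotalSpace m ι H₀ →L[ℂ] TotalSpace m ι H₀}
    (hZ : Z ∈ (T.crossedProduct β V).horizontalForms) (i : ι) (k l : Fin m → ℤ) :
    (gradedEntry V i k 0 Z, gradedEntry V i (l + k) l Z) ∈ T.formGraph β l := by
  let Φ : (TotalSpace m ι H₀ →L[ℂ] TotalSpace m ι H₀) →L[ℂ] (H₀ →L[ℂ] H₀) × (H₀ →L[ℂ] H₀) :=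
    (gradedEntry V i k 0).prod (gradedEntry V i (l + k) l)
  have hcl : IsClosed (T.formGraph β l : Set ((H₀ →L[ℂ] H₀) × (H₀ →L[ℂ] H₀))) :=
    Submodule.isClosed_topologicalClosure _
  have key : (T.crossedProduct β V).horizontalForms ≤
      (T.formGraph β l).comap (Φ : _ →ₗ[ℂ] _) := by
    refine Submodule.topologicalClosure_minimal _ (Submodule.span_le.mpr ?_)
      (hcl.preimage Φ.continuous)
    rintro _ ⟨a, ha, b', hb', rfl⟩
    obtain ⟨b₂, hb₂, rfl⟩ := (T.mem_fixedAlg_iff β V).mp hb'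
    rw [T.commutator_crossedOp β V hb₂]
    have hcl2 : IsClosed {a | Φ (a * blockOp id fun p => tens V.grading (T.d (β.act p b₂))) ∈
        T.formGraph β l} := hcl.preimage (Φ.continuous.comp (continuous_mul_const _))
    -- The left factor lies only in A; continuity of the product reduces to 𝒜, where it is a finite
    -- sum of terms bλ_n.
    refine closure_minimal ?_ hcl2 ha
    intro a ha
    change a ∈ Submodule.span ℂ _ at ha
    change Φ (a * _) ∈ T.formGraph β l
    induction ha using Submodule.span_induction with
    | mem x hx =>
      obtain ⟨b₁, -, n, rfl⟩ := hx
      have h1 := (T.isBlockOp_crossedOp β b₁ n).mul (T.isBlockOp_diag_d β V hb₂)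
      rw [isBlockOp_iff_entry] at h1
      by_cases hn : n = k
      · subst hn
        have e1 : gradedEntry V i n 0 (T.crossedOp β ι b₁ n * blockOp id fun p =>
            tens V.grading (T.d (β.act p b₂))) = T.rep (β.act n b₁) * T.d b₂ := by
          apply gradedEntry_of_entry
          rw [h1, if_pos (by simp), tens_mul, one_mul, sub_self, β.act_zero]
        have e2 : gradedEntry V i (l + n) l (T.crossedOp β ι b₁ n * blockOp id fun p =>
            tens V.grading (T.d (β.act p b₂))) =
              T.rep (β.act l (β.act n b₁)) * T.d (β.act l b₂) := by
          apply gradedEntry_of_entry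
          rw [h1, if_pos (by simp), tens_mul, one_mul, add_sub_cancel_right, β.act_add]
        change (gradedEntry V i n 0 _, gradedEntry V i (l + n) l _) ∈ _
        rw [e1, e2]
        exact mem_formGraph β l _ hb₂
      · have e1 : gradedEntry V i k 0 (T.crossedOp β ι b₁ n * blockOp id fun p =>
            tens V.grading (T.d (β.act p b₂))) = 0 := by
          apply gradedEntry_of_entry
          rw [h1, if_neg (by
            simp only [Function.comp, id, sub_eq_zero]; exact fun h => hn h.symm), tens_zero]
        have e2 : gradedEntry V i (l + k) l (T.crossedOp β ι b₁ n * blockOp id fun p =>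
            tens V.grading (T.d (β.act p b₂))) = 0 := by
          apply gradedEntry_of_entry
          rw [h1, if_neg (by
            simp only [Function.comp, id, sub_eq_iff_eq_add, add_right_inj]
            exact fun h => hn h.symm), tens_zero]
        change (gradedEntry V i k 0 _, gradedEntry V i (l + k) l _) ∈ _
        rw [e1, e2]
        exact zero_mem _
    | zero =>
      rw [zero_mul, map_zero]
      exact zero_mem _
    | add x y _ _ hx hy =>
      rw [add_mul, map_add]
      exact add_mem hx hy
    | smul c x _ hx =>
      rw [smul_mul_assoc, map_smul]
      exact Submodule.smul_mem _ c hx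
  exact key hZ

theorem norm_tens_formGraph_le {C : ℝ}
    (hC : ∀ k, ∀ x y, (x, y) ∈ T.formGraph β k → ‖y‖ ≤ C * ‖x‖) {x : H₀ →L[ℂ] H₀}
    {y : (Fin m → ℤ) → H₀ →L[ℂ] H₀} (h : ∀ p, (x, y p) ∈ T.formGraph β p) (p : Fin m → ℤ) :
    ‖tens V.grading (y p)‖ ≤ C * ‖x‖ := by
  rw [V.norm_tens_grading]
  exact hC p _ _ (h p)

/-- The diagonal operator of the orbit of a one-form is a limit of forms `∑ b [D, b']` with
`b ∈ A^G`. -/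
theorem orbit_mem_closure (hker : T.DescendsToForms β) {x : H₀ →L[ℂ] H₀} (hx : x ∈ T.oneForms)
    {y : (Fin m → ℤ) → H₀ →L[ℂ] H₀} (hy : ∀ p, (x, y p) ∈ T.formGraph β p) :
    blockOp id (fun p => tens V.grading (y p)) ∈ (Submodule.span ℂ
      {X | ∃ b₁ : B, ∃ b₂ ∈ T.smooth, X = T.crossedOp β ι b₁ 0 *
        blockOp id fun p => tens V.grading (T.d (β.act p b₂))}).topologicalClosure := by
  obtain ⟨C, hC0, hC⟩ := exists_formGraph_norm_le β hker
  -- For finite sums ∑ b [D₀, b'] the orbit is realised exactly by an operator in the span.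
  have key : ∀ x' ∈ Submodule.span ℂ {X | ∃ b₁ : B, ∃ b₂ ∈ T.smooth, X = T.rep b₁ * T.d b₂},
      ∃ y' : (Fin m → ℤ) → H₀ →L[ℂ] H₀, ∃ N ∈ Submodule.span ℂ
        {X | ∃ b₁ : B, ∃ b₂ ∈ T.smooth, X = T.crossedOp β ι b₁ 0 *
          blockOp id fun p => tens V.grading (T.d (β.act p b₂))},
        (∀ p, (x', y' p) ∈ T.formGraph β p) ∧
          IsBlockOp id (fun p => tens V.grading (y' p)) N := by
    intro x' hx'
    induction hx' using Submodule.span_induction with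
    | mem x hx =>
      obtain ⟨b₁, b₂, hb₂, rfl⟩ := hx
      refine ⟨fun p => T.rep (β.act p b₁) * T.d (β.act p b₂), _,
        Submodule.subset_span ⟨b₁, b₂, hb₂, rfl⟩, fun p => mem_formGraph β p b₁ hb₂, ?_⟩
      refine ((T.isBlockOp_crossedOp_zero β b₁).mul (T.isBlockOp_diag_d β V hb₂)).congr
        (fun _ => rfl) fun p => ?_
      rw [tens_mul, one_mul]
      rfl
    | zero =>
      refine ⟨0, 0, zero_mem _, fun p => zero_mem _, ?_⟩
      refine (isBlockOp_zero _).congr (fun _ => rfl) fun p => ?_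
      rw [Pi.zero_apply, tens_zero]
    | add x x' _ _ hx hx' =>
      obtain ⟨y, N, hN, h1, h2⟩ := hx
      obtain ⟨y', N', hN', h1', h2'⟩ := hx'
      refine ⟨y + y', N + N', add_mem hN hN', fun p => add_mem (h1 p) (h1' p), ?_⟩
      refine (h2.add h2').congr (fun _ => rfl) fun p => ?_
      rw [Pi.add_apply, tens_add]
    | smul c x _ hx =>
      obtain ⟨y, N, hN, h1, h2⟩ := hx
      refine ⟨c • y, c • N, Submodule.smul_mem _ c hN, fun p => Submodule.smul_mem _ c (h1 p), ?_⟩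
      refine (h2.smul c).congr (fun _ => rfl) fun p => ?_
      rw [Pi.smul_apply, tens_smul]
  have hY := isBlockOp_diag (T.norm_tens_formGraph_le β V hC hy)
  change _ ∈ closure _
  rw [Metric.mem_closure_iff]
  intro ε hε
  have hx2 : x ∈ closure _ := hx
  rw [Metric.mem_closure_iff] at hx2
  -- Every point of the orbit of x - x' has norm at most C‖x - x'‖, so approximation in one fibre is
  -- uniform over all fibres. The denominator is C + 1 because C may vanish.
  obtain ⟨x', hx', hd⟩ := hx2 (ε / (C + 1)) (by positivity)
  obtain ⟨y', N, hN, h1, h2⟩ := key x' hx'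
  refine ⟨N, hN, ?_⟩
  have h3 : ∀ p, (x - x', y p - y' p) ∈ T.formGraph β p := fun p => sub_mem (hy p) (h1 p)
  have h4 := (hY.sub h2).norm_le_of_diag (C := C * ‖x - x'‖) (by positivity) fun p => by
    rw [← tens_sub]
    exact T.norm_tens_formGraph_le β V hC h3 p
  rw [dist_eq_norm] at hd ⊢
  refine h4.trans_lt ?_
  calc C * ‖x - x'‖ ≤ (C + 1) * ‖x - x'‖ := by gcongr; linarith
    _ < (C + 1) * (ε / (C + 1)) := by gcongr
    _ = ε := by field_simp

/-- Multiplication by bλ_k is continuous, and it sends the generators b₁ [D, b₂] to the generators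
(b β_{-k}(b₁)) λ_k [D, b₂]. -/
theorem crossedOp_mul_orbit_mem (hker : T.DescendsToForms β) {x : H₀ →L[ℂ] H₀}
    (hx : x ∈ T.oneForms) {y : (Fin m → ℤ) → H₀ →L[ℂ] H₀}
    (hy : ∀ p, (x, y p) ∈ T.formGraph β p) (b : B) (k : Fin m → ℤ) :
    T.crossedOp β ι b k * blockOp id (fun p => tens V.grading (y p)) ∈
      (T.crossedProduct β V).horizontalForms := by
  have h := T.orbit_mem_closure β V hker hx hy
  have h2 : Continuous fun Z : TotalSpace m ι H₀ →L[ℂ] TotalSpace m ι H₀ =>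
    T.crossedOp β ι b k * Z := continuous_const_mul _
  refine map_mem_closure h2 h ?_
  intro Z hZ
  induction hZ using Submodule.span_induction with
  | mem Z hZ =>
    obtain ⟨b₁, b₂, hb₂, rfl⟩ := hZ
    refine Submodule.subset_span ⟨T.crossedOp β ι (b * β.act (-k) b₁) k,
      T.crossedOp_mem_algA β V _ k, T.crossedOp β ι b₂ 0,
      (T.mem_fixedAlg_iff β V).mpr ⟨b₂, hb₂, rfl⟩, ?_⟩
    rw [T.commutator_crossedOp β V hb₂, ← crossedOp_mul_crossedOp_zero, mul_assoc]
  | zero => rw [mul_zero]; exact zero_mem _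
  | add x y _ _ hx hy => rw [mul_add]; exact add_mem hx hy
  | smul c x _ hx => rw [mul_smul_comm]; exact Submodule.smul_mem _ c hx

end SpectralTriple

end CrossGauge
end

/-! ### Relative gauge potentials as diagonal operators. -/

noncomputable section
namespace CrossGauge
namespace SpectralTriple

variable {m r : ℕ} {ι B H₀ : Type*} [Fintype ι] [DecidableEq ι] [CStarAlgebra B]
  [NormedAddCommGroup H₀] [InnerProductSpace ℂ H₀] [CompleteSpace H₀]
  (T : SpectralTriple r B H₀) (β : EquicontinuousAction m T) (V : SpinModule m ι)

/-! ### Diagonal operators on `Dom Dv` -/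

/-- `Ω ∈ 𝐋(Dom Dv, H)` is the diagonal operator `Op(Y)`. -/
def IsDiagOnDom (Y : (Fin m → ℤ) → Fib ι H₀ →L[ℂ] Fib ι H₀)
    (Ω : GraphDom (T.verticalDirac V) →L[ℂ] TotalSpace m ι H₀) : Prop :=
  ∀ (ξ : (T.verticalDirac V).domain) (k : Fin m → ℤ),
    Ω (toGraphDom (T.verticalDirac V) ξ) k = Y k (ξ.1 k)

section Diag

variable {T V} {Y Y' : (Fin m → ℤ) → Fib ι H₀ →L[ℂ] Fib ι H₀}
  {Ω Ω' : GraphDom (T.verticalDirac V) →L[ℂ] TotalSpace m ι H₀}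

theorem IsDiagOnDom.unique (h : T.IsDiagOnDom V Y Ω) (h' : T.IsDiagOnDom V Y Ω') : Ω = Ω' := by
  ext1 g
  obtain ⟨ξ, rfl⟩ := exists_toGraphDom_eq g
  ext1
  funext k
  rw [h, h']

theorem IsDiagOnDom.congr (h : T.IsDiagOnDom V Y Ω) (hY : ∀ k, Y k = Y' k) :
    T.IsDiagOnDom V Y' Ω := fun ξ k => by rw [h, hY]

theorem IsDiagOnDom.add (h : T.IsDiagOnDom V Y Ω) (h' : T.IsDiagOnDom V Y' Ω') :
    T.IsDiagOnDom V (fun k => Y k + Y' k) (Ω + Ω') := fun ξ k => by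
  change Ω _ k + Ω' _ k = _
  rw [h, h', add_apply]

theorem IsDiagOnDom.smul (c : ℝ) (h : T.IsDiagOnDom V Y Ω) :
    T.IsDiagOnDom V (fun k => c • Y k) (c • Ω) := fun ξ k => by
  change c • Ω _ k = _
  rw [h, smul_apply]

/-- Through `graphIso`, Op(Y) becomes the block operator with entries `weight k • Y k`. So linear
growth of Y is the condition for boundedness on Dom Dv. -/
theorem exists_isDiagOnDom {R : ℝ} (hY : ∀ k, ‖Y k‖ ≤ R * growth k) :
    ∃ Ω, T.IsDiagOnDom V Y Ω ∧ ‖Ω‖ ≤ R := by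
  have hR : 0 ≤ R := by
    have := (norm_nonneg _).trans (hY 0)
    exact nonneg_of_mul_nonneg_left this (growth_pos 0)
  have hb : ∀ k, ‖(weight k : ℂ) • Y k‖ ≤ R := fun k => by
    rw [norm_smul, Complex.norm_real, Real.norm_of_nonneg (weight_pos k).le, weight_mul_le_iff]
    exact hY k
  have h1 := isBlockOp_diag hb
  refine ⟨blockOp id (fun k => (weight k : ℂ) • Y k) ∘L
    ((T.graphIso V).symm : GraphDom (T.verticalDirac V) →L[ℂ] TotalSpace m ι H₀),
    fun ξ k => ?_, ?_⟩
  · change blockOp id _ ((T.graphIso V).symm _) k = _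
    rw [h1, id, graphIso_symm_toGraphDom, smul_apply, map_smul, smul_smul, ← Complex.ofReal_mul,
      weight_mul_growth, Complex.ofReal_one, one_smul]
  · refine ContinuousLinearMap.opNorm_le_bound _ hR fun g => ?_
    change ‖blockOp id _ ((T.graphIso V).symm g)‖ ≤ _
    rw [← (T.graphIso V).symm.norm_map g]
    exact (ContinuousLinearMap.le_opNorm _ _).trans (by
      gcongr
      exact h1.norm_le_of_diag hR hb)

theorem IsDiagOnDom.norm_le {R : ℝ} (h : T.IsDiagOnDom V Y Ω)
    (hY : ∀ k, ‖Y k‖ ≤ R * growth k) : ‖Ω‖ ≤ R := by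
  obtain ⟨Ω', h', hn⟩ := exists_isDiagOnDom (T := T) (V := V) hY
  rwa [h.unique h']

theorem IsDiagOnDom.isBlockOp (h : T.IsDiagOnDom V Y Ω) :
    IsBlockOp id (fun k => (weight k : ℂ) • Y k)
      (Ω ∘L (T.graphIso V : TotalSpace m ι H₀ →L[ℂ] GraphDom (T.verticalDirac V))) := by
  intro ζ k
  change Ω (T.graphIso V ζ) k = _
  rw [graphIso_apply, h, weightOp_apply, map_smul]
  rfl

theorem IsDiagOnDom.norm_apply_le (h : T.IsDiagOnDom V Y Ω) (k : Fin m → ℤ) :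
    ‖Y k‖ ≤ ‖Ω‖ * growth k := by
  rw [← weight_mul_le_iff]
  have h1 := h.isBlockOp.norm_apply_le k
  rw [norm_smul, Complex.norm_real, Real.norm_of_nonneg (weight_pos k).le] at h1
  refine h1.trans ?_
  refine ContinuousLinearMap.opNorm_le_bound _ (norm_nonneg Ω) fun ζ => ?_
  change ‖Ω (T.graphIso V ζ)‖ ≤ _
  rw [← (T.graphIso V).norm_map ζ]
  exact Ω.le_opNorm _

theorem isDiagOnDom_of_isBlockOp {t : (Fin m → ℤ) → Fib ι H₀ →L[ℂ] Fib ι H₀}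
    (h : IsBlockOp id t
      (Ω ∘L (T.graphIso V : TotalSpace m ι H₀ →L[ℂ] GraphDom (T.verticalDirac V)))) :
    T.IsDiagOnDom V (fun k => (growth k : ℂ) • t k) Ω := by
  intro ξ k
  have h1 := h ((T.graphIso V).symm (toGraphDom _ ξ)) k
  change Ω (T.graphIso V _) k = _ at h1
  rw [LinearIsometryEquiv.apply_symm_apply, id, graphIso_symm_toGraphDom, map_smul] at h1
  exact h1

theorem IsDiagOnDom.eq_apply (h : T.IsDiagOnDom V Y Ω) (h' : T.IsDiagOnDom V Y' Ω)
    (k : Fin m → ℤ) : Y k = Y' k := by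
  have h1 := h.isBlockOp.entry_eq k
  rw [h'.isBlockOp.entry_eq k] at h1
  have hw : (weight k : ℂ) ≠ 0 := by exact_mod_cast (weight_pos k).ne'
  exact (smul_right_injective _ hw h1).symm

theorem isDiagOnDom_restrict {t : (Fin m → ℤ) → Fib ι H₀ →L[ℂ] Fib ι H₀}
    {Z : TotalSpace m ι H₀ →L[ℂ] TotalSpace m ι H₀} (h : IsBlockOp id t Z) :
    T.IsDiagOnDom V t (restrictToDom (T.verticalDirac V) Z) := fun ξ k => h ξ.1 k

end Diag

/-! ### Potential operators -/

section PotentialOp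

variable {T V} {Y : (Fin m → ℤ) → Fib ι H₀ →L[ℂ] Fib ι H₀}
  {Ω : GraphDom (T.verticalDirac V) →L[ℂ] TotalSpace m ι H₀}

theorem mem_domain_potentialOp {ξ : TotalSpace m ι H₀} :
    ξ ∈ ((T.crossedProduct β V).potentialOp Ω).domain ↔ ξ ∈ (T.totalDirac V).domain := by
  change ξ ∈ (T.crossedProduct β V).coreDom ⊓ (T.verticalDirac V).domain ↔ _
  rw [T.coreDom_eq β V]
  exact ⟨fun h => h.1, fun h => ⟨h, T.domain_totalDirac_le V h⟩⟩

theorem IsDiagOnDom.potentialOp_apply (h : T.IsDiagOnDom V Y Ω)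
    (ξ : ((T.crossedProduct β V).potentialOp Ω).domain) (k : Fin m → ℤ) :
    (T.crossedProduct β V).potentialOp Ω ξ k = Y k (ξ.1 k) :=
  h ⟨ξ.1, ξ.2.2⟩ k

variable {l : Fin m → ℤ} {t z : (Fin m → ℤ) → Fib ι H₀ →L[ℂ] Fib ι H₀}
  {S Z : TotalSpace m ι H₀ →L[ℂ] TotalSpace m ι H₀}

theorem IsDiagOnDom.isCommutator (h : T.IsDiagOnDom V Y Ω)
    (hS : IsBlockOp (fun p => p - l) t S)
    (hdom : ∀ ξ ∈ (T.totalDirac V).domain, S ξ ∈ (T.totalDirac V).domain)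
    (hZ : IsBlockOp (fun p => p - l) z Z) (hz : ∀ p, Y p * t p - t p * Y (p - l) = z p) :
    IsCommutator ((T.crossedProduct β V).potentialOp Ω) S Z := by
  intro ξ
  refine ⟨(mem_domain_potentialOp β).mpr (hdom _ ((mem_domain_potentialOp β).mp ξ.2)), ?_⟩
  ext1
  funext p
  rw [hZ, ← hz]
  refine congrArg₂ (· - ·) ((h.potentialOp_apply β _ p).trans ?_) ((hS _ p).trans ?_)
  · exact congrArg (Y p) (hS ξ.1 p)
  · exact congrArg (t p) (h.potentialOp_apply β ξ (p - l))

theorem IsDiagOnDom.commutesWith (h : T.IsDiagOnDom V Y Ω) (hS : IsBlockOp id t S)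
    (hdom : ∀ ξ ∈ (T.totalDirac V).domain, S ξ ∈ (T.totalDirac V).domain)
    (hz : ∀ p, Y p * t p = t p * Y p) :
    CommutesWith ((T.crossedProduct β V).potentialOp Ω) S := by
  refine h.isCommutator (l := 0) β (hS.congr (fun p => (sub_zero p).symm) fun _ => rfl) hdom
    (isBlockOp_zero _) fun p => ?_
  rw [sub_zero, hz, sub_self]

theorem IsDiagOnDom.anticommutesWith (h : T.IsDiagOnDom V Y Ω) (hS : IsBlockOp id t S)
    (hdom : ∀ ξ ∈ (T.totalDirac V).domain, S ξ ∈ (T.totalDirac V).domain)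
    (hz : ∀ p, Y p * t p = -(t p * Y p)) :
    AnticommutesWith ((T.crossedProduct β V).potentialOp Ω) S := by
  intro ξ
  refine ⟨(mem_domain_potentialOp β).mpr (hdom _ ((mem_domain_potentialOp β).mp ξ.2)), ?_⟩
  ext1
  funext p
  refine (h.potentialOp_apply β _ p).trans ?_
  refine (congrArg (Y p) (hS ξ.1 p)).trans ?_
  refine (congrArg (fun X : Fib ι H₀ →L[ℂ] Fib ι H₀ => X (ξ.1 p)) (hz p)).trans ?_
  exact congrArg Neg.neg ((hS _ p).trans (congrArg (t p) (h.potentialOp_apply β ξ p))).symm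

theorem IsDiagOnDom.isFormalAdjoint (h : T.IsDiagOnDom V Y Ω) (hY : ∀ p, star (Y p) = Y p) :
    ((T.crossedProduct β V).potentialOp Ω).IsFormalAdjoint
      ((T.crossedProduct β V).potentialOp Ω) := by
  intro ξ η
  rw [lp.inner_eq_tsum, lp.inner_eq_tsum]
  refine tsum_congr fun k => ?_
  rw [h.potentialOp_apply, h.potentialOp_apply]
  nth_rewrite 1 [← hY k]
  rw [ContinuousLinearMap.star_eq_adjoint, ContinuousLinearMap.adjoint_inner_left]

/-! Conversely, algebraic relations of the operator hold for its diagonal entries. -/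

/-- Tested on vectors supported at p - l with value in the domain of γ ⊗ D₀, which lie in the domain
of the potential; their values are dense in the fibre. -/
theorem IsDiagOnDom.entry_eq_of_isCommutator (h : T.IsDiagOnDom V Y Ω)
    (hS : IsBlockOp (fun p => p - l) t S)
    (hZ : IsCommutator ((T.crossedProduct β V).potentialOp Ω) S Z) (p : Fin m → ℤ) :
    entry p (p - l) Z = Y p * t p - t p * Y (p - l) := by
  refine T.clm_ext_of_domain V fun w v hw => ?_
  have hd : (lp.single 2 (p - l) w : TotalSpace m ι H₀) ∈
      ((T.crossedProduct β V).potentialOp Ω).domain :=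
    (mem_domain_potentialOp β).mpr (T.single_mem_domain_totalDirac V _ hw)
  obtain ⟨h1, h2⟩ := hZ ⟨_, hd⟩
  rw [entry_apply, ← h2]
  have hw' : (lp.single 2 (p - l) w : TotalSpace m ι H₀) (p - l) = w := lp.single_apply_self ..
  refine congrArg₂ (· - ·) ((h.potentialOp_apply β _ p).trans ?_) ((hS _ p).trans ?_)
  · exact congrArg (Y p) ((hS _ p).trans (congrArg (t p) hw'))
  · exact congrArg (t p) ((h.potentialOp_apply β ⟨_, hd⟩ (p - l)).trans (congrArg (Y (p - l)) hw'))

theorem IsDiagOnDom.comm_of_commutesWith (h : T.IsDiagOnDom V Y Ω) (hS : IsBlockOp id t S)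
    (hZ : CommutesWith ((T.crossedProduct β V).potentialOp Ω) S) (p : Fin m → ℤ) :
    Y p * t p = t p * Y p := by
  have h1 := h.entry_eq_of_isCommutator (l := 0) β
    (hS.congr (fun p => (sub_zero p).symm) fun _ => rfl) hZ p
  rw [map_zero, sub_zero] at h1
  exact sub_eq_zero.mp h1.symm

theorem IsDiagOnDom.comm_of_anticommutesWith (h : T.IsDiagOnDom V Y Ω) (hS : IsBlockOp id t S)
    (hZ : AnticommutesWith ((T.crossedProduct β V).potentialOp Ω) S) (p : Fin m → ℤ) :
    Y p * t p = -(t p * Y p) := by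
  refine T.clm_ext_of_domain V fun w v hw => ?_
  have hd : (lp.single 2 p w : TotalSpace m ι H₀) ∈
      ((T.crossedProduct β V).potentialOp Ω).domain :=
    (mem_domain_potentialOp β).mpr (T.single_mem_domain_totalDirac V _ hw)
  obtain ⟨h1, h2⟩ := hZ ⟨_, hd⟩
  have h3 := congrArg (fun η : TotalSpace m ι H₀ => η p) h2
  have hw' : (lp.single 2 p w : TotalSpace m ι H₀) p = w := lp.single_apply_self ..
  have h4 : Y p (S (lp.single 2 p w) p) = Y p (t p w) :=
    congrArg (Y p) ((hS _ p).trans (congrArg (t p) hw'))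
  have h5 := (h.potentialOp_apply β ⟨_, hd⟩ p).trans (congrArg (Y p) hw')
  refine (h4.symm.trans (h.potentialOp_apply β ⟨_, h1⟩ p).symm).trans (h3.trans ?_)
  exact congrArg Neg.neg ((hS _ p).trans (congrArg (t p) h5))

theorem IsDiagOnDom.star_eq_of_isFormalAdjoint (h : T.IsDiagOnDom V Y Ω)
    (hs : ((T.crossedProduct β V).potentialOp Ω).IsFormalAdjoint
      ((T.crossedProduct β V).potentialOp Ω)) (p : Fin m → ℤ) : star (Y p) = Y p := by
  refine T.clm_ext_of_domain V fun w v hw => ?_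
  refine Dense.eq_of_inner_left (𝕜 := ℂ) (T.dense_domain_idTensD V) fun w' hw' => ?_
  obtain ⟨v', hw'⟩ := hw'
  have hd : ∀ {w v}, (w, v) ∈ (T.idTensD V).graph → (lp.single 2 p w : TotalSpace m ι H₀) ∈
      ((T.crossedProduct β V).potentialOp Ω).domain := fun hw =>
    (mem_domain_potentialOp β).mpr (T.single_mem_domain_totalDirac V _ hw)
  have h1 := hs ⟨_, hd hw⟩ ⟨_, hd hw'⟩
  rw [lp.inner_single_left, lp.inner_single_right, h.potentialOp_apply, h.potentialOp_apply] at h1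
  simp only [lp.single_apply_self] at h1
  rw [ContinuousLinearMap.star_eq_adjoint, ContinuousLinearMap.adjoint_inner_left]
  exact h1.symm

end PotentialOp

/-! ### Diagonal operators that preserve `Dom D` -/

theorem diag_mem_domain {t : (Fin m → ℤ) → Fib ι H₀ →L[ℂ] Fib ι H₀}
    {S : TotalSpace m ι H₀ →L[ℂ] TotalSpace m ι H₀} (hS : IsBlockOp id t S) (c : ℂ)
    (h : ∀ p w v, (w, v) ∈ (T.idTensD V).graph → (t p w, c • t p v) ∈ (T.idTensD V).graph)
    {ξ : TotalSpace m ι H₀} (hξ : ξ ∈ (T.totalDirac V).domain) :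
    S ξ ∈ (T.totalDirac V).domain := by
  obtain ⟨η, hη⟩ := LinearPMap.mem_domain_iff.mp hξ
  obtain ⟨η', h1, -⟩ := exists_mem_graph_totalDirac (l := 0) (C' := 0) (c := c) (y := 0)
    (hS.congr (fun p => (sub_zero p).symm) fun _ => rfl) hS.norm_apply_le
    (fun p => by simp) (fun p w v hw => by simpa using h p w v hw) hη
  exact LinearPMap.mem_domain_of_mem_graph h1

theorem grading_mem_domain {ξ : TotalSpace m ι H₀} (hξ : ξ ∈ (T.totalDirac V).domain) :
    (T.crossedProduct β V).grading ξ ∈ (T.totalDirac V).domain :=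
  T.diag_mem_domain V (isBlockOp_const _) (-1) (fun _ _ _ hw => by
    rw [neg_one_smul]; exact T.tens_grading_mem_graph_idTensD V T.D_odd hw) hξ

theorem cliff_mem_domain (j : Fin m ⊕ Fin r) {ξ : TotalSpace m ι H₀}
    (hξ : ξ ∈ (T.totalDirac V).domain) :
    (T.crossedProduct β V).cliff j ξ ∈ (T.totalDirac V).domain := by
  rcases j with i | i
  · exact T.diag_mem_domain V (isBlockOp_const _) (-1) (fun _ _ _ hw => by
      rw [neg_one_smul]; exact T.tens_anticomm_mem_graph_idTensD V (V.e_odd i) hw) hξ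
  · exact T.diag_mem_domain V (isBlockOp_const _) (-1) (fun _ _ _ hw => by
      rw [neg_one_smul]; exact T.tens_grading_mem_graph_idTensD V (T.D_cliff i) hw) hξ

theorem vert_mem_domain (i : Fin m) {ξ : TotalSpace m ι H₀}
    (hξ : ξ ∈ (T.totalDirac V).domain) :
    (T.crossedProduct β V).vert i ξ ∈ (T.totalDirac V).domain :=
  T.diag_mem_domain V (isBlockOp_const _) (-1) (fun _ _ _ hw => by
    rw [neg_one_smul]; exact T.tens_anticomm_mem_graph_idTensD V (V.f_odd i) hw) hξ

theorem act_mem_domain (g : Fin m → UnitAddCircle) {ξ : TotalSpace m ι H₀}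
    (hξ : ξ ∈ (T.totalDirac V).domain) :
    (T.crossedProduct β V).act g ξ ∈ (T.totalDirac V).domain :=
  T.diag_mem_domain V (T.isBlockOp_act β V g) 1 (fun p _ _ hw => by
    rw [one_smul]; exact Submodule.smul_mem _ (pairing p g) hw) hξ

/-! ### Relative gauge potentials -/

section Potentials

variable {T V β}

theorem tens_grading_anticomm {X S : H₀ →L[ℂ] H₀} (h : X * S = -(S * X)) :
    tens V.grading X * tens V.grading S = -(tens V.grading S * tens V.grading X) := by
  rw [tens_mul, tens_mul, h, tens_neg]

theorem anticomm_of_tens_grading {X S : H₀ →L[ℂ] H₀}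
    (h : tens V.grading X * tens V.grading S = -(tens V.grading S * tens V.grading X)) :
    X * S = -(S * X) := by
  have := V.nonempty
  rw [tens_mul, tens_mul, ← tens_neg, V.grading_sq] at h
  exact tens_one_injective h

theorem tens_grading_comm {X S : H₀ →L[ℂ] H₀} (h : X * S = S * X) :
    tens V.grading X * tens 1 S = tens 1 S * tens V.grading X := by
  rw [tens_mul, tens_mul, h, one_mul, mul_one]

theorem comm_of_tens_grading {X S : H₀ →L[ℂ] H₀}
    (h : tens V.grading X * tens 1 S = tens 1 S * tens V.grading X) : X * S = S * X := by
  rw [tens_mul, tens_mul, one_mul, mul_one] at h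
  exact V.tens_grading_injective h

theorem star_tens_grading (X : H₀ →L[ℂ] H₀) :
    star (tens V.grading X) = tens V.grading (star X) := by
  rw [star_tens, V.grading_star]

/-- Elements of 𝒜 act boundedly on Dom Dv for the graph norm, so this condition on potentials is
automatic. -/
theorem extendsToDom_potentialOp {Ω : GraphDom (T.verticalDirac V) →L[ℂ] TotalSpace m ι H₀}
    {a : TotalSpace m ι H₀ →L[ℂ] TotalSpace m ι H₀} (ha : a ∈ (T.crossedProduct β V).alg) :
    ExtendsToDom (T.crossedProduct β V).Dv ((T.crossedProduct β V).potentialOp Ω) a := by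
  obtain ⟨Y, hY⟩ := T.alg_lift β V ha
  refine ⟨Ω ∘L Y, fun ξ hT => ?_⟩
  have hm : a ξ.1 ∈ ((T.crossedProduct β V).potentialOp Ω).domain :=
    (mem_domain_potentialOp β).mpr
      (T.alg_mem_domain β V ha ((mem_domain_potentialOp β).mp ξ.2))
  refine ⟨hm, ?_⟩
  obtain ⟨h1, h2⟩ := hY ⟨ξ.1, hT⟩
  exact (congrArg Ω h2).symm

/-- The condition with content is the one on the commutator with bλ_k. In the difference of the
entries at p and p - k the constant M cancels, and ω(p) - ω(p - k) = β_{p-k}(ω(k)), so the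
commutator is bλ_k times the diagonal operator of the orbit of ω(k). -/
theorem isRelativeGaugePotential (hker : T.DescendsToForms β)
    {Ω : GraphDom (T.verticalDirac V) →L[ℂ] TotalSpace m ι H₀}
    {ω : (Fin m → ℤ) → H₀ →L[ℂ] H₀} {M : H₀ →L[ℂ] H₀} (hω : ω ∈ T.formCocycles β)
    (hM : M ∈ T.oddCommutant) (h : T.IsDiagOnDom V (fun k => tens V.grading (ω k + M)) Ω) :
    (T.crossedProduct β V).IsRelativeGaugePotential Ω := by
  obtain ⟨C, hC0, hC⟩ := exists_formGraph_norm_le β hker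
  have hcomm : ∀ p b, (ω p + M) * T.rep b = T.rep b * (ω p + M) := fun p b => by
    rw [add_mul, mul_add, T.centralForms_comm (hω.1 p), hM.2.2.1]
  have anti : ∀ x : Matrix ι ι ℂ, x * V.grading = -(V.grading * x) → ∀ p,
      tens V.grading (ω p + M) * tens x 1 = -(tens x 1 * tens V.grading (ω p + M)) := by
    intro x hx p
    rw [tens_mul, tens_mul, one_mul, mul_one, hx, tens_neg_left, neg_neg]
  refine ⟨?_, fun j => ?_, ?_, fun g => ?_, fun i => ?_, fun a ha => ?_, fun a ha => ?_,
    fun a ha => ?_⟩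
  · refine h.anticommutesWith β (isBlockOp_const _)
      (fun ξ hξ => T.grading_mem_domain β V hξ) fun p => tens_grading_anticomm ?_
    rw [add_mul, mul_add, T.centralForms_odd (hω.1 p), hM.2.1, neg_add]
  · rcases j with i | i
    · exact h.anticommutesWith β (isBlockOp_const _)
        (fun ξ hξ => T.cliff_mem_domain β V (Sum.inl i) hξ) (anti _ (V.e_odd i))
    · refine h.anticommutesWith β (isBlockOp_const _)
        (fun ξ hξ => T.cliff_mem_domain β V (Sum.inr i) hξ) fun p => tens_grading_anticomm ?_
      rw [add_mul, mul_add, T.oneForms_cliff (hω.1 p).1, hM.2.2.2, neg_add]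
  · refine h.isFormalAdjoint β fun p => ?_
    rw [star_tens_grading, star_add, (hω.1 p).2.1, hM.1]
  · refine h.commutesWith β (T.isBlockOp_act β V g)
      (fun ξ hξ => T.act_mem_domain β V g hξ) fun p => ?_
    ext1 w
    simp
  · exact h.anticommutesWith β (isBlockOp_const _)
      (fun ξ hξ => T.vert_mem_domain β V i hξ) (anti _ (V.f_odd i))
  · obtain ⟨b, hb, rfl⟩ := (T.mem_fixedAlg_iff β V).mp ha
    exact h.commutesWith β (T.isBlockOp_crossedOp_zero β b)
      (fun ξ hξ => T.alg_mem_domain β V ha.1 hξ) fun p => tens_grading_comm (hcomm p _)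
  · change a ∈ Submodule.span ℂ _ at ha
    induction ha using Submodule.span_induction with
    | mem x hx =>
      obtain ⟨b, hb, k, rfl⟩ := hx
      have hy : ∀ q, (ω k, ω (q + k) - ω q) ∈ T.formGraph β q := fun q => hω.2 q k
      refine ⟨_, T.crossedOp_mul_orbit_mem β V hker (hω.1 k).1 hy b k, ?_⟩
      refine h.isCommutator β (T.isBlockOp_crossedOp β b k)
        (fun ξ hξ => T.alg_mem_domain β V (T.crossedOp_mem_alg β V hb k) hξ)
        ((T.isBlockOp_crossedOp β b k).mul
          (isBlockOp_diag (T.norm_tens_formGraph_le β V hC hy))) fun p => ?_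
      rw [tens_grading_comm (hcomm p _), ← mul_sub, ← tens_sub, add_sub_add_right_eq_sub,
        sub_add_cancel]
    | zero =>
      exact ⟨0, zero_mem _, fun ξ => ⟨zero_mem _, by
        change (T.crossedProduct β V).potentialOp Ω 0 - 0 = 0
        rw [LinearPMap.map_zero, sub_zero]⟩⟩
    | add x y _ _ hx hy =>
      obtain ⟨X, hX, hX'⟩ := hx
      obtain ⟨Y, hY, hY'⟩ := hy
      exact ⟨X + Y, add_mem hX hY, hX'.add hY'⟩
    | smul c x _ hx =>
      obtain ⟨X, hX, hX'⟩ := hx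
      exact ⟨c • X, Submodule.smul_mem _ c hX, hX'.smul c⟩
  · exact extendsToDom_potentialOp ha

theorem exists_isDiagOnDom_of_invariant
    {Ω : GraphDom (T.verticalDirac V) →L[ℂ] TotalSpace m ι H₀}
    (h : ∀ g, CommutesWith ((T.crossedProduct β V).potentialOp Ω) ((T.crossedProduct β V).act g)) :
    ∃ Y, T.IsDiagOnDom V Y Ω := by
  refine ⟨_, isDiagOnDom_of_isBlockOp (T.isBlockOp_of_invariant β V fun g => ?_)⟩
  refine T.ext_of_single V fun p w v hw => ?_
  have hU := T.isBlockOp_act β V g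
  have hd : (lp.single 2 p w : TotalSpace m ι H₀) ∈
      ((T.crossedProduct β V).potentialOp Ω).domain :=
    (mem_domain_potentialOp β).mpr (T.single_mem_domain_totalDirac V _ hw)
  obtain ⟨h1, h2⟩ := h g ⟨_, hd⟩
  have h3 : Ω (toGraphDom _ ⟨(T.crossedProduct β V).act g (lp.single 2 p w), h1.2⟩) =
      (T.crossedProduct β V).act g (Ω (toGraphDom _ ⟨lp.single 2 p w, hd.2⟩)) :=
    sub_eq_zero.mp h2
  -- On vectors supported at `p`, `graphIso` is multiplication by the scalar `weight p`; this
  -- carries invariance over from the potential.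
  have key : ∀ (ζ : TotalSpace m ι H₀) (hζ : ζ ∈ (T.verticalDirac V).domain),
      ζ = lp.single 2 p (ζ p) → Ω (T.graphIso V ζ) =
        (weight p : ℂ) • Ω (toGraphDom _ ⟨ζ, hζ⟩) := by
    intro ζ hζ he
    rw [graphIso_apply, ← map_smul, ← map_smul]
    congr 2
    apply Subtype.ext
    change weightOp m ι H₀ ζ = (weight p : ℂ) • ζ
    rw [he, weightOp_single, lp.single_smul]
  change Ω (T.graphIso V ((T.crossedProduct β V).act g _)) =
    (T.crossedProduct β V).act g (Ω (T.graphIso V _))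
  rw [key _ h1.2 (by rw [hU.apply_single, lp.single_apply_self]),
    key _ hd.2 (by rw [lp.single_apply_self]), h3, map_smul]

/-- After invariance and Schur's lemma the potential is Op(γ ⊗ X). The pair is ω = X - X(0), M =
X(0): commutators see only differences of X, and a cocycle must vanish at 0. -/
theorem exists_of_isRelativeGaugePotential
    {Ω : GraphDom (T.verticalDirac V) →L[ℂ] TotalSpace m ι H₀}
    (h : (T.crossedProduct β V).IsRelativeGaugePotential Ω) :
    ∃ ω ∈ T.formCocycles β, ∃ M ∈ T.oddCommutant,
      T.IsDiagOnDom V (fun k => tens V.grading (ω k + M)) Ω := by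
  obtain ⟨Y, hY⟩ := exists_isDiagOnDom_of_invariant h.invariant
  have hX : ∀ p, ∃ X : H₀ →L[ℂ] H₀, Y p = tens V.grading X := fun p =>
    V.exists_eq_tens_grading (Y p)
      (fun i => hY.comm_of_anticommutesWith β (isBlockOp_const _) (h.cliff (Sum.inl i)) p)
      (fun i => hY.comm_of_anticommutesWith β (isBlockOp_const _) (h.vert i) p)
  choose X hX using hX
  replace hY := hY.congr hX
  have hodd : ∀ p, X p * T.grading = -(T.grading * X p) := fun p =>
    anticomm_of_tens_grading (V := V)
      (hY.comm_of_anticommutesWith β (isBlockOp_const _) h.odd p)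
  have hcliff : ∀ p i, X p * T.cliff i = -(T.cliff i * X p) := fun p i =>
    anticomm_of_tens_grading (V := V)
      (hY.comm_of_anticommutesWith β (isBlockOp_const _) (h.cliff (Sum.inr i)) p)
  have hstar : ∀ p, star (X p) = X p := fun p => by
    have := hY.star_eq_of_isFormalAdjoint β h.symm p
    rw [star_tens_grading] at this
    exact V.tens_grading_injective this
  -- In the fibre over p the element β_{-p}(b) acts as b, so every X(p) commutes with all of 𝓑.
  have hsm : ∀ p, ∀ b ∈ T.smooth, X p * T.rep b = T.rep b * X p := fun p b hb => by
    have h1 := h.fixedAlg _ ((T.mem_fixedAlg_iff β V).mpr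
      ⟨β.act (-p) b, β.act_smooth _ _ hb, rfl⟩)
    have h2 := hY.comm_of_commutesWith β (T.isBlockOp_crossedOp_zero β _) h1 p
    rw [β.act_act_neg] at h2
    exact comm_of_tens_grading (V := V) h2
  obtain ⟨i⟩ := V.nonempty
  -- The commutator with λ_k has entries X(p) - X(p - k); comparing (k, 0) with (l + k, l) gives the
  -- cocycle identity.
  have hform : ∀ k l, (X k - X 0, X (l + k) - X l) ∈ T.formGraph β l := by
    intro k l
    obtain ⟨Z, hZ, hZ'⟩ := h.comm _ (T.crossedOp_mem_alg β V (one_mem _) k)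
    have e : ∀ p, gradedEntry V i p (p - k) Z = X p - X (p - k) := fun p => by
      apply gradedEntry_of_entry
      rw [hY.entry_eq_of_isCommutator β (T.isBlockOp_crossedOp β 1 k) hZ', map_one, map_one,
        tens_one_one, mul_one, one_mul, tens_sub]
    have h1 := T.mem_formGraph_of_mem_horizontalForms β V hZ i k l
    have e1 := e k
    have e2 := e (l + k)
    rw [sub_self] at e1
    rw [add_sub_cancel_right] at e2
    rwa [e1, e2] at h1
  refine ⟨fun k => X k - X 0, ⟨fun k => ⟨formGraph_fst_mem β (hform k 0), ?_, fun b hb => ?_⟩,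
    fun k l => ?_⟩, X 0, ⟨hstar 0, hodd 0, T.commute_of_smooth (hsm 0), hcliff 0⟩, ?_⟩
  · rw [star_sub, hstar, hstar]
  · rw [sub_mul, mul_sub, hsm k b hb, hsm 0 b hb]
  · rw [sub_sub_sub_cancel_right]
    exact hform l k
  · exact hY.congr fun k => by rw [sub_add_cancel]

end Potentials

end SpectralTriple

end CrossGauge
end

/-! ### The space of potentials and its quotient by remainders. -/

noncomputable section
namespace CrossGauge
namespace SpectralTriple

variable {m r : ℕ} {ι B H₀ : Type*} [Fintype ι] [DecidableEq ι] [CStarAlgebra B]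
  [NormedAddCommGroup H₀] [InnerProductSpace ℂ H₀] [CompleteSpace H₀]
  {T : SpectralTriple r B H₀} {β : EquicontinuousAction m T} {V : SpinModule m ι}

/-! ### The isomorphism of `Z¹ × 𝔯` with the space of potentials -/

theorem norm_cocycle_le_cocycleNorm {ω : (Fin m → ℤ) → H₀ →L[ℂ] H₀}
    (h : BddAbove (Set.range fun k => weight k * ‖ω k‖)) (k : Fin m → ℤ) :
    ‖ω k‖ ≤ cocycleNorm ω * growth k :=
  weight_mul_le_iff.mp (le_ciSup h k)

theorem norm_tens_add_le {ω : (Fin m → ℤ) → H₀ →L[ℂ] H₀}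
    (h : BddAbove (Set.range fun k => weight k * ‖ω k‖)) (M : H₀ →L[ℂ] H₀) (k : Fin m → ℤ) :
    ‖tens V.grading (ω k + M)‖ ≤ (cocycleNorm ω + ‖M‖) * growth k := by
  rw [V.norm_tens_grading, add_mul]
  exact (norm_add_le _ _).trans (add_le_add (norm_cocycle_le_cocycleNorm h k)
    (le_mul_of_one_le_right (norm_nonneg _) (one_le_growth k)))

/-- The operators Op(γ ⊗ (ω + M)) are closed under real linear combinations, so passing to the span
in `potentials` adds nothing. -/
theorem mem_potentials_iff (hker : T.DescendsToForms β)
    {Ω : GraphDom (T.verticalDirac V) →L[ℂ] TotalSpace m ι H₀} :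
    Ω ∈ (T.crossedProduct β V).potentials ↔
      (T.crossedProduct β V).IsRelativeGaugePotential Ω := by
  refine ⟨fun h => ?_, fun h => Submodule.subset_span h⟩
  have key : ∃ ω ∈ T.formCocycles β, ∃ M ∈ T.oddCommutant,
      T.IsDiagOnDom V (fun k => tens V.grading (ω k + M)) Ω := by
    change Ω ∈ Submodule.span ℝ {ω | (T.crossedProduct β V).IsRelativeGaugePotential ω} at h
    induction h using Submodule.span_induction with
    | mem x hx => exact exists_of_isRelativeGaugePotential hx
    | zero =>
      refine ⟨0, zero_mem _, 0, zero_mem _, fun ξ k => ?_⟩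
      have e : tens V.grading ((0 : (Fin m → ℤ) → H₀ →L[ℂ] H₀) k + 0) = 0 := by
        rw [Pi.zero_apply, add_zero, tens_zero]
      exact (congrArg (fun X : Fib ι H₀ →L[ℂ] Fib ι H₀ => X (ξ.1 k)) e).symm
    | add x y _ _ hx hy =>
      obtain ⟨ω, hω, M, hM, h⟩ := hx
      obtain ⟨ω', hω', M', hM', h'⟩ := hy
      refine ⟨ω + ω', add_mem hω hω', M + M', add_mem hM hM', (h.add h').congr fun k => ?_⟩
      rw [← tens_add, add_add_add_comm]
      rfl
    | smul c x _ hx =>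
      obtain ⟨ω, hω, M, hM, h⟩ := hx
      refine ⟨c • ω, Submodule.smul_mem _ c hω, c • M, Submodule.smul_mem _ c hM,
        (h.smul c).congr fun k => ?_⟩
      rw [Pi.smul_apply, ← smul_add, ← Complex.coe_smul c (ω k + M), tens_smul]
      rfl
  obtain ⟨ω, hω, M, hM, h'⟩ := key
  exact isRelativeGaugePotential hker hω hM h'

theorem IsDiagOnDom.sub_const {Ω : GraphDom (T.verticalDirac V) →L[ℂ] TotalSpace m ι H₀}
    {X X' : (Fin m → ℤ) → H₀ →L[ℂ] H₀} (h : T.IsDiagOnDom V (fun k => tens V.grading (X k)) Ω)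
    (h' : T.IsDiagOnDom V (fun k => tens V.grading (X' k)) Ω) (k : Fin m → ℤ) : X k = X' k :=
  V.tens_grading_injective (h.eq_apply h' k)

theorem exists_potentialEquiv (V : SpinModule m ι) (hker : T.DescendsToForms β) :
    ∃ F : (T.formCocycles β × T.oddCommutant) ≃ₗ[ℝ] (T.crossedProduct β V).potentials,
      ∀ p, T.IsDiagOnDom V (fun k => tens V.grading (p.1.1 k + p.2.1)) (F p).1 := by
  have hex : ∀ p : T.formCocycles β × T.oddCommutant, ∃ Ω,
      T.IsDiagOnDom V (fun k => tens V.grading (p.1.1 k + p.2.1)) Ω := fun p => by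
    obtain ⟨Ω, hΩ, -⟩ := exists_isDiagOnDom (T := T) (V := V)
      (norm_tens_add_le (V := V) (bddAbove_cocycle hker p.1.2) p.2.1)
    exact ⟨Ω, hΩ⟩
  choose F hF using hex
  let L : (T.formCocycles β × T.oddCommutant) →ₗ[ℝ] (T.crossedProduct β V).potentials :=
    { toFun := fun p => ⟨F p, (mem_potentials_iff hker).mpr
        (isRelativeGaugePotential hker p.1.2 p.2.2 (hF p))⟩
      map_add' := fun p p' => Subtype.ext <| (hF _).unique <|
        ((hF p).add (hF p')).congr fun k => by
          rw [← tens_add, add_add_add_comm]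
          rfl
      map_smul' := fun c p => Subtype.ext <| (hF _).unique <|
        ((hF p).smul c).congr fun k => by
          change _ = tens V.grading (c • p.1.1 k + c • p.2.1)
          rw [← smul_add, ← Complex.coe_smul c (p.1.1 k + p.2.1), tens_smul]
          rfl }
  refine ⟨LinearEquiv.ofBijective L ⟨fun p p' h => ?_, fun Ω => ?_⟩, hF⟩
  · have h1 : F p = F p' := congrArg Subtype.val h
    have h2 := hF p
    rw [h1] at h2
    have h3 := h2.sub_const (hF p')
    -- Cocycles vanish at 0, so the fibre over 0 recovers M.
    have h4 : p.2.1 = p'.2.1 := by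
      have := h3 0
      rwa [formCocycles_zero p.1.2, formCocycles_zero p'.1.2, zero_add, zero_add] at this
    refine Prod.ext (Subtype.ext (funext fun k => ?_)) (Subtype.ext h4)
    have := h3 k
    rw [h4] at this
    exact add_right_cancel this
  · obtain ⟨ω, hω, M, hM, h⟩ :=
      exists_of_isRelativeGaugePotential ((mem_potentials_iff hker).mp Ω.2)
    exact ⟨(⟨ω, hω⟩, ⟨M, hM⟩), Subtype.ext ((hF (⟨ω, hω⟩, ⟨M, hM⟩)).unique h)⟩

section Norms

variable {Ω : GraphDom (T.verticalDirac V) →L[ℂ] TotalSpace m ι H₀}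
  {ω : (Fin m → ℤ) → H₀ →L[ℂ] H₀} {M : H₀ →L[ℂ] H₀}

theorem growth_zero : growth (0 : Fin m → ℤ) = 1 := by
  rw [← inv_inv (growth 0), ← weight_eq, weight_zero, inv_one]

theorem IsDiagOnDom.norm_const_le (h : T.IsDiagOnDom V (fun k => tens V.grading (ω k + M)) Ω)
    (h0 : ω 0 = 0) : ‖M‖ ≤ ‖Ω‖ := by
  have := h.norm_apply_le 0
  rwa [V.norm_tens_grading, h0, zero_add, growth_zero, mul_one] at this

theorem IsDiagOnDom.norm_cocycle_le (h : T.IsDiagOnDom V (fun k => tens V.grading (ω k + M)) Ω)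
    (h0 : ω 0 = 0) (k : Fin m → ℤ) : weight k * ‖ω k‖ ≤ 2 * ‖Ω‖ := by
  rw [weight_mul_le_iff]
  have h1 := h.norm_apply_le k
  rw [V.norm_tens_grading] at h1
  have h2 := h.norm_const_le h0
  have h3 : ‖ω k‖ ≤ ‖ω k + M‖ + ‖M‖ := by
    have := norm_sub_le (ω k + M) M
    rwa [add_sub_cancel_right] at this
  nlinarith [one_le_growth k, norm_nonneg Ω]

/-- The fibre over 0 bounds M by ‖Ω‖, and subtracting M bounds the weighted ω by 2‖Ω‖; together
3‖Ω‖. -/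
theorem IsDiagOnDom.cocycleNorm_add_le
    (h : T.IsDiagOnDom V (fun k => tens V.grading (ω k + M)) Ω) (h0 : ω 0 = 0) :
    cocycleNorm ω + ‖M‖ ≤ 3 * ‖Ω‖ := by
  have h1 : cocycleNorm ω ≤ 2 * ‖Ω‖ := ciSup_le (h.norm_cocycle_le h0)
  linarith [h.norm_const_le h0]

end Norms

/-- A bounded cocycle needs no weights: Op is then a bounded operator on H. This covers coboundaries
and the constants M, the two things that vanish in the quotient. -/
theorem mem_map_remainders {Ω : GraphDom (T.verticalDirac V) →L[ℂ] TotalSpace m ι H₀}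
    {ω : (Fin m → ℤ) → H₀ →L[ℂ] H₀} {M : H₀ →L[ℂ] H₀} {R : ℝ} (hω : ω ∈ T.formCocycles β)
    (hR : ∀ k, ‖ω k‖ ≤ R) (hM : M ∈ T.oddCommutant)
    (h : T.IsDiagOnDom V (fun k => tens V.grading (ω k + M)) Ω) :
    Ω ∈ (T.crossedProduct β V).remainders.map
      (restrictToDom (T.crossedProduct β V).Dv) := by
  have hb : ∀ k, ‖tens V.grading (ω k + M)‖ ≤ R + ‖M‖ := fun k => by
    rw [V.norm_tens_grading]
    exact (norm_add_le _ _).trans (by gcongr; exact hR k)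
  have hZ := isBlockOp_diag hb
  have hcomm : ∀ p b, (ω p + M) * T.rep b = T.rep b * (ω p + M) := fun p b => by
    rw [add_mul, mul_add, T.centralForms_comm (hω.1 p), hM.2.2.1]
  have anti : ∀ x : Matrix ι ι ℂ, x * V.grading = -(V.grading * x) → ∀ p,
      tens V.grading (ω p + M) * tens x 1 = -(tens x 1 * tens V.grading (ω p + M)) := by
    intro x hx p
    rw [tens_mul, tens_mul, one_mul, mul_one, hx, tens_neg_left, neg_neg]
  have anti' : ∀ {t : Fib ι H₀ →L[ℂ] Fib ι H₀},
      (∀ p, tens V.grading (ω p + M) * t = -(t * tens V.grading (ω p + M))) →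
      blockOp id (fun p => tens V.grading (ω p + M)) * blockOp id (fun _ => t) =
        -(blockOp id (fun _ => t) * blockOp id (fun p => tens V.grading (ω p + M))) :=
    fun {t} ht => (hZ.mul (isBlockOp_const t)).unique
      (((isBlockOp_const t).mul hZ).neg.congr (fun _ => rfl) fun p => (ht p).symm)
  refine ⟨blockOp id fun p => tens V.grading (ω p + M), ⟨?_, fun j => ?_, ?_, fun g => ?_,
    fun i => ?_, fun a ha => ?_⟩, (isDiagOnDom_restrict hZ).unique h⟩
  · refine anti' fun p => tens_grading_anticomm ?_
    rw [add_mul, mul_add, T.centralForms_odd (hω.1 p), hM.2.1, neg_add]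
  · rcases j with i | i
    · exact anti' (anti _ (V.e_odd i))
    · refine anti' fun p => tens_grading_anticomm ?_
      rw [add_mul, mul_add, T.oneForms_cliff (hω.1 p).1, hM.2.2.2, neg_add]
  · refine (hZ.star hb).unique (hZ.congr (fun _ => rfl) fun p => ?_)
    rw [star_tens_grading, star_add, (hω.1 p).2.1, hM.1]
  · exact IsBlockOp.comm_act T β V hZ g
  · exact anti' (anti _ (V.f_odd i))
  · obtain ⟨b, hb, rfl⟩ := (T.mem_fixedAlg_iff β V).mp ha
    have hb := T.isBlockOp_crossedOp_zero β (ι := ι) b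
    refine (hZ.mul hb).unique ((hb.mul hZ).congr (fun _ => rfl) fun p => ?_)
    exact (tens_grading_comm (hcomm p _)).symm

theorem exists_quotient_map (hker : T.DescendsToForms β)
    (F : (T.formCocycles β × T.oddCommutant) ≃ₗ[ℝ] (T.crossedProduct β V).potentials)
    (hF : ∀ p, T.IsDiagOnDom V (fun k => tens V.grading (p.1.1 k + p.2.1)) (F p).1) :
    ∃ q : (T.formCocycles β ⧸ T.formCoboundaries β) →ₗ[ℝ]
        ((T.crossedProduct β V).potentials ⧸ (T.crossedProduct β V).boundedPotentials),
      Function.Surjective q ∧ ∀ (ω : T.formCocycles β) (M : T.oddCommutant),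
        q (Submodule.Quotient.mk ω) = Submodule.Quotient.mk (F (ω, M)) := by
  obtain ⟨C, hC0, hC⟩ := exists_formGraph_norm_le β hker
  have h1 : T.formCoboundaries β ≤ (T.crossedProduct β V).boundedPotentials.comap
      (F.toLinearMap ∘ₗ LinearMap.inl ℝ _ _) := by
    rintro ω ⟨x, hx, h⟩
    -- ‖β_k(x) - x‖ ≤ C‖x‖ + ‖x‖, uniformly in k.
    refine mem_map_remainders (R := C * ‖x‖ + ‖x‖) ω.2 (fun k => ?_) (zero_mem _) (hF (ω, 0))
    have h2 := hC k _ _ (h k)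
    have h3 := norm_sub_le (ω.1 k + x) x
    rw [add_sub_cancel_right] at h3
    linarith
  have hq : ∀ (ω : T.formCocycles β) (M : T.oddCommutant),
      (T.formCoboundaries β).mapQ (T.crossedProduct β V).boundedPotentials
        (F.toLinearMap ∘ₗ LinearMap.inl ℝ _ _) h1 (Submodule.Quotient.mk ω) =
        Submodule.Quotient.mk (F (ω, M)) := by
    intro ω M
    rw [Submodule.mapQ_apply, Submodule.Quotient.eq]
    -- Changing M alters the potential by a bounded one, so the class depends on ω only; with
    -- surjectivity of `F` this also makes the induced map surjective.
    have e : (F.toLinearMap ∘ₗ LinearMap.inl ℝ (T.formCocycles β) T.oddCommutant) ω - F (ω, M) =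
        F (0, -M) := by
      change F (ω, 0) - F (ω, M) = _
      rw [← map_sub, Prod.mk_sub_mk, sub_self, zero_sub]
    rw [e]
    exact mem_map_remainders (R := 0) (zero_mem _) (fun k => by simp) (neg_mem M.2) (hF (0, -M))
  refine ⟨_, fun y => ?_, hq⟩
  obtain ⟨Ω, rfl⟩ := Submodule.Quotient.mk_surjective _ y
  obtain ⟨⟨ω, M⟩, rfl⟩ := F.surjective Ω
  exact ⟨Submodule.Quotient.mk ω, hq ω M⟩

end SpectralTriple

end CrossGauge
end

/-! ### Gauge transformations defined by pairs (υ, w). -/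

noncomputable section
namespace CrossGauge
namespace SpectralTriple

variable {m r : ℕ} {ι B H₀ : Type*} [Fintype ι] [DecidableEq ι] [CStarAlgebra B]
  [NormedAddCommGroup H₀] [InnerProductSpace ℂ H₀] [CompleteSpace H₀]
  {T : SpectralTriple r B H₀} {β : EquicontinuousAction m T} {V : SpinModule m ι}

/-! ### Commutators of `D` with diagonal operators -/

section DiagCommutator

variable {u X : (Fin m → ℤ) → H₀ →L[ℂ] H₀} {S : TotalSpace m ι H₀ →L[ℂ] TotalSpace m ι H₀}

theorem fibSymbol_tens_one (k : Fin m → ℤ) (A : H₀ →L[ℂ] H₀) (w : Fib ι H₀) :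
    fibSymbol V H₀ k (tens 1 A w) = tens 1 A (fibSymbol V H₀ k w) := by
  rw [fibSymbol, ← mul_apply_eq_comp, ← mul_apply_eq_comp, tens_mul, tens_mul]
  simp

/-- s(k) ⊗ 1 commutes with 1 ⊗ u(k), so the vertical part of D drops out of the commutator. -/
theorem totalDirac_sub_apply (hS : IsBlockOp id (fun k => tens (1 : Matrix ι ι ℂ) (u k)) S)
    (hX : ∀ k, IsCommutator T.D (u k) (X k)) {ξ : TotalSpace m ι H₀}
    (hξ : ξ ∈ (T.totalDirac V).domain) (hSξ : S ξ ∈ (T.totalDirac V).domain) (k : Fin m → ℤ) :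
    (T.totalDirac V ⟨S ξ, hSξ⟩ - S (T.totalDirac V ⟨ξ, hξ⟩)) k = tens V.grading (X k) (ξ k) := by
  have h1 := T.totalDirac_apply_mem V ⟨ξ, hξ⟩ k
  have h2 := T.totalDirac_apply_mem V ⟨S ξ, hSξ⟩ k
  have h3 := T.tens_one_mem_graph_idTensD V (hX k) h1
  have e1 : S ξ k = tens 1 (u k) (ξ k) := hS ξ k
  have e2 : S (T.totalDirac V ⟨ξ, hξ⟩) k = tens 1 (u k) (T.totalDirac V ⟨ξ, hξ⟩ k) := hS _ k
  have h4 := LinearPMap.mem_graph_snd_inj _ h2 h3 e1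
  change T.totalDirac V ⟨S ξ, hSξ⟩ k - S (T.totalDirac V ⟨ξ, hξ⟩) k = _
  rw [e2]
  change _ - fibSymbol V H₀ k (S ξ k) = _ at h4
  rw [e1, fibSymbol_tens_one, map_sub] at h4
  change _ = tens 1 (u k) (T.totalDirac V ⟨ξ, hξ⟩ k) - tens 1 (u k) (fibSymbol V H₀ k (ξ k)) + _ at h4
  rw [sub_eq_iff_eq_add] at h4 ⊢
  rw [h4]
  abel

theorem mem_domain_of_isCommutator {C R : ℝ}
    (hS : IsBlockOp id (fun k => tens (1 : Matrix ι ι ℂ) (u k)) S)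
    (hu : ∀ k, ‖tens (1 : Matrix ι ι ℂ) (u k)‖ ≤ C)
    (hX : ∀ k, IsCommutator T.D (u k) (X k)) (hR : ∀ k, ‖X k‖ ≤ R * growth k)
    {ξ : TotalSpace m ι H₀} (hξ : ξ ∈ (T.totalDirac V).domain) :
    S ξ ∈ (T.totalDirac V).domain := by
  obtain ⟨η, hη⟩ := LinearPMap.mem_domain_iff.mp hξ
  obtain ⟨η', h1, -⟩ := exists_mem_graph_totalDirac (l := 0) (C' := R) (c := 1)
    (y := fun k => tens V.grading (X k))
    (hS.congr (fun p => (sub_zero p).symm) fun _ => rfl) hu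
    (fun p => by rw [V.norm_tens_grading]; exact hR p)
    (fun p w v hw => by rw [one_smul]; exact T.tens_one_mem_graph_idTensD V (hX p) hw) hη
  exact LinearPMap.mem_domain_of_mem_graph h1

theorem mem_domain_gaugeComm (hdom : ∀ ξ ∈ (T.totalDirac V).domain, S ξ ∈ (T.totalDirac V).domain)
    {ξ : TotalSpace m ι H₀} :
    ξ ∈ ((T.crossedProduct β V).gaugeComm S).domain ↔ ξ ∈ (T.totalDirac V).domain := by
  change ξ ∈ (T.crossedProduct β V).coreDom ⊓ ((T.totalDirac V).domain ⊓
    (T.totalDirac V).domain.comap (S : TotalSpace m ι H₀ →ₗ[ℂ] TotalSpace m ι H₀)) ↔ _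
  rw [T.coreDom_eq β V]
  exact ⟨fun h => h.1, fun h => ⟨h, h, hdom ξ h⟩⟩

theorem gaugeComm_apply (hS : IsBlockOp id (fun k => tens (1 : Matrix ι ι ℂ) (u k)) S)
    (hX : ∀ k, IsCommutator T.D (u k) (X k))
    (ξ : ((T.crossedProduct β V).gaugeComm S).domain) (k : Fin m → ℤ) :
    (T.crossedProduct β V).gaugeComm S ξ k = tens V.grading (X k) (ξ.1 k) :=
  totalDirac_sub_apply hS hX ξ.2.2.1 ξ.2.2.2 k

/-- This lets the rules for diagonal operators on Dom Dv be applied to [D, S], which need not itself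
be a gauge potential. -/
theorem gaugeComm_eq_potentialOp (hS : IsBlockOp id (fun k => tens (1 : Matrix ι ι ℂ) (u k)) S)
    (hX : ∀ k, IsCommutator T.D (u k) (X k))
    (hdom : ∀ ξ ∈ (T.totalDirac V).domain, S ξ ∈ (T.totalDirac V).domain)
    {Ω : GraphDom (T.verticalDirac V) →L[ℂ] TotalSpace m ι H₀}
    (hΩ : T.IsDiagOnDom V (fun k => tens V.grading (X k)) Ω) :
    (T.crossedProduct β V).gaugeComm S = (T.crossedProduct β V).potentialOp Ω := by
  refine LinearPMap.ext (Submodule.ext fun ξ => ?_) fun ξ h1 h2 => ?_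
  · rw [mem_domain_gaugeComm hdom, mem_domain_potentialOp]
  · ext1
    funext k
    exact (gaugeComm_apply hS hX ⟨ξ, h1⟩ k).trans (hΩ.potentialOp_apply β ⟨ξ, h2⟩ k).symm

end DiagCommutator

/-! ### The gauge transformation of a pair `(υ, w)` -/

section Gauge

variable {υ : (Fin m → ℤ) → unitary B} {w : unitary (H₀ →L[ℂ] H₀)}
  {S : TotalSpace m ι H₀ →L[ℂ] TotalSpace m ι H₀}

theorem norm_le_one_of_star_mul {E : Type*} [NormedAddCommGroup E] [InnerProductSpace ℂ E]
    [CompleteSpace E] {X : E →L[ℂ] E} (h : star X * X = 1) : ‖X‖ ≤ 1 := by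
  have h1 : ‖X‖ * ‖X‖ ≤ 1 := by
    rw [← CStarRing.norm_star_mul_self, h]
    exact ContinuousLinearMap.norm_id_le
  nlinarith [norm_nonneg X]

theorem norm_tens_one_gauge_le (w : unitary (H₀ →L[ℂ] H₀)) (u : unitary B) :
    ‖tens (1 : Matrix ι ι ℂ) ((w : H₀ →L[ℂ] H₀) * T.rep u)‖ ≤ 1 := by
  refine norm_le_one_of_star_mul ?_
  rw [star_tens, tens_mul, star_one, one_mul, gauge_star_mul, tens_one_one]

theorem norm_tens_one_star_gauge_le (w : unitary (H₀ →L[ℂ] H₀)) (u : unitary B) :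
    ‖tens (1 : Matrix ι ι ℂ) (star ((w : H₀ →L[ℂ] H₀) * T.rep u))‖ ≤ 1 := by
  have h := T.norm_tens_one_gauge_le (ι := ι) w u
  rwa [← norm_star, star_tens, star_one] at h

/-- `S = Op(id ⊗̂ w υ)`. -/
def IsGaugeOp (T : SpectralTriple r B H₀) (υ : (Fin m → ℤ) → unitary B)
    (w : unitary (H₀ →L[ℂ] H₀)) (S : TotalSpace m ι H₀ →L[ℂ] TotalSpace m ι H₀) : Prop :=
  IsBlockOp id (fun k => tens (1 : Matrix ι ι ℂ) ((w : H₀ →L[ℂ] H₀) * T.rep (υ k : B))) S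

theorem IsGaugeOp.star_isBlockOp (h : T.IsGaugeOp υ w S) :
    IsBlockOp id (fun k => tens (1 : Matrix ι ι ℂ)
      (star ((w : H₀ →L[ℂ] H₀) * T.rep (υ k : B)))) (star S) := by
  have h1 := IsBlockOp.star (C := 1)
    (t := fun k => tens (1 : Matrix ι ι ℂ) ((w : H₀ →L[ℂ] H₀) * T.rep (υ k : B)))
    (fun k => norm_tens_one_gauge_le w (υ k)) h
  refine h1.congr (fun _ => rfl) fun k => ?_
  rw [star_tens, star_one]

/-- w' commutes with B, so the factors of the two pairs can be interchanged and the pairs multiply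
componentwise. -/
theorem gauge_mul {w' : unitary (H₀ →L[ℂ] H₀)}
    (hw' : w' ∈ T.constantGauge) (u u' : unitary B) :
    ((w * w' : unitary (H₀ →L[ℂ] H₀)) : H₀ →L[ℂ] H₀) * T.rep ((u * u' : unitary B) : B) =
      ((w : H₀ →L[ℂ] H₀) * T.rep u) * ((w' : H₀ →L[ℂ] H₀) * T.rep u') := by
  rw [Submonoid.coe_mul, Submonoid.coe_mul, map_mul, mul_assoc, mul_assoc,
    ← mul_assoc (w' : H₀ →L[ℂ] H₀), constantGauge_comm hw', mul_assoc]

theorem exists_gaugeHom (T : SpectralTriple r B H₀) (β : EquicontinuousAction m T) (ι : Type*)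
    [Fintype ι] [DecidableEq ι] :
    ∃ U : (T.unitaryCocycles β × T.constantGauge) →*
        unitary (TotalSpace m ι H₀ →L[ℂ] TotalSpace m ι H₀),
      ∀ p, T.IsGaugeOp p.1.1 p.2.1 (U p).1 := by
  have h : ∀ p : T.unitaryCocycles β × T.constantGauge,
      T.IsGaugeOp p.1.1 p.2.1 (blockOp id fun k => tens (1 : Matrix ι ι ℂ)
        ((p.2.1 : H₀ →L[ℂ] H₀) * T.rep (p.1.1 k : B))) := fun p =>
    isBlockOp_diag fun k => T.norm_tens_one_gauge_le p.2.1 (p.1.1 k)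
  refine ⟨⟨⟨fun p => ⟨blockOp id fun k => tens (1 : Matrix ι ι ℂ)
        ((p.2.1 : H₀ →L[ℂ] H₀) * T.rep (p.1.1 k : B)), Unitary.mem_iff.mpr ⟨?_, ?_⟩⟩, Subtype.ext ?_⟩,
    fun p p' => Subtype.ext ?_⟩, h⟩
  · refine ((h p).star_isBlockOp.mul (h p)).unique (isBlockOp_one.congr (fun _ => rfl) fun k => ?_)
    rw [tens_mul, one_mul, id, gauge_star_mul, tens_one_one]
  · refine ((h p).mul (h p).star_isBlockOp).unique (isBlockOp_one.congr (fun _ => rfl) fun k => ?_)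
    rw [tens_mul, one_mul, id, gauge_mul_star, tens_one_one]
  · refine (h 1).unique (isBlockOp_one.congr (fun _ => rfl) fun k => ?_)
    change 1 = tens 1 ((1 : H₀ →L[ℂ] H₀) * T.rep (1 : B))
    rw [map_one, one_mul, tens_one_one]
  · refine (h (p * p')).unique (((h p).mul (h p')).congr (fun _ => rfl) fun k => ?_)
    rw [tens_mul, one_mul]
    exact congrArg _ (gauge_mul p'.2.2 (p.1.1 k) (p'.1.1 k)).symm

theorem IsGaugeOp.ext_pair [Nonempty ι] (hυ : υ ∈ T.unitaryCocycles β)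
    {υ' : (Fin m → ℤ) → unitary B} (hυ' : υ' ∈ T.unitaryCocycles β)
    {w' : unitary (H₀ →L[ℂ] H₀)} (h : T.IsGaugeOp υ w S) (h' : T.IsGaugeOp υ' w' S) :
    υ = υ' ∧ w = w' := by
  have key : ∀ k, (w : H₀ →L[ℂ] H₀) * T.rep (υ k : B) = (w' : H₀ →L[ℂ] H₀) * T.rep (υ' k : B) :=
    fun k => tens_one_injective ((h.entry_eq k).symm.trans (h'.entry_eq k))
  -- υ(0) = 1 for unitary cocycles, so the fibre over 0 of the operator is w.
  have hw : w = w' := by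
    have := key 0
    rw [unitaryCocycles_zero hυ, unitaryCocycles_zero hυ'] at this
    simpa using this
  refine ⟨funext fun k => Subtype.ext (T.rep_injective ?_), hw⟩
  have := congrArg (fun X => star (w : H₀ →L[ℂ] H₀) * X) (key k)
  rwa [← hw, ← mul_assoc, ← mul_assoc, Unitary.coe_star_mul_self, one_mul, one_mul] at this

theorem exists_norm_log_add_const_le (hker : T.DescendsToForms β)
    (hinv : T.CentralFormsInvariant β) (hυ : υ ∈ T.unitaryCocycles β) (M : H₀ →L[ℂ] H₀) :
    ∃ R : ℝ, ∀ k, ‖T.logForm (υ k : B) + M‖ ≤ R * growth k := by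
  obtain ⟨R, hR⟩ := exists_norm_cocycle_le hker (logDeriv_mem hinv hυ)
  refine ⟨R + ‖M‖, fun k => (norm_add_le _ _).trans ?_⟩
  rw [add_mul]
  exact add_le_add (hR k) (le_mul_of_one_le_right (norm_nonneg _) (one_le_growth k))

theorem norm_gauge_le (w : unitary (H₀ →L[ℂ] H₀)) (u : unitary B) :
    ‖(w : H₀ →L[ℂ] H₀) * T.rep u‖ ≤ 1 := norm_le_one_of_star_mul (gauge_star_mul w u)

theorem norm_star_gauge_le (w : unitary (H₀ →L[ℂ] H₀)) (u : unitary B) :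
    ‖star ((w : H₀ →L[ℂ] H₀) * T.rep u)‖ ≤ 1 := by
  rw [norm_star]
  exact norm_gauge_le w u

/-- [D₀, wυ(k)] need not be bounded in k, but it grows at most linearly, as υ [D₀, υ*] is a cocycle;
the vertical part of the graph norm absorbs this growth. -/
theorem IsGaugeOp.mem_domain (hker : T.DescendsToForms β)
    (hinv : T.CentralFormsInvariant β) (hυ : υ ∈ T.unitaryCocycles β) (hw : w ∈ T.constantGauge)
    (h : T.IsGaugeOp υ w S) {ξ : TotalSpace m ι H₀} (hξ : ξ ∈ (T.totalDirac V).domain) :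
    S ξ ∈ (T.totalDirac V).domain := by
  obtain ⟨R, hR⟩ := exists_norm_log_add_const_le hker hinv hυ (T.constForm (w : H₀ →L[ℂ] H₀))
  refine mem_domain_of_isCommutator h (fun k => T.norm_tens_one_gauge_le w (υ k))
    (fun k => isCommutator_gauge hw (hυ.1 k)) (R := R) (fun k => ?_) hξ
  rw [norm_neg]
  refine (norm_mul_le _ _).trans ((mul_le_of_le_one_right (norm_nonneg _) ?_).trans (hR k))
  exact norm_gauge_le w (υ k)

theorem IsGaugeOp.star_mem_domain (hker : T.DescendsToForms β)
    (hinv : T.CentralFormsInvariant β) (hυ : υ ∈ T.unitaryCocycles β) (hw : w ∈ T.constantGauge)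
    (h : T.IsGaugeOp υ w S) {ξ : TotalSpace m ι H₀} (hξ : ξ ∈ (T.totalDirac V).domain) :
    star S ξ ∈ (T.totalDirac V).domain := by
  obtain ⟨R, hR⟩ := exists_norm_log_add_const_le hker hinv hυ (T.constForm (w : H₀ →L[ℂ] H₀))
  refine mem_domain_of_isCommutator h.star_isBlockOp
    (fun k => T.norm_tens_one_star_gauge_le w (υ k))
    (fun k => isCommutator_gauge_star hw (hυ.1 k)) (R := R) (fun k => ?_) hξ
  refine (norm_mul_le _ _).trans ((mul_le_of_le_one_left (norm_nonneg _) ?_).trans (hR k))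
  exact norm_star_gauge_le w (υ k)

/-- `S D S* - D = Op(id ⊗̂ (υ [D₀, υ*] + w [D₀, w*]))`. -/
theorem IsGaugeOp.conj_totalDirac_apply (hυ : υ ∈ T.unitaryCocycles β) (hw : w ∈ T.constantGauge)
    (h : T.IsGaugeOp υ w S) {ξ : TotalSpace m ι H₀} (hξ : ξ ∈ (T.totalDirac V).domain)
    (hSξ : star S ξ ∈ (T.totalDirac V).domain) (k : Fin m → ℤ) :
    (S (T.totalDirac V ⟨star S ξ, hSξ⟩) - T.totalDirac V ⟨ξ, hξ⟩) k =
      tens V.grading (T.logForm (υ k : B) + T.constForm (w : H₀ →L[ℂ] H₀)) (ξ k) := by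
  have h1 := totalDirac_sub_apply h.star_isBlockOp
    (fun k => isCommutator_gauge_star hw (hυ.1 k)) hξ hSξ k
  have h2 : S (T.totalDirac V ⟨star S ξ, hSξ⟩) - T.totalDirac V ⟨ξ, hξ⟩ =
      S (T.totalDirac V ⟨star S ξ, hSξ⟩ - star S (T.totalDirac V ⟨ξ, hξ⟩)) := by
    have h3 : S (star S (T.totalDirac V ⟨ξ, hξ⟩)) = T.totalDirac V ⟨ξ, hξ⟩ := by
      have h4 : S * star S = 1 := by
        refine (h.mul h.star_isBlockOp).unique (isBlockOp_one.congr (fun _ => rfl) fun k => ?_)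
        rw [tens_mul, one_mul, id, gauge_mul_star, tens_one_one]
      rw [← mul_apply_eq_comp, h4, one_apply_eq_self]
    rw [map_sub, h3]
  rw [h2, h, id, h1, ← mul_apply_eq_comp, tens_mul, one_mul, ← mul_assoc, gauge_mul_star, one_mul]

theorem IsGaugeOp.gaugeShift_eq (hker : T.DescendsToForms β)
    (hinv : T.CentralFormsInvariant β) (hυ : υ ∈ T.unitaryCocycles β) (hw : w ∈ T.constantGauge)
    (h : T.IsGaugeOp υ w S) {Ω : GraphDom (T.verticalDirac V) →L[ℂ] TotalSpace m ι H₀}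
    (hΩ : T.IsDiagOnDom V
      (fun k => tens V.grading (T.logForm (υ k : B) + T.constForm (w : H₀ →L[ℂ] H₀))) Ω) :
    (T.crossedProduct β V).gaugeShift S = Ω := by
  have hshift : (T.crossedProduct β V).IsGaugeShift S Ω := fun ξ _ hD hv => by
    have hm : star S ξ ∈ (T.totalDirac V).domain := h.star_mem_domain hker hinv hυ hw hD
    refine ⟨hm, ?_⟩
    ext1
    funext k
    exact (h.conj_totalDirac_apply hυ hw hD hm k).trans (hΩ ⟨ξ, hv⟩ k).symm
  have hex : ∃ Y, (T.crossedProduct β V).IsGaugeShift S Y := ⟨Ω, hshift⟩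
  unfold GaugeData.gaugeShift
  rw [dif_pos hex]
  refine T.graphDom_ext V fun ξ hξ hv => ?_
  have hc : ξ ∈ (T.crossedProduct β V).coreDom := by rwa [T.coreDom_eq β V]
  obtain ⟨_, h1⟩ := hex.choose_spec ξ hc hξ hv
  obtain ⟨_, h2⟩ := hshift ξ hc hξ hv
  exact h1.symm.trans h2

theorem conj_mul_eq {R : Type*} [Monoid R] {a a' u u' y : R} (hu : u * y = y * u)
    (ha : a * y = y * a) (ha' : a * a' = 1) (hu' : u * u' = 1) :
    a * (u * y) * (u' * a') = y := by
  calc a * (u * y) * (u' * a') = a * y * (u * u') * a' := by rw [hu]; simp only [mul_assoc]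
    _ = y := by rw [hu', mul_one, ha, mul_assoc, ha', mul_one]

/-- S bλ_k S* = β_{-k}(υ(k)) b λ_k. At p the identity υ(p) = υ(p - k) β_{p-k}(υ(k)) is inserted;
then w and υ(p - k) commute with what lies between them and their adjoints, and cancel. -/
theorem IsGaugeOp.conj_mem_alg (hυ : υ ∈ T.unitaryCocycles β) (hw : w ∈ T.constantGauge)
    (h : T.IsGaugeOp υ w S) {a : TotalSpace m ι H₀ →L[ℂ] TotalSpace m ι H₀}
    (ha : a ∈ (T.crossedProduct β V).alg) : S * a * star S ∈ (T.crossedProduct β V).alg := by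
  change a ∈ Submodule.span ℂ _ at ha
  induction ha using Submodule.span_induction with
  | mem x hx =>
    obtain ⟨b, hb, k, rfl⟩ := hx
    have e : S * T.crossedOp β ι b k * star S =
        T.crossedOp β ι (β.act (-k) (υ k : B) * b) k := by
      refine ((IsBlockOp.mul h (T.isBlockOp_crossedOp β b k)).mul h.star_isBlockOp).unique
        ((T.isBlockOp_crossedOp β _ k).congr (fun _ => rfl) fun p => ?_)
      have hp : (υ p : B) = (υ (p - k) : B) * β.act (p - k) (υ k : B) := by
        rw [← hυ.2, sub_add_cancel]
      have hpk : β.act p (β.act (-k) (υ k : B)) = β.act (p - k) (υ k : B) := by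
        rw [← β.act_add, sub_eq_add_neg]
      simp only [tens_mul, one_mul, id, Function.comp]
      congr 1
      rw [map_mul, hpk, hp, map_mul, star_mul, ← map_star, mul_assoc (w : H₀ →L[ℂ] H₀),
        map_mul T.rep (υ (p - k) : B), mul_assoc (T.rep (υ (p - k) : B)),
        ← map_mul T.rep (β.act (p - k) (υ k : B))]
      exact (conj_mul_eq (centralUnitaries_comm (hυ.1 (p - k)) _) (constantGauge_comm hw _)
        (unitary_mul_star w) (rep_mul_rep_star (υ (p - k)))).symm
    rw [e]
    exact T.crossedOp_mem_alg β V (mul_mem (β.act_smooth _ _ (hυ.1 k).1) hb) k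
  | zero => rw [mul_zero, zero_mul]; exact zero_mem _
  | add x y _ _ hx hy => rw [mul_add, add_mul]; exact add_mem hx hy
  | smul c x _ hx => rw [mul_smul_comm, smul_mul_assoc]; exact Submodule.smul_mem _ c hx

end Gauge

end SpectralTriple

end CrossGauge
end

/-! ### Identification of the gauge group. -/

noncomputable section
namespace CrossGauge
namespace SpectralTriple

variable {m r : ℕ} {ι B H₀ : Type*} [Fintype ι] [DecidableEq ι] [CStarAlgebra B]
  [NormedAddCommGroup H₀] [InnerProductSpace ℂ H₀] [CompleteSpace H₀]
  {T : SpectralTriple r B H₀} {β : EquicontinuousAction m T} {V : SpinModule m ι}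

/-! ### The gauge group -/

section Forward

variable {υ : (Fin m → ℤ) → unitary B} {w : unitary (H₀ →L[ℂ] H₀)}

/-- The operator S* belongs to the inverse pair; knowing this gives the inclusion 𝒜 ⊆ S𝒜S* from the
same computation as the other inclusion. -/
theorem IsGaugeOp.isGaugeTransformation (hker : T.DescendsToForms β)
    (hinv : T.CentralFormsInvariant β) (hυ : υ ∈ T.unitaryCocycles β) (hw : w ∈ T.constantGauge)
    {S : unitary (TotalSpace m ι H₀ →L[ℂ] TotalSpace m ι H₀)}
    (h : T.IsGaugeOp υ w (S : TotalSpace m ι H₀ →L[ℂ] TotalSpace m ι H₀))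
    (h' : T.IsGaugeOp υ⁻¹ w⁻¹ (star S : TotalSpace m ι H₀ →L[ℂ] TotalSpace m ι H₀)) :
    (T.crossedProduct β V).IsGaugeTransformation S := by
  have hdom : ∀ ξ ∈ (T.totalDirac V).domain, S.1 ξ ∈ (T.totalDirac V).domain :=
    fun ξ hξ => h.mem_domain hker hinv hυ hw hξ
  have hS : IsBlockOp id (fun k => tens (1 : Matrix ι ι ℂ)
    ((w : H₀ →L[ℂ] H₀) * T.rep (υ k : B))) S.1 := h
  obtain ⟨R, hR⟩ := exists_norm_log_add_const_le hker hinv hυ (T.constForm (w : H₀ →L[ℂ] H₀))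
  have hX := fun k => isCommutator_gauge hw (hυ.1 k)
  obtain ⟨Ω, hΩ, -⟩ := exists_isDiagOnDom (T := T) (V := V) (R := R)
    (Y := fun k => tens V.grading (-((T.logForm (υ k : B) + T.constForm (w : H₀ →L[ℂ] H₀)) *
      ((w : H₀ →L[ℂ] H₀) * T.rep (υ k : B))))) fun k => by
    rw [V.norm_tens_grading, norm_neg]
    refine (norm_mul_le _ _).trans ((mul_le_of_le_one_right (norm_nonneg _) ?_).trans (hR k))
    exact norm_gauge_le w (υ k)
  have hgc := gaugeComm_eq_potentialOp (β := β) hS hX hdom hΩ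
  have comm : ∀ {t : Fib ι H₀ →L[ℂ] Fib ι H₀},
      (∀ k, tens (1 : Matrix ι ι ℂ) ((w : H₀ →L[ℂ] H₀) * T.rep (υ k : B)) * t =
        t * tens 1 ((w : H₀ →L[ℂ] H₀) * T.rep (υ k : B))) →
      S.1 * blockOp id (fun _ => t) = blockOp id (fun _ => t) * S.1 := fun {t} ht =>
    (hS.mul (isBlockOp_const t)).unique
      (((isBlockOp_const t).mul hS).congr (fun _ => rfl) fun p => (ht p).symm)
  have hx : ∀ (x : Matrix ι ι ℂ) (A : H₀ →L[ℂ] H₀), tens 1 A * tens x 1 = tens x 1 * tens 1 A :=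
    fun x A => by rw [tens_mul, tens_mul, one_mul, mul_one, one_mul, mul_one]
  refine ⟨?_, fun j => ?_, fun i => ?_, fun g => ?_, fun a ha => ?_, ?_, ?_, fun a ha => ?_,
    fun i => ?_, fun a ha => ?_⟩
  · refine comm fun k => ?_
    rw [tens_mul, tens_mul, one_mul, mul_one, gauge_even hw]
  · rcases j with i | i
    · exact comm fun k => hx _ _
    · refine comm fun k => ?_
      rw [tens_mul, tens_mul, one_mul, mul_one, gauge_cliff hw]
  · exact comm fun k => hx _ _
  · exact IsBlockOp.comm_act T β V hS g
  · obtain ⟨b, rfl⟩ := (T.mem_fixedA_iff β V).mp ha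
    have hb := T.isBlockOp_crossedOp_zero β (ι := ι) b
    refine (hS.mul hb).unique ((hb.mul hS).congr (fun _ => rfl) fun p => ?_)
    rw [tens_mul, tens_mul]
    exact congrArg _ (gauge_comm hw (hυ.1 p) _).symm
  · refine Set.Subset.antisymm ?_ fun a ha => ?_
    · rintro _ ⟨a, ha, rfl⟩
      exact h.conj_mem_alg hυ hw ha
    · refine ⟨star S.1 * a * S.1, ?_, ?_⟩
      · have h1 := h'.conj_mem_alg (V := V) (inv_mem hυ) (inv_mem hw) ha
        rwa [star_star] at h1
      · change S.1 * (star S.1 * a * S.1) * star S.1 = a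
        rw [mul_assoc, mul_assoc, mul_assoc, unitary_mul_star, mul_one, ← mul_assoc,
          unitary_mul_star, one_mul]
  · rw [T.coreDom_eq β V]
    refine le_antisymm ?_ fun ξ hξ => ?_
    · rintro _ ⟨ξ, hξ, rfl⟩
      exact hdom ξ hξ
    · refine ⟨star S.1 ξ, h.star_mem_domain hker hinv hυ hw hξ, ?_⟩
      change (S.1 * star S.1) ξ = ξ
      rw [unitary_mul_star, one_apply_eq_self]
  · rw [hgc]
    exact extendsToDom_potentialOp ha
  · rw [hgc]
    refine hΩ.anticommutesWith β (isBlockOp_const _)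
      (fun ξ hξ => T.vert_mem_domain β V i hξ) fun p => ?_
    rw [tens_mul, tens_mul, one_mul, mul_one, V.f_odd, tens_neg_left, neg_neg]
  · rw [hgc]
    obtain ⟨b, hb, rfl⟩ := (T.mem_fixedAlg_iff β V).mp ha
    refine hΩ.commutesWith β (T.isBlockOp_crossedOp_zero β b)
      (fun ξ hξ => T.alg_mem_domain β V ha.1 hξ) fun p => tens_grading_comm ?_
    have h1 : (T.logForm (υ p : B) + T.constForm (w : H₀ →L[ℂ] H₀)) * T.rep (β.act p b) =
        T.rep (β.act p b) * (T.logForm (υ p : B) + T.constForm (w : H₀ →L[ℂ] H₀)) := by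
      rw [add_mul, mul_add, T.centralForms_comm (logForm_mem_centralForms (hυ.1 p)),
        (constForm_mem hw).2.2.1]
    rw [neg_mul, mul_neg, mul_assoc, gauge_comm hw (hυ.1 p), ← mul_assoc, h1, mul_assoc]

end Forward

section Converse

/-- Testing on vectors whose only nonzero coordinate is the i-th brings a commutator relation on V ⊗
H₀ down to H₀. -/
theorem isCommutator_of_idTensD (i : ι) {u : H₀ →L[ℂ] H₀} {Y : Fib ι H₀ →L[ℂ] Fib ι H₀}
    (h : ∀ w v, (w, v) ∈ (T.idTensD V).graph →
      (tens 1 u w, tens 1 u v + Y w) ∈ (T.idTensD V).graph) :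
    IsCommutator T.D u (fibEntry i i (fibGrading V H₀ * Y)) := by
  intro x
  have h1 : ((WithLp.toLp 2 (Pi.single i x.1) : Fib ι H₀),
      fibGrading V H₀ (WithLp.toLp 2 (Pi.single i (T.D x)))) ∈ (T.idTensD V).graph := by
    rw [mem_graph_idTensD]
    intro j
    rw [fibGrading_fibGrading]
    change ((Pi.single i x.1 : ι → H₀) j, (Pi.single i (T.D x) : ι → H₀) j) ∈ T.D.graph
    by_cases hj : j = i
    · subst hj
      rw [Pi.single_eq_same, Pi.single_eq_same]
      exact T.D.mem_graph x
    · rw [Pi.single_eq_of_ne hj, Pi.single_eq_of_ne hj]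
      exact zero_mem _
  have h2 := (T.mem_graph_idTensD V).mp (h _ _ h1) i
  have e : fibGrading V H₀ (tens 1 u (fibGrading V H₀ (WithLp.toLp 2 (Pi.single i (T.D x)))) +
      Y (WithLp.toLp 2 (Pi.single i x.1))) i =
        u (T.D x) + fibEntry i i (fibGrading V H₀ * Y) x.1 := by
    rw [map_add, fibEntry_apply]
    have e1 : fibGrading V H₀ (tens 1 u (fibGrading V H₀ (WithLp.toLp 2 (Pi.single i (T.D x))))) =
        tens 1 u (WithLp.toLp 2 (Pi.single i (T.D x))) := by
      rw [← mul_apply_eq_comp, ← mul_apply_eq_comp, tens_mul, tens_mul, one_mul, mul_one, mul_one,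
        V.grading_sq]
    rw [e1]
    change tens 1 u (WithLp.toLp 2 (Pi.single i (T.D x))) i + _ = _
    rw [tens_one_apply]
    change u ((Pi.single i (T.D x) : ι → H₀) i) + _ = _
    rw [Pi.single_eq_same]
    rfl
  rw [e, tens_one_apply] at h2
  change (u ((Pi.single i x.1 : ι → H₀) i), _) ∈ T.D.graph at h2
  rw [Pi.single_eq_same] at h2
  have hm := LinearPMap.mem_domain_of_mem_graph h2
  refine ⟨hm, ?_⟩
  rw [LinearPMap.mem_graph_snd_inj _ (T.D.mem_graph ⟨_, hm⟩) h2 rfl, add_sub_cancel_left]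

variable {S : unitary (TotalSpace m ι H₀ →L[ℂ] TotalSpace m ι H₀)}

/-- As 1 ∈ 𝒜, the operator [D, S] itself is bounded for the graph norm of Dv. On vectors supported
at p that norm is a multiple of the norm of H, so each fibre commutator is bounded. -/
theorem exists_isCommutator_of_isGaugeTransformation
    (h : (T.crossedProduct β V).IsGaugeTransformation S) {u : (Fin m → ℤ) → H₀ →L[ℂ] H₀}
    (hu : IsBlockOp id (fun k => tens (1 : Matrix ι ι ℂ) (u k)) S.1) (p : Fin m → ℤ) :
    ∃ X, IsCommutator T.D (u p) X := by
  have hdom : ∀ ξ ∈ (T.totalDirac V).domain, S.1 ξ ∈ (T.totalDirac V).domain := fun ξ hξ => by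
    have h1 := h.coreDom
    rw [T.coreDom_eq β V] at h1
    rw [← h1]
    exact ⟨ξ, hξ, rfl⟩
  obtain ⟨Y, hY⟩ := h.bdd 1 (T.one_mem_alg β V)
  obtain ⟨i⟩ := V.nonempty
  let Z : TotalSpace m ι H₀ →L[ℂ] TotalSpace m ι H₀ :=
    Y ∘L (T.graphIso V : TotalSpace m ι H₀ →L[ℂ] GraphDom (T.verticalDirac V))
  -- The factor `growth p` undoes the weight that `graphIso` introduces in the fibre over `p`.
  refine ⟨_, isCommutator_of_idTensD (V := V) i (Y := (growth p : ℂ) • entry p p Z)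
    fun w v hw => ?_⟩
  have hξ := T.single_mem_domain_totalDirac V p hw
  have hD : T.totalDirac V ⟨_, hξ⟩ = lp.single 2 p (fibSymbol V H₀ p w + v) :=
    LinearPMap.mem_graph_snd_inj _ ((T.totalDirac V).mem_graph ⟨_, hξ⟩)
      (T.single_mem_graph_totalDirac V p hw) rfl
  have hv := T.domain_totalDirac_le V hξ
  obtain ⟨_, h2⟩ := hY ⟨_, (mem_domain_gaugeComm (β := β) hdom).mpr hξ⟩ hv
  have h3 : T.totalDirac V ⟨_, hdom _ hξ⟩ - S.1 (T.totalDirac V ⟨_, hξ⟩) =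
      Y (toGraphDom (T.verticalDirac V) ⟨_, hv⟩) := h2
  have h4 : (growth p : ℂ) • entry p p Z w = Y (toGraphDom (T.verticalDirac V) ⟨_, hv⟩) p := by
    rw [← map_smul, entry_apply]
    have e : (⟨weightOp m ι H₀ (lp.single 2 p ((growth p : ℂ) • w)),
        T.weightOp_mem_domain V _⟩ : (T.verticalDirac V).domain) = ⟨lp.single 2 p w, hv⟩ := by
      apply Subtype.ext
      change weightOp m ι H₀ _ = lp.single 2 p w
      rw [weightOp_single, smul_smul, ← Complex.ofReal_mul, weight_mul_growth, Complex.ofReal_one,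
        one_smul]
    exact congrArg (fun ζ => Y (toGraphDom (T.verticalDirac V) ζ) p) e
  have h5 := T.totalDirac_apply_mem V ⟨_, hdom _ hξ⟩ p
  have hw' : (lp.single 2 p w : TotalSpace m ι H₀) p = w := lp.single_apply_self ..
  have e1 : S.1 (lp.single 2 p w) p = tens 1 (u p) w := (hu _ p).trans (congrArg _ hw')
  change (S.1 (lp.single 2 p w) p, _ - fibSymbol V H₀ p (S.1 (lp.single 2 p w) p)) ∈ _ at h5
  rw [e1] at h5
  rw [smul_apply, h4, ← h3]
  convert h5 using 2
  change _ + (T.totalDirac V ⟨_, hdom _ hξ⟩ p - S.1 (T.totalDirac V ⟨_, hξ⟩) p) = _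
  have e2 : S.1 (T.totalDirac V ⟨_, hξ⟩) p =
      tens 1 (u p) (fibSymbol V H₀ p w) + tens 1 (u p) v := by
    rw [hD, ← map_add]
    exact (hu _ p).trans (congrArg _ (lp.single_apply_self ..))
  rw [e2, fibSymbol_tens_one]
  abel

/-- S = Op(1 ⊗ u) by invariance and Schur's lemma. Membership of S λ_k S* in 𝒜 gives b_k ∈ 𝓑 with
u(p) u(p - k)* = β_p(b_k) for all p. The value at p = k defines υ(k) = u(k) u(0)*, and w = u(0). -/
theorem exists_isGaugeOp_of_isGaugeTransformation
    (h : (T.crossedProduct β V).IsGaugeTransformation S) :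
    ∃ υ ∈ T.unitaryCocycles β, ∃ w ∈ T.constantGauge, T.IsGaugeOp υ w S.1 := by
  have := V.nonempty
  have hB := T.isBlockOp_of_invariant β V h.invariant
  have hcomm : ∀ {t : Fib ι H₀ →L[ℂ] Fib ι H₀},
      S.1 * blockOp id (fun _ => t) = blockOp id (fun _ => t) * S.1 → ∀ p,
        entry p p S.1 * t = t * entry p p S.1 := fun {t} ht p => by
    have h1 := (hB.mul (isBlockOp_const t)).entry_eq p
    rw [ht] at h1
    exact h1.symm.trans (((isBlockOp_const t).mul hB).entry_eq p)
  have hu : ∀ p, ∃ u : H₀ →L[ℂ] H₀, entry p p S.1 = tens 1 u := fun p =>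
    V.exists_eq_tens_one _ (fun i => hcomm (h.cliff (Sum.inl i)) p) (fun i => hcomm (h.vert i) p)
  choose u hu using hu
  replace hB := hB.congr (fun _ => rfl) hu
  have hg : ∀ {S' : H₀ →L[ℂ] H₀} {p}, tens (1 : Matrix ι ι ℂ) (u p) * tens V.grading S' =
      tens V.grading S' * tens 1 (u p) → u p * S' = S' * u p := fun h => by
    rw [tens_mul, tens_mul, one_mul, mul_one] at h
    exact V.tens_grading_injective h
  have heven : ∀ p, u p * T.grading = T.grading * u p := fun p => hg (by
    rw [← hu]; exact hcomm h.even p)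
  have hcliff : ∀ p i, u p * T.cliff i = T.cliff i * u p := fun p i => hg (by
    rw [← hu]; exact hcomm (h.cliff (Sum.inr i)) p)
  have hrep : ∀ p b, u p * T.rep b = T.rep b * u p := fun p b => by
    have h1 := h.fixedA _ ((T.mem_fixedA_iff β V).mpr ⟨β.act (-p) b, rfl⟩)
    have hb := T.isBlockOp_crossedOp_zero β (ι := ι) (β.act (-p) b)
    have h2 := (hB.mul hb).entry_eq p
    rw [h1] at h2
    have h3 := h2.symm.trans ((hb.mul hB).entry_eq p)
    rw [tens_mul, tens_mul, id, β.act_act_neg, mul_one] at h3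
    exact tens_one_injective h3
  have hBs : IsBlockOp id (fun k => tens (1 : Matrix ι ι ℂ) (star (u k))) (star S.1) :=
    (IsBlockOp.star hB.norm_apply_le hB).congr (fun _ => rfl) fun k => by
      rw [star_tens, star_one]
  have hmul : ∀ p, u p * star (u p) = 1 := fun p => by
    have h1 := (hB.mul hBs).entry_eq p
    rw [unitary_mul_star] at h1
    have h2 := h1.symm.trans (isBlockOp_one.entry_eq p)
    rw [tens_mul, ← tens_one_one, one_mul] at h2
    exact tens_one_injective h2
  have hmul' : ∀ p, star (u p) * u p = 1 := fun p => by
    have h1 := (hBs.mul hB).entry_eq p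
    rw [Unitary.coe_star_mul_self] at h1
    have h2 := h1.symm.trans (isBlockOp_one.entry_eq p)
    rw [tens_mul, ← tens_one_one, one_mul] at h2
    exact tens_one_injective h2
  have hrep' : ∀ p b, star (u p) * T.rep b = T.rep b * star (u p) := fun p b => by
    have := congrArg star (hrep p (star b))
    rw [star_mul, star_mul, map_star, star_star] at this
    exact this.symm
  choose X hX using exists_isCommutator_of_isGaugeTransformation h hB
  have hXrep : ∀ p, ∀ b ∈ T.smooth, X p * T.rep b = T.rep b * X p := fun p b hb => by
    have hb' := β.act_smooth (-p) b hb
    have h1 := h.comm_fixedAlg _ ((T.mem_fixedAlg_iff β V).mpr ⟨_, hb', rfl⟩)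
    have hc := T.isBlockOp_crossedOp_zero β (ι := ι) (β.act (-p) b)
    have hdom : ∀ ξ ∈ (T.totalDirac V).domain, S.1 ξ ∈ (T.totalDirac V).domain := fun ξ hξ => by
      have h1 := h.coreDom
      rw [T.coreDom_eq β V] at h1
      rw [← h1]
      exact ⟨ξ, hξ, rfl⟩
    refine comm_of_tens_grading (V := V) (T.clm_ext_of_domain V fun w v hw => ?_)
    have hξ := (mem_domain_gaugeComm (β := β) hdom).mpr (T.single_mem_domain_totalDirac V p hw)
    obtain ⟨h2, h3⟩ := h1 ⟨_, hξ⟩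
    have h4 := congrArg (fun η : TotalSpace m ι H₀ => η p) (sub_eq_zero.mp h3)
    have hw' : (lp.single 2 p w : TotalSpace m ι H₀) p = w := lp.single_apply_self ..
    have e1 : T.crossedOp β ι (β.act (-p) b) 0 (lp.single 2 p w) p = tens 1 (T.rep b) w := by
      have := hc (lp.single 2 p w) p
      beta_reduce at this
      rw [β.act_act_neg] at this
      exact this.trans (congrArg _ hw')
    have e2 := (gaugeComm_apply hB hX ⟨_, h2⟩ p).trans (congrArg (tens V.grading (X p)) e1)
    have e3 := (gaugeComm_apply hB hX ⟨_, hξ⟩ p).trans (congrArg (tens V.grading (X p)) hw')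
    have e4 := hc ((T.crossedProduct β V).gaugeComm S.1 ⟨_, hξ⟩) p
    beta_reduce at e4
    rw [β.act_act_neg] at e4
    exact e2.symm.trans (h4.trans (e4.trans (congrArg _ e3)))
  have halg : ∀ k, ∃ b ∈ T.smooth, ∀ p, u p * star (u (p - k)) = T.rep (β.act p b) := fun k => by
    have h1 : S.1 * T.crossedOp β ι 1 k * star S.1 ∈ (T.crossedProduct β V).alg := by
      have h2 : S.1 * T.crossedOp β ι 1 k * star S.1 ∈
          ((T.crossedProduct β V).alg : Set (TotalSpace m ι H₀ →L[ℂ] TotalSpace m ι H₀)) := by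
        rw [← h.alg]
        exact ⟨_, T.crossedOp_mem_alg β V (one_mem _) k, rfl⟩
      exact h2
    obtain ⟨b, hb, hbp⟩ := T.exists_entry_eq β V h1 k
    refine ⟨b, hb, fun p => ?_⟩
    have h2 := ((hB.mul (T.isBlockOp_crossedOp β 1 k)).mul hBs).entry_eq p
    have h3 := (hbp p).symm.trans h2
    rw [map_one, map_one, tens_mul, tens_mul, one_mul, one_mul, mul_one] at h3
    exact (tens_one_injective h3).symm
  choose b hbs hb using halg
  have hinj : ∀ {x y : B}, T.rep x = T.rep y → x = y := fun h => T.rep_injective h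
  have hυrep : ∀ k, T.rep (β.act k (b k)) = u k * star (u 0) := fun k => by
    rw [← hb k k, sub_self]
  have hυu : ∀ k, β.act k (b k) ∈ unitary B := fun k => by
    refine Unitary.mem_iff.mpr ⟨hinj ?_, hinj ?_⟩
    · rw [map_mul, map_star, hυrep, star_mul, star_star, map_one, mul_assoc,
        ← mul_assoc (star (u k)), hmul', one_mul, hmul]
    · rw [map_mul, map_star, hυrep, star_mul, star_star, map_one, mul_assoc,
        ← mul_assoc (star (u 0)), hmul', one_mul, hmul]
  have hX0 := (hX 0).adj T.D_selfAdjoint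
  have hX0rep : ∀ c ∈ T.smooth, star (X 0) * T.rep c = T.rep c * star (X 0) := fun c hc => by
    have := congrArg star (hXrep 0 (star c) (star_mem hc))
    rw [star_mul, star_mul, map_star, star_star] at this
    exact this.symm
  have hcen : ∀ k c, β.act k (b k) * c = c * β.act k (b k) := fun k c => hinj (by
    rw [map_mul, map_mul, hυrep, mul_assoc, hrep', ← mul_assoc, hrep, mul_assoc])
  -- The Leibniz rule for u(k) u(0)*; both terms are built from operators that commute with 𝓑.
  have hd : ∀ k, T.d (β.act k (b k)) = X k * star (u 0) + u k * -star (X 0) := fun k => by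
    have h1 := (hX k).mul hX0
    rw [← hυrep] at h1
    exact h1.commutator_eq T.dense_domain
  refine ⟨fun k => ⟨β.act k (b k), hυu k⟩, ⟨fun k => ⟨β.act_smooth _ _ (hbs k),
    fun c _ => hcen k c, fun c hc => ?_⟩, fun k l => hinj ?_⟩,
    ⟨u 0, Unitary.mem_iff.mpr ⟨hmul' 0, hmul 0⟩⟩, ⟨heven 0, fun c _ => hrep 0 c, hcliff 0,
    X 0, hX 0, hXrep 0⟩, ?_⟩
  · change T.d (β.act k (b k)) * _ = _ * T.d (β.act k (b k))
    rw [hd, add_mul, mul_add, mul_assoc, hrep', ← mul_assoc, hXrep k c hc, mul_assoc, mul_neg,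
      neg_mul, mul_neg, mul_assoc, hX0rep c hc, ← mul_assoc (u k), hrep, mul_assoc]
  -- The cocycle identity: u(k + l) u(0)* = u(k + l) u(k)* · u(k) u(0)*, where the first factor is
  -- β_{k+l}(b_l) = β_k(υ(l)).
  · change T.rep (β.act (k + l) (b (k + l))) = T.rep (β.act k (b k) * β.act k (β.act l (b l)))
    rw [hcen, map_mul, ← β.act_add, ← hb l, hυrep, hυrep, add_sub_cancel_right, mul_assoc,
      ← mul_assoc (star (u k)), hmul', one_mul]
  · refine hB.congr (fun _ => rfl) fun k => congrArg _ ?_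
    change u k = u 0 * T.rep (β.act k (b k))
    rw [hrep, hυrep, mul_assoc, hmul', mul_one]

end Converse

end SpectralTriple

end CrossGauge
end

/-! ### Comparison of the topologies. -/

noncomputable section
namespace CrossGauge

/-! ### Induced topologies -/

/-- Extended distances are used because uniform convergence on the infinite set ℤᵐ gives arbitrary
functions possibly infinite distance. -/
theorem induced_le_induced_of_edist_le {X E F : Type*} [PseudoEMetricSpace E]
    [PseudoEMetricSpace F] {f : X → E} {g : X → F} (C : NNReal)
    (h : ∀ x y, edist (f x) (f y) ≤ C * edist (g x) (g y)) :
    TopologicalSpace.induced g inferInstance ≤ TopologicalSpace.induced f inferInstance := by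
  let _ : PseudoEMetricSpace X := PseudoEMetricSpace.induced g inferInstance
  have h1 : LipschitzWith C f := h
  exact continuous_iff_le_induced.mp h1.continuous

theorem isTopologicalGroup_inf_induced {G E : Type*} [Group G] [TopologicalSpace E]
    {t : TopologicalSpace G} (ht : @IsTopologicalGroup G t _) (f : G → E)
    (hmul : @Continuous (G × G) E (@instTopologicalSpaceProd _ _
      (t ⊓ TopologicalSpace.induced f inferInstance)
      (t ⊓ TopologicalSpace.induced f inferInstance)) _ fun p => f (p.1 * p.2))
    (hinv : @Continuous G E (t ⊓ TopologicalSpace.induced f inferInstance) _ fun x => f x⁻¹) :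
    @IsTopologicalGroup G (t ⊓ TopologicalSpace.induced f inferInstance) _ := by
  have hle : t ⊓ TopologicalSpace.induced f inferInstance ≤ t := inf_le_left
  refine @IsTopologicalGroup.mk G (t ⊓ TopologicalSpace.induced f inferInstance) _
    (@ContinuousMul.mk _ (t ⊓ TopologicalSpace.induced f inferInstance) _ ?_)
    (@ContinuousInv.mk _ (t ⊓ TopologicalSpace.induced f inferInstance) _ ?_)
  · exact continuous_inf_rng.mpr ⟨continuous_le_dom
      (inf_le_inf (induced_mono hle) (induced_mono hle)) ht.continuous_mul,
      continuous_induced_rng.mpr hmul⟩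
  · exact continuous_inf_rng.mpr ⟨continuous_le_dom hle ht.continuous_inv,
      continuous_induced_rng.mpr hinv⟩

/-- Here `l` is a homomorphism and `n` a cocycle for conjugation by `c`; their values on products
and inverses depend continuously on `l`, `n` and `c`. It is applied with the weighted υ [D₀, υ*],
with w [D₀, w*] and with w. -/
theorem isTopologicalGroup_of_cocycles {G A R : Type*} [Group G] [AddGroup A] [TopologicalSpace A]
    [IsTopologicalAddGroup A] [Ring R] [StarRing R] [TopologicalSpace R] [IsTopologicalRing R]
    [ContinuousStar R] {t : TopologicalSpace G} (ht : @IsTopologicalGroup G t _) {c : G → R}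
    (hc : @Continuous G R t _ c) {l : G → A} {n : G → R}
    (hl : ∀ x y, l (x * y) = l x + l y) (hl' : ∀ x, l x⁻¹ = -l x)
    (hn : ∀ x y, n (x * y) = n x + c x * n y * star (c x))
    (hn' : ∀ x, n x⁻¹ = -(star (c x) * n x * c x)) :
    @IsTopologicalGroup G
      (t ⊓ TopologicalSpace.induced (fun x => (l x, n x)) inferInstance) _ := by
  let s : TopologicalSpace G := t ⊓ TopologicalSpace.induced (fun x => (l x, n x)) inferInstance
  have hln : @Continuous G (A × R) s _ fun x => (l x, n x) :=
    continuous_iff_le_induced.mpr inf_le_right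
  have hl1 : @Continuous G A s _ l := continuous_fst.comp hln
  have hn1 : @Continuous G R s _ n := continuous_snd.comp hln
  have hc1 : @Continuous G R s _ c := continuous_le_dom inf_le_left hc
  refine isTopologicalGroup_inf_induced ht _ ?_ ?_
  · simp only [hl, hn]
    exact ((hl1.comp continuous_fst).add (hl1.comp continuous_snd)).prodMk
      ((hn1.comp continuous_fst).add (((hc1.comp continuous_fst).mul (hn1.comp continuous_snd)).mul
        (hc1.comp continuous_fst).star))
  · simp only [hl', hn']
    exact hl1.neg.prodMk ((hc1.star.mul hn1).mul hc1).neg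

theorem enorm_le_add_of_norm_le {E F F' : Type*} [SeminormedAddGroup E] [SeminormedAddGroup F]
    [SeminormedAddGroup F'] {x : E} {y : F} {z : F'} (h : ‖x‖ ≤ ‖y‖ + ‖z‖) :
    ‖x‖ₑ ≤ ‖y‖ₑ + ‖z‖ₑ := by
  rw [← ofReal_norm, ← ofReal_norm, ← ofReal_norm, ← ENNReal.ofReal_add (norm_nonneg _)
    (norm_nonneg _)]
  exact ENNReal.ofReal_le_ofReal h

theorem enorm_le_of_norm_le {E F : Type*} [SeminormedAddGroup E] [SeminormedAddGroup F]
    {x : E} {y : F} (C : NNReal) (h : ‖x‖ ≤ C * ‖y‖) : ‖x‖ₑ ≤ C * ‖y‖ₑ := by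
  rw [← ofReal_norm, ← ofReal_norm, ← ENNReal.ofReal_coe_nnreal, ← ENNReal.ofReal_mul C.coe_nonneg]
  exact ENNReal.ofReal_le_ofReal h

theorem enorm_le_of_forall {K E : Type*} [Nonempty K] [SeminormedAddGroup E] {x : E}
    {F : K → Type*} [∀ k, SeminormedAddGroup (F k)] {y : ∀ k, F k} {C : ℝ≥0∞}
    (h : ∀ R : ℝ, (∀ k, ‖y k‖ ≤ R) → ‖x‖ ≤ R) (hC : ∀ k, ‖y k‖ₑ ≤ C) : ‖x‖ₑ ≤ C := by
  by_cases hT : C = ⊤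
  · rw [hT]
    exact le_top
  · rw [← ofReal_norm, ENNReal.ofReal_le_iff_le_toReal hT]
    refine h _ fun k => ?_
    rw [← ENNReal.ofReal_le_iff_le_toReal hT, ofReal_norm]
    exact hC k

namespace SpectralTriple

variable {m r : ℕ} {ι B H₀ : Type*} [Fintype ι] [DecidableEq ι] [CStarAlgebra B]
  [NormedAddCommGroup H₀] [InnerProductSpace ℂ H₀] [CompleteSpace H₀]
  {T : SpectralTriple r B H₀} {β : EquicontinuousAction m T} {V : SpinModule m ι}

theorem IsDiagOnDom.sub {Y Y' : (Fin m → ℤ) → Fib ι H₀ →L[ℂ] Fib ι H₀}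
    {Ω Ω' : GraphDom (T.verticalDirac V) →L[ℂ] TotalSpace m ι H₀}
    (h : T.IsDiagOnDom V Y Ω) (h' : T.IsDiagOnDom V Y' Ω') :
    T.IsDiagOnDom V (fun k => Y k - Y' k) (Ω - Ω') := fun ξ k => by
  change Ω _ k - Ω' _ k = _
  rw [h, h']
  rfl

/-! ### The topologies of the gauge group -/

section Estimates

variable (w w' : unitary (H₀ →L[ℂ] H₀)) (u u' : unitary B)

theorem norm_coe_unitary_le (w : unitary (H₀ →L[ℂ] H₀)) : ‖(w : H₀ →L[ℂ] H₀)‖ ≤ 1 :=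
  norm_le_one_of_star_mul (Unitary.coe_star_mul_self w)

theorem norm_rep_unitary_le (u : unitary B) : ‖T.rep u‖ ≤ 1 :=
  norm_le_one_of_star_mul (by rw [← map_star, rep_star_mul_rep])

theorem norm_gauge_sub_le :
    ‖(w : H₀ →L[ℂ] H₀) * T.rep u - (w' : H₀ →L[ℂ] H₀) * T.rep u'‖ ≤
      ‖T.rep u - T.rep u'‖ + ‖(w : H₀ →L[ℂ] H₀) - w'‖ := by
  have e : (w : H₀ →L[ℂ] H₀) * T.rep u - (w' : H₀ →L[ℂ] H₀) * T.rep u' =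
      (w : H₀ →L[ℂ] H₀) * (T.rep u - T.rep u') + ((w : H₀ →L[ℂ] H₀) - w') * T.rep u' := by
    rw [mul_sub, sub_mul]
    abel
  rw [e]
  exact (norm_add_le _ _).trans (add_le_add
    ((norm_mul_le _ _).trans (mul_le_of_le_one_left (norm_nonneg _) (norm_coe_unitary_le w)))
    ((norm_mul_le _ _).trans (mul_le_of_le_one_right (norm_nonneg _) (norm_rep_unitary_le u'))))

/-- u is recovered from wu as w*(wu). The error in w enters in addition to that in wu, hence the
factor 2 in the comparison of υ with S. -/
theorem norm_rep_sub_le :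
    ‖T.rep u - T.rep u'‖ ≤
      ‖(w : H₀ →L[ℂ] H₀) * T.rep u - (w' : H₀ →L[ℂ] H₀) * T.rep u'‖ +
        ‖(w : H₀ →L[ℂ] H₀) - w'‖ := by
  have e : T.rep u - T.rep u' =
      star (w : H₀ →L[ℂ] H₀) * ((w : H₀ →L[ℂ] H₀) * T.rep u - (w' : H₀ →L[ℂ] H₀) * T.rep u') -
        star (w : H₀ →L[ℂ] H₀) * ((w : H₀ →L[ℂ] H₀) - w') * T.rep u' := by
    rw [mul_sub, mul_sub, sub_mul, ← mul_assoc, ← mul_assoc, Unitary.coe_star_mul_self, one_mul,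
      one_mul]
    abel
  have hs : ‖star (w : H₀ →L[ℂ] H₀)‖ ≤ 1 := by
    rw [norm_star]
    exact norm_coe_unitary_le w
  rw [e]
  refine (norm_sub_le _ _).trans (add_le_add ?_ ?_)
  · exact (norm_mul_le _ _).trans (mul_le_of_le_one_left (norm_nonneg _) hs)
  · refine (norm_mul_le _ _).trans ((mul_le_of_le_one_right (norm_nonneg _)
      (norm_rep_unitary_le u')).trans ?_)
    exact (norm_mul_le _ _).trans (mul_le_of_le_one_left (norm_nonneg _) hs)

end Estimates

section Topology

/-- `υ` as an element of `ℓ^∞(ℤᵐ, 𝐋(H₀))`. -/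
def uniformPart (p : T.unitaryCocycles β × T.constantGauge) :
    UniformFun (Fin m → ℤ) (H₀ →L[ℂ] H₀) := UniformFun.ofFun fun k => T.rep (p.1.1 k : B)

/-- `w` as an operator. -/
def constPart (p : T.unitaryCocycles β × T.constantGauge) : H₀ →L[ℂ] H₀ := (p.2.1 : H₀ →L[ℂ] H₀)

/-- `υ [D₀, υ*]` with its weight. -/
def logPart (p : T.unitaryCocycles β × T.constantGauge) :
    UniformFun (Fin m → ℤ) (H₀ →L[ℂ] H₀) :=
  UniformFun.ofFun fun k => weight k • T.logForm (p.1.1 k : B)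

/-- `w [D₀, w*]`. -/
def constFormPart (p : T.unitaryCocycles β × T.constantGauge) : H₀ →L[ℂ] H₀ :=
  T.constForm (p.2.1 : H₀ →L[ℂ] H₀)

theorem prod_uniformTopology :
    @instTopologicalSpaceProd _ _ (T.cocycleUniformTopology β) T.constantNormTopology =
      TopologicalSpace.induced
        (fun p : T.unitaryCocycles β × T.constantGauge => (uniformPart p, constPart p))
        inferInstance := by
  change TopologicalSpace.induced _ _ ⊓ TopologicalSpace.induced _ _ =
    TopologicalSpace.induced _ (TopologicalSpace.induced _ _ ⊓ TopologicalSpace.induced _ _)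
  rw [induced_compose, induced_compose, induced_inf, induced_compose, induced_compose]
  rfl

theorem prod_gaugeTopology :
    @instTopologicalSpaceProd _ _ (T.cocycleGaugeTopology β) T.constantGaugeTopology =
      TopologicalSpace.induced
        (fun p : T.unitaryCocycles β × T.constantGauge => (uniformPart p, constPart p))
        inferInstance ⊓ TopologicalSpace.induced
        (fun p : T.unitaryCocycles β × T.constantGauge => (logPart p, constFormPart p))
        inferInstance := by
  change TopologicalSpace.induced _ (TopologicalSpace.induced _ _ ⊓ TopologicalSpace.induced _ _) ⊓
    TopologicalSpace.induced _ (TopologicalSpace.induced _ _ ⊓ TopologicalSpace.induced _ _) =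
    TopologicalSpace.induced _ (TopologicalSpace.induced _ _ ⊓ TopologicalSpace.induced _ _) ⊓
    TopologicalSpace.induced _ (TopologicalSpace.induced _ _ ⊓ TopologicalSpace.induced _ _)
  simp only [induced_inf, induced_compose]
  exact inf_inf_inf_comm _ _ _ _

variable {U : (T.unitaryCocycles β × T.constantGauge) →*
    unitary (TotalSpace m ι H₀ →L[ℂ] TotalSpace m ι H₀)}

/-- υ(0) = 1, so w is the fibre over 0 of the gauge transformation. -/
theorem edist_const_le (V : SpinModule m ι) (hU : ∀ p, T.IsGaugeOp p.1.1 p.2.1 (U p).1)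
    (p q : T.unitaryCocycles β × T.constantGauge) :
    edist (constPart p) (constPart q) ≤ edist (U p).1 (U q).1 := by
  have := V.nonempty
  rw [edist_eq_enorm_sub, edist_eq_enorm_sub]
  have h1 : ‖constPart p - constPart q‖ ≤ ‖(U p).1 - (U q).1‖ := by
    have h2 := (IsBlockOp.sub (hU p) (hU q)).norm_apply_le 0
    rw [← tens_sub, norm_tens_one, unitaryCocycles_zero p.1.2, unitaryCocycles_zero q.1.2] at h2
    rw [constPart, constPart]
    simpa using h2
  exact enorm_le_iff_norm_le.mpr h1

theorem edist_uniform_le (V : SpinModule m ι) (hU : ∀ p, T.IsGaugeOp p.1.1 p.2.1 (U p).1)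
    (p q : T.unitaryCocycles β × T.constantGauge) :
    edist (uniformPart p) (uniformPart q) ≤ 2 * edist (U p).1 (U q).1 := by
  have := V.nonempty
  rw [UniformFun.edist_le]
  intro k
  have h1 := enorm_le_add_of_norm_le
    (norm_rep_sub_le (T := T) p.2.1 q.2.1 (p.1.1 k) (q.1.1 k))
  have h2 := (IsBlockOp.sub (hU p) (hU q)).norm_apply_le k
  rw [← tens_sub, norm_tens_one] at h2
  have h3 := edist_const_le V hU p q
  rw [two_mul]
  refine (edist_eq_enorm_sub _ _).trans_le (h1.trans (add_le_add ?_ ?_))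
  · rw [edist_eq_enorm_sub]
    exact enorm_le_iff_norm_le.mpr h2
  · rw [← edist_eq_enorm_sub]
    exact h3

theorem edist_gauge_le (V : SpinModule m ι) (hU : ∀ p, T.IsGaugeOp p.1.1 p.2.1 (U p).1)
    (p q : T.unitaryCocycles β × T.constantGauge) :
    edist (U p).1 (U q).1 ≤
      edist (uniformPart p) (uniformPart q) + edist (constPart p) (constPart q) := by
  have := V.nonempty
  have hb := IsBlockOp.sub (hU p) (hU q)
  rw [edist_eq_enorm_sub]
  refine enorm_le_of_forall (y := fun k => tens (1 : Matrix ι ι ℂ)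
    ((p.2.1 : H₀ →L[ℂ] H₀) * T.rep (p.1.1 k : B)) - tens (1 : Matrix ι ι ℂ)
    ((q.2.1 : H₀ →L[ℂ] H₀) * T.rep (q.1.1 k : B)))
    (fun R hR => hb.norm_le_of_diag ((norm_nonneg _).trans (hR 0)) hR) fun k => ?_
  have h1 := enorm_le_add_of_norm_le
    (norm_gauge_sub_le (T := T) p.2.1 q.2.1 (p.1.1 k) (q.1.1 k))
  have h2 : ‖tens (1 : Matrix ι ι ℂ) ((p.2.1 : H₀ →L[ℂ] H₀) * T.rep (p.1.1 k : B)) -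
      tens (1 : Matrix ι ι ℂ) ((q.2.1 : H₀ →L[ℂ] H₀) * T.rep (q.1.1 k : B))‖ₑ =
      ‖(p.2.1 : H₀ →L[ℂ] H₀) * T.rep (p.1.1 k : B) -
        (q.2.1 : H₀ →L[ℂ] H₀) * T.rep (q.1.1 k : B)‖ₑ := by
    rw [← tens_sub, ← ofReal_norm, norm_tens_one, ofReal_norm]
  rw [h2]
  refine h1.trans (add_le_add ?_ ?_)
  · rw [← edist_eq_enorm_sub]
    exact UniformFun.edist_le.mp le_rfl k
  · rw [← edist_eq_enorm_sub]
    exact le_rfl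

theorem prod_uniformTopology_eq (V : SpinModule m ι)
    (hU : ∀ p, T.IsGaugeOp p.1.1 p.2.1 (U p).1) :
    @instTopologicalSpaceProd _ _ (T.cocycleUniformTopology β) T.constantNormTopology =
      TopologicalSpace.induced U inferInstance := by
  rw [prod_uniformTopology]
  refine le_antisymm (induced_le_induced_of_edist_le 2 fun p q => ?_)
    (induced_le_induced_of_edist_le 2 fun p q => ?_)
  · rw [Subtype.edist_eq, Prod.edist_eq]
    refine (edist_gauge_le V hU p q).trans ?_
    rw [ENNReal.coe_ofNat, two_mul]
    exact add_le_add (le_max_left _ _) (le_max_right _ _)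
  · rw [Subtype.edist_eq, Prod.edist_eq]
    refine max_le (edist_uniform_le V hU p q) ((edist_const_le V hU p q).trans ?_)
    rw [ENNReal.coe_ofNat, two_mul]
    exact le_self_add

theorem gaugeShift_isDiagOnDom (V : SpinModule m ι) (hker : T.DescendsToForms β)
    (hinv : T.CentralFormsInvariant β)
    (hU : ∀ p, T.IsGaugeOp p.1.1 p.2.1 (U p).1) (p : T.unitaryCocycles β × T.constantGauge) :
    T.IsDiagOnDom V (fun k => tens V.grading
      (T.logForm (p.1.1 k : B) + T.constForm (p.2.1 : H₀ →L[ℂ] H₀)))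
      ((T.crossedProduct β V).gaugeShift (U p).1) := by
  obtain ⟨R, hR⟩ := exists_norm_log_add_const_le hker hinv p.1.2
    (T.constForm (p.2.1 : H₀ →L[ℂ] H₀))
  obtain ⟨Ω, hΩ, -⟩ := exists_isDiagOnDom (T := T) (V := V) (R := R)
    (Y := fun k => tens V.grading
      (T.logForm (p.1.1 k : B) + T.constForm (p.2.1 : H₀ →L[ℂ] H₀)))
    (fun k => by rw [V.norm_tens_grading]; exact hR k)
  rw [(hU p).gaugeShift_eq hker hinv p.1.2 p.2.2 hΩ]
  exact hΩ

/-- The difference of two shifts has the form of a potential, with a first part that vanishes at 0,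
so the norm estimates for potentials compare the gauge topologies. -/
theorem gaugeShift_sub_isDiagOnDom (V : SpinModule m ι) (hker : T.DescendsToForms β)
    (hinv : T.CentralFormsInvariant β)
    (hU : ∀ p, T.IsGaugeOp p.1.1 p.2.1 (U p).1) (p q : T.unitaryCocycles β × T.constantGauge) :
    T.IsDiagOnDom V (fun k => tens V.grading
      ((T.logDeriv p.1.1 - T.logDeriv q.1.1) k + (constFormPart p - constFormPart q)))
      ((T.crossedProduct β V).gaugeShift (U p).1 - (T.crossedProduct β V).gaugeShift (U q).1) :=
  ((gaugeShift_isDiagOnDom V hker hinv hU p).sub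
    (gaugeShift_isDiagOnDom V hker hinv hU q)).congr fun k => by
    rw [← tens_sub, add_sub_add_comm]
    rfl

theorem logDeriv_sub_zero (hinv : T.CentralFormsInvariant β)
    (p q : T.unitaryCocycles β × T.constantGauge) :
    (T.logDeriv p.1.1 - T.logDeriv q.1.1) 0 = 0 := by
  rw [Pi.sub_apply, formCocycles_zero (logDeriv_mem hinv p.1.2),
    formCocycles_zero (logDeriv_mem hinv q.1.2), sub_zero]

theorem edist_constForm_le (V : SpinModule m ι) (hker : T.DescendsToForms β)
    (hinv : T.CentralFormsInvariant β)
    (hU : ∀ p, T.IsGaugeOp p.1.1 p.2.1 (U p).1) (p q : T.unitaryCocycles β × T.constantGauge) :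
    edist (constFormPart p) (constFormPart q) ≤
      edist ((T.crossedProduct β V).gaugeShift (U p).1)
        ((T.crossedProduct β V).gaugeShift (U q).1) := by
  rw [edist_eq_enorm_sub, edist_eq_enorm_sub]
  exact enorm_le_iff_norm_le.mpr
    ((gaugeShift_sub_isDiagOnDom V hker hinv hU p q).norm_const_le (logDeriv_sub_zero hinv p q))

theorem edist_log_le (V : SpinModule m ι) (hker : T.DescendsToForms β)
    (hinv : T.CentralFormsInvariant β)
    (hU : ∀ p, T.IsGaugeOp p.1.1 p.2.1 (U p).1) (p q : T.unitaryCocycles β × T.constantGauge) :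
    edist (logPart p) (logPart q) ≤
      2 * edist ((T.crossedProduct β V).gaugeShift (U p).1)
        ((T.crossedProduct β V).gaugeShift (U q).1) := by
  rw [UniformFun.edist_le]
  intro k
  have h1 := (gaugeShift_sub_isDiagOnDom V hker hinv hU p q).norm_cocycle_le
    (logDeriv_sub_zero hinv p q) k
  rw [edist_eq_enorm_sub ((T.crossedProduct β V).gaugeShift (U p).1)]
  refine (edist_eq_enorm_sub _ _).trans_le (enorm_le_of_norm_le 2 ?_)
  change ‖weight k • T.logForm (p.1.1 k : B) - weight k • T.logForm (q.1.1 k : B)‖ ≤ _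
  rw [← smul_sub, norm_smul, Real.norm_of_nonneg (weight_pos k).le]
  exact h1

theorem edist_gaugeShift_le (V : SpinModule m ι) (hker : T.DescendsToForms β)
    (hinv : T.CentralFormsInvariant β)
    (hU : ∀ p, T.IsGaugeOp p.1.1 p.2.1 (U p).1) (p q : T.unitaryCocycles β × T.constantGauge) :
    edist ((T.crossedProduct β V).gaugeShift (U p).1)
        ((T.crossedProduct β V).gaugeShift (U q).1) ≤
      edist (logPart p) (logPart q) + edist (constFormPart p) (constFormPart q) := by
  have hd := gaugeShift_sub_isDiagOnDom V hker hinv hU p q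
  rw [edist_eq_enorm_sub]
  refine enorm_le_of_forall (y := fun k => weight k •
    ((T.logDeriv p.1.1 - T.logDeriv q.1.1) k + (constFormPart p - constFormPart q)))
    (fun R hR => hd.norm_le fun k => ?_) fun k => ?_
  · have := hR k
    rw [norm_smul, Real.norm_of_nonneg (weight_pos k).le, weight_mul_le_iff] at this
    rwa [V.norm_tens_grading]
  · have h1 : ‖weight k • ((T.logDeriv p.1.1 - T.logDeriv q.1.1) k +
        (constFormPart p - constFormPart q))‖ ≤
        ‖weight k • T.logForm (p.1.1 k : B) - weight k • T.logForm (q.1.1 k : B)‖ +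
          ‖constFormPart p - constFormPart q‖ := by
      rw [smul_add, ← smul_sub]
      refine (norm_add_le _ _).trans (add_le_add le_rfl ?_)
      rw [norm_smul, Real.norm_of_nonneg (weight_pos k).le]
      exact mul_le_of_le_one_left (norm_nonneg _) (weight_le_one k)
    refine (enorm_le_add_of_norm_le h1).trans (add_le_add ?_ ?_)
    · rw [← edist_eq_enorm_sub]
      exact UniformFun.edist_le.mp le_rfl k
    · rw [← edist_eq_enorm_sub]

theorem prod_gaugeTopology_eq (V : SpinModule m ι) (hker : T.DescendsToForms β)
    (hinv : T.CentralFormsInvariant β)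
    (hU : ∀ p, T.IsGaugeOp p.1.1 p.2.1 (U p).1) :
    @instTopologicalSpaceProd _ _ (T.cocycleGaugeTopology β) T.constantGaugeTopology =
      TopologicalSpace.induced U (T.crossedProduct β V).gaugeTopology := by
  have h1 := prod_uniformTopology_eq V hU
  rw [prod_uniformTopology] at h1
  rw [prod_gaugeTopology, h1]
  -- The norm topologies already agree by `h1`; what remains is to compare the shift with the pair
  -- of logarithmic derivatives.
  have h2 : TopologicalSpace.induced
      (fun p : T.unitaryCocycles β × T.constantGauge => (logPart p, constFormPart p))
      inferInstance = TopologicalSpace.induced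
      (fun p => (T.crossedProduct β V).gaugeShift (U p).1) inferInstance := by
    refine le_antisymm (induced_le_induced_of_edist_le 2 fun p q => ?_)
      (induced_le_induced_of_edist_le 2 fun p q => ?_)
    · rw [Prod.edist_eq]
      refine (edist_gaugeShift_le V hker hinv hU p q).trans ?_
      rw [ENNReal.coe_ofNat, two_mul]
      exact add_le_add (le_max_left _ _) (le_max_right _ _)
    · rw [Prod.edist_eq]
      refine max_le (edist_log_le V hker hinv hU p q)
        ((edist_constForm_le V hker hinv hU p q).trans ?_)
      rw [ENNReal.coe_ofNat, two_mul]
      exact le_self_add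
  rw [h2]
  change TopologicalSpace.induced U (TopologicalSpace.induced _ _) ⊓ _ =
    TopologicalSpace.induced U (TopologicalSpace.induced _
      (TopologicalSpace.induced _ _ ⊓ TopologicalSpace.induced _ _))
  simp only [induced_inf, induced_compose]
  rfl

theorem isTopologicalGroup_uniform (V : SpinModule m ι)
    (hU : ∀ p, T.IsGaugeOp p.1.1 p.2.1 (U p).1) :
    @IsTopologicalGroup (T.unitaryCocycles β × T.constantGauge)
      (@instTopologicalSpaceProd _ _ (T.cocycleUniformTopology β) T.constantNormTopology) _ := by
  rw [prod_uniformTopology_eq V hU]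
  exact topologicalGroup_induced U

/-- The shift S D S* - D is not multiplicative, so being induced along the homomorphism does not
suffice; the cocycle formulas for the two logarithmic derivatives are used instead. -/
theorem isTopologicalGroup_gauge (V : SpinModule m ι)
    (hU : ∀ p, T.IsGaugeOp p.1.1 p.2.1 (U p).1) :
    @IsTopologicalGroup (T.unitaryCocycles β × T.constantGauge)
      (@instTopologicalSpaceProd _ _ (T.cocycleGaugeTopology β) T.constantGaugeTopology) _ := by
  have h1 := isTopologicalGroup_uniform V hU
  rw [prod_uniformTopology] at h1
  rw [prod_gaugeTopology]
  have hc : @Continuous _ _ (TopologicalSpace.induced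
      (fun p : T.unitaryCocycles β × T.constantGauge => (uniformPart p, constPart p))
      inferInstance) _ constPart :=
    @Continuous.comp _ _ _ (TopologicalSpace.induced _ _) _ _
      (fun p : T.unitaryCocycles β × T.constantGauge => (uniformPart p, constPart p)) Prod.snd
      continuous_snd continuous_induced_dom
  refine isTopologicalGroup_of_cocycles h1 hc (fun p q => ?_) (fun p => ?_) (fun p q => ?_)
    fun p => ?_
  · change UniformFun.ofFun _ = UniformFun.ofFun _
    congr 1
    funext k
    change weight k • T.logForm ((p.1.1 k : B) * (q.1.1 k : B)) = weight k • T.logForm (p.1.1 k : B) +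
      weight k • T.logForm (q.1.1 k : B)
    rw [logForm_mul (p.1.2.1 k) (q.1.2.1 k), smul_add]
  · change UniformFun.ofFun _ = UniformFun.ofFun _
    congr 1
    funext k
    change weight k • T.logForm (star (p.1.1 k : B)) = -(weight k • T.logForm (p.1.1 k : B))
    rw [logForm_star (p.1.2.1 k), smul_neg]
  · exact constForm_mul p.2.2 q.2.2
  · exact constForm_star p.2.2

end Topology

end SpectralTriple

end CrossGauge
end

/-! ### The affine action, and assembly of the theorem. -/

noncomputable section
namespace CrossGauge
namespace SpectralTriple

variable {m r : ℕ} {ι B H₀ : Type*} [Fintype ι] [DecidableEq ι] [CStarAlgebra B]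
  [NormedAddCommGroup H₀] [InnerProductSpace ℂ H₀] [CompleteSpace H₀]
  {T : SpectralTriple r B H₀} {β : EquicontinuousAction m T} {V : SpinModule m ι}

/-! ### The affine action of gauge transformations on relative gauge potentials -/

/-- u commutes with both x and M, while w commutes with the one-form x and only conjugates M. -/
theorem conj_gauge_form {w : unitary (H₀ →L[ℂ] H₀)} (hw : w ∈ T.constantGauge) (u : unitary B)
    {x M : H₀ →L[ℂ] H₀} (hx : x ∈ T.centralForms) (hM : M ∈ T.oddCommutant) :
    (w : H₀ →L[ℂ] H₀) * T.rep u * (x + M) * star ((w : H₀ →L[ℂ] H₀) * T.rep u) =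
      x + w * M * star (w : H₀ →L[ℂ] H₀) := by
  have h1 : T.rep u * (x + M) * star (T.rep u) = x + M := by
    rw [mul_add, ← T.centralForms_comm hx, ← hM.2.2.1, ← add_mul, mul_assoc, ← map_star,
      ← map_mul, Unitary.mul_star_self_of_mem u.2, map_one, mul_one]
  calc (w : H₀ →L[ℂ] H₀) * T.rep u * (x + M) * star ((w : H₀ →L[ℂ] H₀) * T.rep u)
      = w * (T.rep u * (x + M) * star (T.rep u)) * star (w : H₀ →L[ℂ] H₀) := by
        simp only [star_mul, mul_assoc]
    _ = _ := by
        rw [h1, mul_add, ← constantGauge_comm_oneForms hw hx.1, add_mul, mul_assoc x,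
          Unitary.mul_star_self_of_mem w.2, mul_one]

theorem IsGaugeOp.affine_action {υ : (Fin m → ℤ) → unitary B} {w : unitary (H₀ →L[ℂ] H₀)}
    {S : TotalSpace m ι H₀ →L[ℂ] TotalSpace m ι H₀} (hυ : υ ∈ T.unitaryCocycles β)
    (hw : w ∈ T.constantGauge) (h : T.IsGaugeOp υ w S) {ω : (Fin m → ℤ) → (H₀ →L[ℂ] H₀)}
    {M : H₀ →L[ℂ] H₀} (hω : ω ∈ T.formCocycles β) (hM : M ∈ T.oddCommutant)
    {Ω Ω' : GraphDom (T.verticalDirac V) →L[ℂ] TotalSpace m ι H₀}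
    (hΩ : T.IsDiagOnDom V (fun k => tens V.grading (ω k + M)) Ω)
    (hΩ' : T.IsDiagOnDom V (fun k => tens V.grading ((ω + T.logDeriv υ) k +
      (T.constForm (w : H₀ →L[ℂ] H₀) + w * M * star (w : H₀ →L[ℂ] H₀)))) Ω')
    {ξ : TotalSpace m ι H₀} (hξ : ξ ∈ (T.totalDirac V).domain)
    (hS : star S ξ ∈ (T.totalDirac V).domain) :
    (S (T.totalDirac V ⟨star S ξ, hS⟩) - T.totalDirac V ⟨ξ, hξ⟩) +
        S (Ω (toGraphDom (T.verticalDirac V) ⟨_, T.domain_totalDirac_le V hS⟩)) =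
      Ω' (toGraphDom (T.verticalDirac V) ⟨_, T.domain_totalDirac_le V hξ⟩) := by
  ext1
  funext k
  rw [lp.coeFn_add, Pi.add_apply, h.conj_totalDirac_apply hυ hw hξ hS, h, hΩ, hΩ',
    h.star_isBlockOp]
  change _ + (tens (1 : Matrix ι ι ℂ) ((w : H₀ →L[ℂ] H₀) * T.rep (υ k : B)) *
    tens V.grading (ω k + M) *
    tens (1 : Matrix ι ι ℂ) (star ((w : H₀ →L[ℂ] H₀) * T.rep (υ k : B)))) (ξ k) = _
  rw [tens_mul, tens_mul, one_mul, mul_one, conj_gauge_form hw _ (hω.1 k) hM,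
    ← add_apply, ← tens_add]
  congr 2
  change _ = ω k + T.logForm (υ k : B) + _
  abel

end SpectralTriple
end CrossGauge
end

open CrossGauge CrossGauge.SpectralTriple

theorem mainTheorem8 {m r : ℕ} {ι B H₀ : Type*} [Fintype ι] [DecidableEq ι] [CStarAlgebra B]
    [NormedAddCommGroup H₀] [InnerProductSpace ℂ H₀] [CompleteSpace H₀]
    (T : CrossGauge.SpectralTriple r B H₀) (β : CrossGauge.EquicontinuousAction m T)
    (V : CrossGauge.SpinModule m ι)
    (hker : T.DescendsToForms β) (hinv : T.CentralFormsInvariant β) :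
    ∃ (F : (T.formCocycles β × T.oddCommutant) ≃ₗ[ℝ] (T.crossedProduct β V).potentials)
      (U : (T.unitaryCocycles β × T.constantGauge) →*
        unitary (CrossGauge.TotalSpace m ι H₀ →L[ℂ] CrossGauge.TotalSpace m ι H₀)),
      -- `𝔞𝔱` is the set of relative gauge potentials, and `F(ω, M) = Op(id ⊗̂ (ω + M))`
      ((T.crossedProduct β V).potentials : Set _) =
          {a | (T.crossedProduct β V).IsRelativeGaugePotential a} ∧
      (∀ (ω : T.formCocycles β) (M : T.oddCommutant) (ξ : (T.crossedProduct β V).Dv.domain)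
        (k : Fin m → ℤ),
        (F (ω, M)).1 (CrossGauge.toGraphDom (T.crossedProduct β V).Dv ξ) k =
          T.idTens V (ω.1 k + M.1) (ξ.1 k)) ∧
      -- the norm on `Z¹` is finite, and `F` and its inverse are bounded
      (∀ ω : T.formCocycles β,
        BddAbove (Set.range fun k => CrossGauge.SpectralTriple.weight k * ‖ω.1 k‖)) ∧
      (∃ c C : ℝ, 0 < c ∧ ∀ (ω : T.formCocycles β) (M : T.oddCommutant),
        c * (CrossGauge.SpectralTriple.cocycleNorm ω.1 + ‖M‖) ≤ ‖F (ω, M)‖ ∧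
        ‖F (ω, M)‖ ≤ C * (CrossGauge.SpectralTriple.cocycleNorm ω.1 + ‖M‖)) ∧
      -- `F` descends to a surjection `H¹ → 𝔞𝔱 / ℜ`
      (∃ q : (T.formCocycles β ⧸ T.formCoboundaries β) →ₗ[ℝ]
          ((T.crossedProduct β V).potentials ⧸ (T.crossedProduct β V).boundedPotentials),
        Function.Surjective q ∧ ∀ (ω : T.formCocycles β) (M : T.oddCommutant),
          q (Submodule.Quotient.mk ω) = Submodule.Quotient.mk (F (ω, M))) ∧
      -- `U(υ, w) = Op(id ⊗̂ w υ)` is an isomorphism of groups onto `𝔊`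
      (∀ (υ : T.unitaryCocycles β) (w : T.constantGauge) (ξ : CrossGauge.TotalSpace m ι H₀)
        (k : Fin m → ℤ),
        (U (υ, w)).1 ξ k = T.idTens V (w.1.1 * T.rep (υ.1 k).1) (ξ k)) ∧
      Function.Injective U ∧
      Set.range U = (T.crossedProduct β V).gaugeGroup ∧
      -- it is a homeomorphism for the gauge topologies, which are group topologies
      (@instTopologicalSpaceProd _ _ (T.cocycleGaugeTopology β) T.constantGaugeTopology =
        TopologicalSpace.induced U (T.crossedProduct β V).gaugeTopology) ∧
      (@IsTopologicalGroup (T.unitaryCocycles β × T.constantGauge)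
        (@instTopologicalSpaceProd _ _ (T.cocycleGaugeTopology β) T.constantGaugeTopology) _) ∧
      -- and also for the topologies of uniform convergence and of the operator norm
      (@instTopologicalSpaceProd _ _ (T.cocycleUniformTopology β) T.constantNormTopology =
        TopologicalSpace.induced U inferInstance) ∧
      (@IsTopologicalGroup (T.unitaryCocycles β × T.constantGauge)
        (@instTopologicalSpaceProd _ _ (T.cocycleUniformTopology β) T.constantNormTopology) _) ∧
      -- `F` and `U` intertwine the gauge actions: on `Dom D`,
      -- `S [D, S*] + S F(ω, M) S* = F(ω + υ [D₀, υ*], w [D₀, w*] + w M w*)` for `S = U(υ, w)`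
      (∀ (ω : T.formCocycles β) (M : T.oddCommutant) (υ : T.unitaryCocycles β)
        (w : T.constantGauge), ∃ (ω' : T.formCocycles β) (M' : T.oddCommutant),
        (∀ k, ω'.1 k = ω.1 k + T.logDeriv υ.1 k) ∧
        M'.1 = w.1.1 * CrossGauge.commutator T.D (star w.1.1) + w.1.1 * M.1 * star w.1.1 ∧
        ∀ ξ : (T.crossedProduct β V).D.domain,
          ∃ (hD : (star (U (υ, w)).1) ξ.1 ∈ (T.crossedProduct β V).D.domain)
            (hS : (star (U (υ, w)).1) ξ.1 ∈ (T.crossedProduct β V).Dv.domain)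
            (hξ : ξ.1 ∈ (T.crossedProduct β V).Dv.domain),
            ((U (υ, w)).1 ((T.crossedProduct β V).D ⟨_, hD⟩) - (T.crossedProduct β V).D ξ) +
              (U (υ, w)).1 ((F (ω, M)).1
                (CrossGauge.toGraphDom (T.crossedProduct β V).Dv ⟨_, hS⟩)) =
            (F (ω', M')).1 (CrossGauge.toGraphDom (T.crossedProduct β V).Dv ⟨_, hξ⟩)) := by
  have := V.nonempty
  obtain ⟨F, hF⟩ := exists_potentialEquiv (T := T) (β := β) V hker
  obtain ⟨U, hU⟩ := exists_gaugeHom T β ι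
  refine ⟨F, U, Set.ext fun _ => mem_potentials_iff hker, fun ω M ξ k => ?_,
    fun ω => bddAbove_cocycle hker ω.2, ⟨1 / 3, 1, by norm_num, fun ω M => ⟨?_, ?_⟩⟩,
    exists_quotient_map hker F hF, fun υ w ξ k => ?_, fun p q hpq => ?_, ?_,
    prod_gaugeTopology_eq V hker hinv hU, isTopologicalGroup_gauge V hU,
    prod_uniformTopology_eq V hU, isTopologicalGroup_uniform V hU, fun ω M υ w => ?_⟩
  · rw [T.idTens_of_odd V (by
      rw [add_mul, mul_add, neg_add, T.centralForms_odd (ω.2.1 k), M.2.2.1])]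
    exact hF (ω, M) ξ k
  -- The constant 1/3 inverts the bound of the pair (ω, M) by 3‖F(ω, M)‖.
  · have h := mul_le_mul_of_nonneg_left
      ((hF (ω, M)).cocycleNorm_add_le (formCocycles_zero ω.2)) (by norm_num : (0 : ℝ) ≤ 1 / 3)
    rw [← mul_assoc, one_div_mul_cancel three_ne_zero, one_mul] at h
    exact h
  · rw [one_mul]
    exact (hF (ω, M)).norm_le (norm_tens_add_le (bddAbove_cocycle hker ω.2) M.1)
  · rw [T.idTens_of_even V (gauge_even w.2 _)]
    exact hU (υ, w) ξ k
  · have h := (hU p).ext_pair p.1.2 q.1.2 (hpq ▸ hU q)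
    exact Prod.ext (Subtype.ext h.1) (Subtype.ext h.2)
  · ext S
    constructor
    · rintro ⟨p, rfl⟩
      refine (hU p).isGaugeTransformation hker hinv p.1.2 p.2.2 ?_
      -- The adjoint of `U p` is its inverse, so it is the operator of the inverse pair.
      have h := hU p⁻¹
      rw [map_inv] at h
      exact h
    · intro hS
      obtain ⟨υ, hυ, w, hw, h⟩ := exists_isGaugeOp_of_isGaugeTransformation hS
      exact ⟨(⟨υ, hυ⟩, ⟨w, hw⟩), Subtype.ext (IsBlockOp.unique (hU (⟨υ, hυ⟩, ⟨w, hw⟩)) h)⟩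
  · have hω := add_mem ω.2 (logDeriv_mem hinv υ.2)
    have hM := add_mem (constForm_mem w.2) (conj_mem_oddCommutant w.2 M.2)
    have hF' := hF (⟨_, hω⟩, ⟨_, hM⟩)
    refine ⟨⟨_, hω⟩, ⟨_, hM⟩, fun k => rfl, rfl, fun ξ => ?_⟩
    have hS := (hU (υ, w)).star_mem_domain hker hinv υ.2 w.2 ξ.2
    have h := (hU (υ, w)).affine_action υ.2 w.2 ω.2 M.2 (hF (ω, M)) hF' ξ.2 hS
    exact ⟨hS, T.domain_totalDirac_le V hS, T.domain_totalDirac_le V ξ.2, h⟩
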